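/- **Setting.** Let $M\subset\mathbb C^N$ be a smooth ($C^\infty$) generic real submanifold of codimension $d$ with $0\in M$: near $0$, $M$ is the zero set of smooth real-valued functions $r=(r_1,\dots,r_d)$ (a *defining function*) whose differentials $dr_j$ are linearly independent over $\mathbb R$ at $0$, and the complex differentials $\partial r_1,\dots,\partial r_d$ are linearly independent over $\mathbb C$ at $0$. Put $n=N-d$. Let $\rho_j(Z,\zeta)\in\mathbb C[[Z,\zeta]]$ be the power series such that $\rho_j(Z,\bar Z)$ is the Taylor series of $r_j$ at $0$. A *Segre variety mapping* of $M$ at $0$ is an $N$-tuple $\gamma(\zeta,t)$ of formal power series without constant term in $\zeta=(\zeta_1,\dots,\zeta_N)$, $t=(t_1,\dots,t_n)$, such that $\rho(\gamma(\zeta,t),\zeta)=0$ and the matrix $\frac{\partial\gamma}{\partial t}(0,0)$ has rank $n$. The *iterated Segre mappings* relative to $\gamma$ are $$v^1(t^1)=\gamma(0,t^1),\qquad v^{j+1}(t^1,\dots,t^{j+1})=\gamma\big(\bar v^j(t^1,\dots,t^j),t^{j+1}\big),\quad t^i\in\mathbb C^n,$$ where the bar denotes complex conjugation of the coefficients. For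 a tuple $F(x)$ of formal power series, $\operatorname{Rk}F$ is the rank of the Jacobian matrix $\partial F/\partial x$ over the field of fractions of $\mathbb C[[x]]$. $M$ is of *finite type* at $0$ (Kohn, Bloom–Graham) if the Lie algebra $\mathfrak g_M$ generated by the smooth $(1,0)$ and $(0,1)$ vector fields tangent to $M$ near $0$ spans, at $0$, the complexified tangent space $\mathbb CT_0M$. **Theorem 1.1.** Let $\gamma$ be a Segre variety mapping of $M$ at $0$, and let $v^j$, $j\ge1$, be the iterated Segre mappings relative to $\gamma$. Then $\operatorname{Rk}v^j\le\operatorname{Rk}v^{j+1}$ for all $j\ge1$, and $\operatorname{Rk}v^j$ is independent of the choice of the holomorphic coordinates $Z$ (vanishing at the origin), of the defining function $r$, and of the Segre variety mapping $\gamma$. In addition, there exists an integer $k_0$ with $1\le k_0\le d+1$ such that $$\operatorname{Rk}v^j=\operatorname{Rk}v^{j+1}\ \text{ for } j\ge k_0,\qquad \operatorname{Rk}v^j<\operatorname{Rk}v^{j+1}\ \text{ for } 1\le j\le k_0-1,$$ and the following are equivalent: 1. $M$ is of finite type at $0$; 2. $\operatorname{Rk}v^{k_0}=N$. -/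

import Mathlib

open scoped ContDiff

namespace Segre

/-! ### Formal mappings and their generic rank -/

/-- The rank `Rk F` of a tuple `F` of formal power series in the indeterminates `x_s`, `s : σ`:
the rank of the Jacobian matrix `∂F/∂x` over the field of fractions of `ℂ⟦x⟧`. -/
noncomputable def genericRank {N : ℕ} {σ : Type*} [Fintype σ]
    (F : Fin N → MvPowerSeries σ ℂ) : ℕ :=
  (Matrix.of fun (k : Fin N) (s : σ) =>
    algebraMap (MvPowerSeries σ ℂ) (FractionRing (MvPowerSeries σ ℂ))
      (MvPowerSeries.pderiv ℂ s (F k))).rank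

/-- The series `f̄`, whose coefficients are the complex conjugates of those of `f`. -/
noncomputable def conjSeries {σ : Type*} (f : MvPowerSeries σ ℂ) : MvPowerSeries σ ℂ :=
  MvPowerSeries.map (starRingEnd ℂ) f

/-! ### Wirtinger derivatives and Taylor series

The index type `Fin N ⊕ Fin N` lists `Z_1, …, Z_N` (as `Sum.inl k`) followed by
`Z̄_1, …, Z̄_N`, respectively `ζ_1, …, ζ_N` (as `Sum.inr k`). -/

/-- The Wirtinger derivative `∂f/∂Z_k = (∂f/∂x_k - i ∂f/∂y_k) / 2` for `Sum.inl k`, and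
`∂f/∂Z̄_k = (∂f/∂x_k + i ∂f/∂y_k) / 2` for `Sum.inr k`, where `Z_k = x_k + i y_k`. -/
noncomputable def wirtinger {N : ℕ} :
    Fin N ⊕ Fin N → ((Fin N → ℂ) → ℂ) → (Fin N → ℂ) → ℂ
  | Sum.inl k, f => fun Z =>
      (fderiv ℝ f Z (Pi.single k 1) - Complex.I * fderiv ℝ f Z (Pi.single k Complex.I)) / 2
  | Sum.inr k, f => fun Z =>
      (fderiv ℝ f Z (Pi.single k 1) + Complex.I * fderiv ℝ f Z (Pi.single k Complex.I)) / 2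

/-- The iterated derivative `∂_Z^α ∂_Z̄^β f`, where `m = (α, β)`. (The order in which the
derivatives are taken is immaterial for smooth functions.) -/
noncomputable def iteratedWirtinger {N : ℕ} (m : (Fin N ⊕ Fin N) →₀ ℕ)
    (f : (Fin N → ℂ) → ℂ) : (Fin N → ℂ) → ℂ :=
  (List.finRange N).foldr
    (fun k g => (wirtinger (Sum.inl k))^[m (Sum.inl k)]
      ((wirtinger (Sum.inr k))^[m (Sum.inr k)] g)) f

/-- The Taylor series of `f` at `0`, written in `Z, Z̄` with `Z̄` replaced by indeterminates `ζ`: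
the coefficient of `Z^α ζ^β` is `∂_Z^α ∂_Z̄^β f (0) / (α! β!)`. -/
noncomputable def taylorSeries {N : ℕ} (f : (Fin N → ℂ) → ℂ) :
    MvPowerSeries (Fin N ⊕ Fin N) ℂ :=
  fun m => iteratedWirtinger m f 0 / ((∏ s, (m s).factorial : ℕ) : ℂ)

/-! ### Generic submanifolds near the origin -/

/-- `f` is `C^∞` on some neighbourhood of `p`. -/
def SmoothNear {N : ℕ} {F : Type*} [NormedAddCommGroup F] [NormedSpace ℝ F]
    (f : (Fin N → ℂ) → F) (p : Fin N → ℂ) : Prop :=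
  ∃ U : Set (Fin N → ℂ), IsOpen U ∧ p ∈ U ∧ ContDiffOn ℝ ∞ f U

/-- `r = (r_1, …, r_d)` is a smooth real-valued local defining function of `M` at `0`: the real
differentials `dr_j` are linearly independent at `0`, and `M` is given by `r = 0` near `0`.
In particular `M` is, near `0`, a smooth real submanifold of codimension `d`. -/
structure IsDefiningFunction {N d : ℕ} (M : Set (Fin N → ℂ))
    (r : Fin d → (Fin N → ℂ) → ℝ) : Prop where
  smooth : ∀ j, SmoothNear (r j) 0
  linearIndependent : LinearIndependent ℝ fun j => fderiv ℝ (r j) 0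
  eq_zeros : ∃ U : Set (Fin N → ℂ), IsOpen U ∧ 0 ∈ U ∧ M ∩ U = {Z | ∀ j, r j Z = 0} ∩ U

/-- `M` is, near `0 ∈ M`, a smooth generic submanifold of `ℂ^N` of codimension `d`: it has a
local defining function `r` at `0` whose complex differentials
`∂r_j = ∑_k (∂r_j/∂Z_k) dZ_k` are linearly independent over `ℂ` at `0`. -/
def IsGenericSubmanifold {N : ℕ} (M : Set (Fin N → ℂ)) (d : ℕ) : Prop :=
  (0 : Fin N → ℂ) ∈ M ∧ ∃ r : Fin d → (Fin N → ℂ) → ℝ, IsDefiningFunction M r ∧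
    LinearIndependent ℂ fun (j : Fin d) (k : Fin N) =>
      wirtinger (Sum.inl k) (fun Z => (r j Z : ℂ)) 0

/-! ### Segre variety mappings and iterated Segre mappings -/

/-- `γ(ζ, t)` is a Segre variety mapping relative to the defining function `r`, with
`ζ = (ζ_1, …, ζ_N)` (indices `Sum.inl`) and `t = (t_1, …, t_n)` (indices `Sum.inr`): a formal
mapping without constant term such that `ρ(γ(ζ, t), ζ) = 0` for the Taylor series `ρ(Z, ζ)` of
`r`, and such that `∂γ/∂t (0, 0)` has rank `n`. -/
structure IsSegreVarietyMapping {N n d : ℕ} (r : Fin d → (Fin N → ℂ) → ℝ)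
    (γ : Fin N → MvPowerSeries (Fin N ⊕ Fin n) ℂ) : Prop where
  constantCoeff : ∀ k, MvPowerSeries.constantCoeff (γ k) = 0
  subst_eq_zero : ∀ j, MvPowerSeries.subst
    (Sum.elim γ fun l : Fin N => MvPowerSeries.X (R := ℂ) (Sum.inl l : Fin N ⊕ Fin n))
    (taylorSeries fun Z => (r j Z : ℂ)) = 0
  rank_eq : (Matrix.of fun (k : Fin N) (i : Fin n) =>
    MvPowerSeries.constantCoeff (MvPowerSeries.pderiv ℂ (Sum.inr i) (γ k))).rank = n

/-- The iterated Segre mappings relative to `γ`. The indeterminate with index `(a, i)` is `t^{a+1}_i`.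
With `v^0 = 0` in no indeterminates, the recursion
`v^{j+1}(t^1, …, t^{j+1}) = γ(v̄^j(t^1, …, t^j), t^{j+1})` gives `v^1(t^1) = γ(0, t^1)`. -/
noncomputable def iteratedSegre {N n : ℕ} (γ : Fin N → MvPowerSeries (Fin N ⊕ Fin n) ℂ) :
    (j : ℕ) → Fin N → MvPowerSeries (Fin j × Fin n) ℂ
  | 0 => fun _ => 0
  | j + 1 => fun k => MvPowerSeries.subst
      (Sum.elim
        (fun l : Fin N => MvPowerSeries.rename
          (fun s : Fin j × Fin n => ((s.1.castSucc, s.2) : Fin (j + 1) × Fin n))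
          (conjSeries (iteratedSegre γ j l)))
        (fun i : Fin n => MvPowerSeries.X (R := ℂ) ((Fin.last j, i) : Fin (j + 1) × Fin n)))
      (γ k)

/-! ### Complex vector fields and finite type -/

/-- A complex vector field `X = ∑_k a_k ∂/∂Z_k + b_k ∂/∂Z̄_k` on `ℂ^N`, given by its
coefficients `a_k` (index `Sum.inl k`) and `b_k` (index `Sum.inr k`). -/
abbrev VField (N : ℕ) : Type := (Fin N → ℂ) → (Fin N ⊕ Fin N → ℂ)

/-- The complexified tangent space `ℂT_pM`: the complex tangent vectors
`v = ∑_k a_k ∂/∂Z_k + b_k ∂/∂Z̄_k` of `ℂ^N` at `p` that annihilate all smooth functions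
near `p` that vanish on `M`. -/
def complexTangentSpace {N : ℕ} (M : Set (Fin N → ℂ)) (p : Fin N → ℂ) :
    Submodule ℂ (Fin N ⊕ Fin N → ℂ) where
  carrier := {v | ∀ f : (Fin N → ℂ) → ℂ, SmoothNear f p →
    (∃ U : Set (Fin N → ℂ), IsOpen U ∧ p ∈ U ∧ ∀ Z ∈ M ∩ U, f Z = 0) →
    ∑ s, v s * wirtinger s f p = 0}
  zero_mem' := fun f _ _ => by simp
  add_mem' := fun {v w} hv hw f hf h0 => by
    have h1 := hv f hf h0
    have h2 := hw f hf h0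
    simp only [Pi.add_apply, add_mul, Finset.sum_add_distrib, h1, h2, add_zero]
  smul_mem' := fun c v hv f hf h0 => by
    have h1 := hv f hf h0
    simp only [Pi.smul_apply, smul_eq_mul, mul_assoc, ← Finset.mul_sum, h1, mul_zero]

/-- `X` is smooth near `0` and tangent to `M` at all points of `M` near `0`. -/
def IsTangentField {N : ℕ} (M : Set (Fin N → ℂ)) (X : VField N) : Prop :=
  SmoothNear X 0 ∧ ∃ U : Set (Fin N → ℂ), IsOpen U ∧ 0 ∈ U ∧
    ∀ p ∈ M ∩ U, X p ∈ complexTangentSpace M p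

/-- The commutator `[X, Y]`, with coefficients `X(Y_s) - Y(X_s)`. -/
noncomputable def bracket {N : ℕ} (X Y : VField N) : VField N := fun p s =>
  ∑ u, (X p u * wirtinger u (fun q => Y q s) p - Y p u * wirtinger u (fun q => X q s) p)

/-- Membership in the complex Lie algebra `𝔤_M` generated by the smooth `(1,0)` vector fields
and the smooth `(0,1)` vector fields, defined near `0`, that are tangent to `M`. -/
inductive MemLieAlgebra {N : ℕ} (M : Set (Fin N → ℂ)) : VField N → Prop
  | type_one_zero (X : VField N) : IsTangentField M X → (∀ p k, X p (Sum.inr k) = 0) →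
      MemLieAlgebra M X
  | type_zero_one (X : VField N) : IsTangentField M X → (∀ p k, X p (Sum.inl k) = 0) →
      MemLieAlgebra M X
  | add (X Y : VField N) : MemLieAlgebra M X → MemLieAlgebra M Y → MemLieAlgebra M (X + Y)
  | smul (c : ℂ) (X : VField N) : MemLieAlgebra M X → MemLieAlgebra M (c • X)
  | commutator (X Y : VField N) : MemLieAlgebra M X → MemLieAlgebra M Y →
      MemLieAlgebra M (bracket X Y)

/-- `M` is of finite type at `0`: the values at `0` of the vector fields in `𝔤_M` span
`ℂT_0M`. -/
def IsFiniteType {N : ℕ} (M : Set (Fin N → ℂ)) : Prop :=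
  Submodule.span ℂ {v | ∃ X : VField N, MemLieAlgebra M X ∧ X 0 = v} = complexTangentSpace M 0

/-- `H` is a local holomorphic change of coordinates at the origin: a biholomorphic map
between open neighbourhoods of `0` with `H(0) = 0`. -/
structure IsHolomorphicCoordinateChange {N : ℕ}
    (H : OpenPartialHomeomorph (Fin N → ℂ) (Fin N → ℂ)) : Prop where
  zero_mem : (0 : Fin N → ℂ) ∈ H.source
  map_zero : H 0 = 0
  holomorphic : DifferentiableOn ℂ H H.source
  holomorphic_symm : DifferentiableOn ℂ H.symm H.target

end Segre

/-! Everything happens on formal power series in (Z, ζ). The equations ρ(Z, ζ) = 0 define the formal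
complexification of M, parametrized by (γ(ζ, t), ζ), and the mappings Ξ_j = (v^{j+1}, v̄^j)
(`segrePoint`) take values in it. With v̄^j fixed, the last variables t^{j+1} sweep out the whole
n-dimensional fibre, so the rank of Ξ_j is n + Rk v^j (`fracRank_jacobian_segrePoint`). Let D be the
dimension of the span at 0 of the fields in 𝔤_M (`lieValues`). Two estimates carry the theorem: n +
Rk v^j ≤ D for all j, and D ≤ n + Rk v^j as soon as Rk v^{j+1} = Rk v^j.

The first estimate says that Ξ_j stays in the formal orbit of 𝔤_M through 0. The orbit is given by
its ideal: the series annihilated at 0 by all compositions of fields of 𝔤_M (`orbitIdeal`). Varying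
t^{j+1} moves along (1,0) fields, and complex conjugation exchanges the two factors, so by induction
the ideal vanishes along every Ξ_j (`subst_segrePoint_orbitIdeal`). A formal version of Nagano's
theorem (`exists_mem_orbitIdeal`) supplies 2N - D elements of the ideal with independent
differentials at 0; these cut the rank of Ξ_j down to D.

For the second estimate, the kernel of the projection of the range of dΞ_j to the ζ-components
always has dimension n, hence contains all (1,0) directions tangent to the complexification. If Rk
v^{j+1} = Rk v^j, the same holds for the projection to the Z-components and the (0,1) directions.
Then both kinds of fields are, over the field of fractions, images under Ξ_j of fields on the
parameter space; this property passes to brackets (`IsRelated.bracket`), hence to 𝔤_M, whose values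
have rank at least D along Ξ_j (`finrank_lieValues_le`).

Since v^{j+1}(0, t^1, …, t^j) = v^j, the ranks do not decrease. They are at least n for j = 1 and at
most N = n + d, so the first stall k₀ is at most d + 1; from there on Rk v^j = D - n. Finite type
means D = dim ℂT_0M = n + N, that is Rk v^{k₀} = N.

For the invariance, a biholomorphism induces a formal mapping between the two complexifications. As
M is only smooth, this requires that the Taylor series of any function vanishing on M vanish on the
complexification (`subst_taylorSeries_eq_zero`), which follows from uniqueness of formal flows.
Every formal point of the complexification is (γ(b, τ), b) for some τ (`exists_parameter`), so the
Segre mappings correspond up to a substitution in the parameters. -/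

namespace Segre

open MvPowerSeries Filter Topology

/-! ### Order filtration, chain rule and the formal implicit function theorem. -/

section FormalSeries

variable {σ τ υ ι : Type*}

/-- The ideal of formal power series of order at least `k`. -/
def orderIdeal (σ : Type*) (k : ℕ) : Ideal (MvPowerSeries σ ℂ) where
  carrier := {f | ∀ e : σ →₀ ℕ, e.degree < k → coeff e f = 0}
  zero_mem' := fun e _ => by simp
  add_mem' := fun {f g} hf hg e he => by rw [map_add, hf e he, hg e he, add_zero]
  smul_mem' := fun c f hf e he => by
    classical
    rw [smul_eq_mul, coeff_mul]
    refine Finset.sum_eq_zero fun p hp => ?_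
    rw [hf p.2 (lt_of_le_of_lt ?_ he), mul_zero]
    rw [← Finset.HasAntidiagonal.mem_antidiagonal.1 hp, map_add]
    exact Nat.le_add_left _ _

theorem orderIdeal_anti {j k : ℕ} (h : j ≤ k) : orderIdeal σ k ≤ orderIdeal σ j :=
  fun _ hf e he => hf e (he.trans_le h)

theorem mem_orderIdeal_zero (f : MvPowerSeries σ ℂ) : f ∈ orderIdeal σ 0 :=
  fun _ he => absurd he (Nat.not_lt_zero _)

theorem mem_orderIdeal_one {f : MvPowerSeries σ ℂ} :
    f ∈ orderIdeal σ 1 ↔ constantCoeff f = 0 := by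
  constructor
  · intro h
    have := h 0 (by simp)
    simpa using this
  · intro h e he
    have he0 : e = 0 := by
      rw [← Finsupp.degree_eq_zero_iff]; omega
    simpa [he0] using h

theorem mul_mem_orderIdeal {j k : ℕ} {f g : MvPowerSeries σ ℂ} (hf : f ∈ orderIdeal σ j)
    (hg : g ∈ orderIdeal σ k) : f * g ∈ orderIdeal σ (j + k) := by
  classical
  intro e he
  rw [coeff_mul]
  refine Finset.sum_eq_zero fun p hp => ?_
  have h1 : p.1.degree + p.2.degree = e.degree := by
    rw [← map_add, Finset.HasAntidiagonal.mem_antidiagonal.1 hp]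
  by_cases h : p.1.degree < j
  · rw [hf _ h, zero_mul]
  · rw [hg p.2 (by omega), mul_zero]

/-- The order filtration is separated. Identities between series are obtained by placing their
difference in every `orderIdeal`, usually by induction on the order. -/
theorem eq_zero_of_forall_mem_orderIdeal {f : MvPowerSeries σ ℂ}
    (h : ∀ k, f ∈ orderIdeal σ k) : f = 0 := by
  ext e
  exact h (e.degree + 1) e (Nat.lt_succ_self _)

theorem pderiv_mem_orderIdeal {k : ℕ} {f : MvPowerSeries σ ℂ} (s : σ)
    (hf : f ∈ orderIdeal σ (k + 1)) : pderiv ℂ s f ∈ orderIdeal σ k := by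
  intro e he
  rw [coeff_pderiv, hf _ (by rw [map_add, Finsupp.degree_single]; omega), zero_mul]

theorem prod_pow_mem_orderIdeal {a : τ → MvPowerSeries σ ℂ}
    (ha : ∀ s, constantCoeff (a s) = 0) (d : τ →₀ ℕ) :
    (d.prod fun s e => a s ^ e) ∈ orderIdeal σ d.degree := by
  classical
  have key : ∀ S : Finset τ, (∏ s ∈ S, a s ^ d s) ∈ orderIdeal σ (∑ s ∈ S, d s) := by
    intro S
    induction S using Finset.induction_on with
    | empty => simpa using mem_orderIdeal_zero _
    | insert s S hs ih =>
      rw [Finset.prod_insert hs, Finset.sum_insert hs]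
      refine mul_mem_orderIdeal ?_ ih
      induction d s with
      | zero => simpa using mem_orderIdeal_zero _
      | succ m ihm =>
        rw [pow_succ]
        exact mul_mem_orderIdeal ihm (mem_orderIdeal_one.2 (ha s))
  exact key d.support

theorem subst_mem_orderIdeal [Finite τ] {k : ℕ} {a : τ → MvPowerSeries σ ℂ}
    (ha : ∀ s, constantCoeff (a s) = 0) {f : MvPowerSeries τ ℂ} (hf : f ∈ orderIdeal τ k) :
    subst a f ∈ orderIdeal σ k := by
  intro e he
  rw [coeff_subst (hasSubst_of_constantCoeff_zero ha)]
  refine finsum_eq_zero_of_forall_eq_zero fun d => ?_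
  by_cases h : d.degree < k
  · rw [hf d h, zero_smul]
  · rw [prod_pow_mem_orderIdeal ha d e (by omega), smul_zero]

theorem constantCoeff_subst' [Finite τ] {a : τ → MvPowerSeries σ ℂ}
    (ha : ∀ s, constantCoeff (a s) = 0) (f : MvPowerSeries τ ℂ) :
    constantCoeff (subst a f) = constantCoeff f := by
  have hs := hasSubst_of_constantCoeff_zero ha
  have h1 : f = (f - C (constantCoeff f)) + C (constantCoeff f) := by ring
  have h2 : constantCoeff (f - C (constantCoeff f)) = 0 := by simp
  conv_lhs => rw [h1, subst_add hs, map_add,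
    constantCoeff_subst_eq_zero hs ha h2, subst_C]
  simp

theorem subst_zero_series [Finite τ] {a : τ → MvPowerSeries σ ℂ}
    (ha : ∀ s, constantCoeff (a s) = 0) : subst a (0 : MvPowerSeries τ ℂ) = 0 := by
  rw [← coe_substAlgHom (hasSubst_of_constantCoeff_zero ha), map_zero]

theorem subst_sum [Finite τ] {a : τ → MvPowerSeries σ ℂ}
    (ha : ∀ s, constantCoeff (a s) = 0) {κ : Type*} (S : Finset κ)
    (f : κ → MvPowerSeries τ ℂ) : subst a (∑ i ∈ S, f i) = ∑ i ∈ S, subst a (f i) := by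
  rw [← coe_substAlgHom (hasSubst_of_constantCoeff_zero ha), map_sum]

theorem subst_subst [Finite τ] [Finite σ] {a : τ → MvPowerSeries σ ℂ}
    (ha : ∀ s, constantCoeff (a s) = 0) {b : σ → MvPowerSeries υ ℂ}
    (hb : ∀ s, constantCoeff (b s) = 0) (f : MvPowerSeries τ ℂ) :
    subst b (subst a f) = subst (fun s => subst b (a s)) f :=
  subst_comp_subst_apply (hasSubst_of_constantCoeff_zero ha)
    (hasSubst_of_constantCoeff_zero hb) f

theorem sub_truncTotal_mem_orderIdeal [Finite σ] (k : ℕ) (f : MvPowerSeries σ ℂ) :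
    f - (truncTotal k f : MvPowerSeries σ ℂ) ∈ orderIdeal σ k := by
  intro e he
  rw [map_sub, MvPolynomial.coeff_coe, coeff_truncTotal _ he, sub_self]

/-- The chain rule for formal power series. -/
theorem pderiv_subst [Fintype τ] {a : τ → MvPowerSeries σ ℂ}
    (ha : ∀ s, constantCoeff (a s) = 0) (s : σ) (f : MvPowerSeries τ ℂ) :
    pderiv ℂ s (subst a f) = ∑ u, subst a (pderiv ℂ u f) * pderiv ℂ s (a u) := by
  have hs := hasSubst_of_constantCoeff_zero ha
  have poly : ∀ p : MvPolynomial τ ℂ, pderiv ℂ s (subst a (p : MvPowerSeries τ ℂ)) =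
      ∑ u, subst a (pderiv ℂ u (p : MvPowerSeries τ ℂ)) * pderiv ℂ s (a u) := by
    intro p
    induction p using MvPolynomial.induction_on with
    | C c =>
      simp only [MvPolynomial.coe_C, subst_C, pderiv_C]
      simp [subst_zero_series ha]
    | add p q hp hq =>
      simp only [MvPolynomial.coe_add, subst_add hs, map_add, hp, hq, add_mul,
        Finset.sum_add_distrib]
    | mul_X p u hp =>
      classical
      simp only [MvPolynomial.coe_mul, MvPolynomial.coe_X, subst_mul hs, subst_X hs,
        Derivation.leibniz, smul_eq_mul, hp, subst_add hs, add_mul, Finset.sum_add_distrib]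
      congr 1
      · rw [Finset.sum_eq_single u]
        · rw [pderiv_X_self]
          rw [← coe_substAlgHom hs, map_one, mul_one]
        · intro v _ hv
          rw [pderiv_X_of_ne hv.symm, subst_zero_series ha]; simp
        · simp
      · rw [Finset.mul_sum]
        exact Finset.sum_congr rfl fun v _ => by ring
  -- Both sides are additive in `f` and lower the order by at most one, so modulo order `k` the
  -- series `f` may be replaced by its truncation, a polynomial.
  rw [← sub_eq_zero]
  refine eq_zero_of_forall_mem_orderIdeal fun k => ?_
  set p := truncTotal (k + 1) f
  have hf : f = (f - (p : MvPowerSeries τ ℂ)) + p := by ring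
  have hg := sub_truncTotal_mem_orderIdeal (k + 1) f
  have e1 : pderiv ℂ s (subst a f) - ∑ u, subst a (pderiv ℂ u f) * pderiv ℂ s (a u) =
      pderiv ℂ s (subst a (f - (p : MvPowerSeries τ ℂ))) -
        ∑ u, subst a (pderiv ℂ u (f - (p : MvPowerSeries τ ℂ))) * pderiv ℂ s (a u) := by
    conv_lhs => rw [hf]
    simp only [subst_add hs, map_add, add_mul, Finset.sum_add_distrib, poly p]
    ring
  rw [e1]
  refine sub_mem (pderiv_mem_orderIdeal s (subst_mem_orderIdeal ha hg))
    (sum_mem fun u _ => Ideal.mul_mem_right _ _ ?_)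
  exact subst_mem_orderIdeal ha (pderiv_mem_orderIdeal u hg)

theorem exists_eq_single_add {d : τ →₀ ℕ} (hd : d ≠ 0) :
    ∃ s d', d = Finsupp.single s 1 + d' := by
  obtain ⟨s, hs⟩ := Finsupp.ne_iff.1 hd
  obtain ⟨d', hd'⟩ := exists_add_of_le (a := Finsupp.single s 1) (b := d) (by
    classical
    rw [Finsupp.single_le_iff]
    exact Nat.one_le_iff_ne_zero.2 hs)
  exact ⟨s, d', hd'⟩

/-- Telescoping: in each term one factor is a difference of order `k + 1`, and the remaining
`d.degree - 1` factors have order at least one. -/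
theorem prod_pow_sub_mem_orderIdeal [Finite τ] {k : ℕ} {a a' : τ → MvPowerSeries σ ℂ}
    (ha : ∀ s, constantCoeff (a s) = 0) (ha' : ∀ s, constantCoeff (a' s) = 0)
    (h : ∀ s, a s - a' s ∈ orderIdeal σ (k + 1)) (d : τ →₀ ℕ) :
    ((d.prod fun s e => a s ^ e) - d.prod fun s e => a' s ^ e) ∈ orderIdeal σ (k + d.degree) := by
  classical
  suffices H : ∀ n, ∀ d : τ →₀ ℕ, d.degree = n →
      ((d.prod fun s e => a s ^ e) - d.prod fun s e => a' s ^ e) ∈ orderIdeal σ (k + n) from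
    H _ d rfl
  intro n
  induction n with
  | zero =>
    intro d hd
    rw [Finsupp.degree_eq_zero_iff] at hd
    simp [hd]
  | succ n ih =>
    intro d hd
    obtain ⟨s, d', rfl⟩ := exists_eq_single_add (d := d) (by rintro rfl; simp at hd)
    have hd' : d'.degree = n := by
      rw [map_add, Finsupp.degree_single] at hd; omega
    have e1 : ∀ c : τ → MvPowerSeries σ ℂ, ((Finsupp.single s 1 + d').prod fun s e => c s ^ e) =
        c s * d'.prod fun s e => c s ^ e := by
      intro c
      rw [Finsupp.prod_add_index' (by simp) (by intros; rw [pow_add])]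
      simp
    rw [e1, e1]
    have e2 : a s * (d'.prod fun s e => a s ^ e) - a' s * (d'.prod fun s e => a' s ^ e) =
        (a s - a' s) * (d'.prod fun s e => a s ^ e) +
        a' s * ((d'.prod fun s e => a s ^ e) - d'.prod fun s e => a' s ^ e) := by ring
    rw [e2]
    refine add_mem ?_ ?_
    · have := mul_mem_orderIdeal (h s) (prod_pow_mem_orderIdeal ha d')
      rw [hd'] at this
      exact orderIdeal_anti (by omega) this
    · exact orderIdeal_anti (by omega)
        (mul_mem_orderIdeal (mem_orderIdeal_one.2 (ha' s)) (ih d' hd'))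

/-- The constant term of `f` cancels in the difference, so only monomials of degree at least `j`
contribute. -/
theorem subst_sub_subst_mem_orderIdeal [Finite τ] {k j : ℕ} {a a' : τ → MvPowerSeries σ ℂ}
    (ha : ∀ s, constantCoeff (a s) = 0) (ha' : ∀ s, constantCoeff (a' s) = 0)
    (h : ∀ s, a s - a' s ∈ orderIdeal σ (k + 1)) (f : MvPowerSeries τ ℂ)
    (hf : ∀ d : τ →₀ ℕ, d ≠ 0 → d.degree < j → coeff d f = 0) :
    subst a f - subst a' f ∈ orderIdeal σ (k + j) := by
  intro e he
  have hs := hasSubst_of_constantCoeff_zero ha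
  have hs' := hasSubst_of_constantCoeff_zero ha'
  rw [map_sub, coeff_subst hs, coeff_subst hs', ← finsum_sub_distrib (coeff_subst_finite hs f e)
    (coeff_subst_finite hs' f e)]
  refine finsum_eq_zero_of_forall_eq_zero fun d => ?_
  rw [← smul_sub, ← map_sub]
  by_cases h0 : d = 0
  · simp [h0]
  by_cases hd : d.degree < j
  · rw [hf d h0 hd, zero_smul]
  · rw [prod_pow_sub_mem_orderIdeal ha ha' h d e (by omega), smul_zero]

/-- First order expansion of a formal power series. -/
theorem subst_sub_linear_mem_orderIdeal [Fintype τ] {k : ℕ} {a a' : τ → MvPowerSeries σ ℂ}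
    (ha : ∀ s, constantCoeff (a s) = 0) (ha' : ∀ s, constantCoeff (a' s) = 0)
    (h : ∀ s, a s - a' s ∈ orderIdeal σ (k + 1)) (f : MvPowerSeries τ ℂ) :
    subst a f - subst a' f -
      ∑ s, C (constantCoeff (pderiv ℂ s f)) * (a s - a' s) ∈ orderIdeal σ (k + 2) := by
  classical
  have hs := hasSubst_of_constantCoeff_zero ha
  have hs' := hasSubst_of_constantCoeff_zero ha'
  set L : MvPowerSeries τ ℂ := ∑ s, C (constantCoeff (pderiv ℂ s f)) * X s with hL
  have hsub : ∀ c : τ → MvPowerSeries σ ℂ, (∀ s, constantCoeff (c s) = 0) →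
      subst c L = ∑ s, C (constantCoeff (pderiv ℂ s f)) * c s := by
    intro c hc
    rw [hL, subst_sum hc]
    refine Finset.sum_congr rfl fun s _ => ?_
    rw [subst_mul (hasSubst_of_constantCoeff_zero hc), subst_X (hasSubst_of_constantCoeff_zero hc),
      subst_C]
  -- Without its linear part `L`, the series has no terms of degree one, which gains one order in
  -- the difference.
  have key := subst_sub_subst_mem_orderIdeal (j := 2) ha ha' h (f - L) (by
    intro d hd hd2
    have h1 : d.degree = 1 := by
      have : d.degree ≠ 0 := by rwa [Ne, Finsupp.degree_eq_zero_iff]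
      omega
    obtain ⟨s, d', rfl⟩ := exists_eq_single_add hd
    have hd' : d' = 0 := by
      rw [← Finsupp.degree_eq_zero_iff]
      rw [map_add, Finsupp.degree_single] at h1
      omega
    rw [hd', add_zero]
    rw [map_sub, hL, map_sum, Finset.sum_eq_single s]
    · rw [coeff_C_mul, coeff_X, if_pos rfl, mul_one, ← coeff_zero_eq_constantCoeff_apply,
        coeff_pderiv]
      simp
    · intro b _ hb
      rw [coeff_C_mul, coeff_X, if_neg, mul_zero]
      intro hh
      exact hb (Finsupp.single_left_injective one_ne_zero hh).symm
    · simp)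
  rw [subst_sub hs, subst_sub hs', hsub a ha, hsub a' ha'] at key
  convert key using 1
  simp only [mul_sub, Finset.sum_sub_distrib]
  ring

/-- A contracting map of tuples of formal power series without constant terms has a fixed
point. -/
theorem exists_formal_fixedPoint
    (Φ : (ι → MvPowerSeries σ ℂ) → ι → MvPowerSeries σ ℂ)
    (h0 : ∀ u, (∀ i, constantCoeff (u i) = 0) → ∀ i, constantCoeff (Φ u i) = 0)
    (hc : ∀ k u v, (∀ i, constantCoeff (u i) = 0) → (∀ i, constantCoeff (v i) = 0) →
      (∀ i, u i - v i ∈ orderIdeal σ (k + 1)) → ∀ i, Φ u i - Φ v i ∈ orderIdeal σ (k + 2)) :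
    ∃ u, (∀ i, constantCoeff (u i) = 0) ∧ Φ u = u := by
  set w : ℕ → ι → MvPowerSeries σ ℂ := fun n => Φ^[n] 0 with hw
  have hw1 : ∀ n, w (n + 1) = Φ (w n) := fun n => Function.iterate_succ_apply' Φ n 0
  have hw0 : ∀ n i, constantCoeff (w n i) = 0 := by
    intro n
    induction n with
    | zero => intro i; simp [hw]
    | succ n ih => rw [hw1]; exact h0 _ ih
  have hstep : ∀ n i, w (n + 1) i - w n i ∈ orderIdeal σ (n + 1) := by
    intro n
    induction n with
    | zero =>
      intro i
      refine mem_orderIdeal_one.2 ?_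
      rw [map_sub, hw0, hw0, sub_zero]
    | succ n ih =>
      intro i
      have := hc n _ _ (hw0 (n + 1)) (hw0 n) ih i
      rwa [← hw1, ← hw1] at this
  have hmono : ∀ n k i, w (n + k) i - w n i ∈ orderIdeal σ (n + 1) := by
    intro n k i
    induction k with
    | zero => simp
    | succ k ih =>
      have e : w (n + (k + 1)) i - w n i = (w (n + k + 1) i - w (n + k) i) +
          (w (n + k) i - w n i) := by rw [← add_assoc]; ring
      rw [e]
      exact add_mem (orderIdeal_anti (by omega) (hstep (n + k) i)) ih
  -- The coefficients of degree m no longer change from the m-th iterate on, so the limit is read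
  -- off diagonally.
  set u : ι → MvPowerSeries σ ℂ := fun i e => coeff e (w e.degree i) with hu
  have huw : ∀ n i, u i - w n i ∈ orderIdeal σ (n + 1) := by
    intro n i e he
    have h1 : coeff e (u i) = coeff e (w e.degree i) := rfl
    obtain ⟨k, hk⟩ := Nat.exists_eq_add_of_le (Nat.lt_succ_iff.1 he)
    have := hmono e.degree k i e (Nat.lt_succ_self _)
    rw [← hk, map_sub] at this
    rw [map_sub, h1, ← neg_sub, this, neg_zero]
  have hu0 : ∀ i, constantCoeff (u i) = 0 := by
    intro i
    have := mem_orderIdeal_one.1 (huw 0 i)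
    rwa [map_sub, hw0, sub_zero] at this
  refine ⟨u, hu0, funext fun i => ?_⟩
  rw [← sub_eq_zero]
  refine eq_zero_of_forall_mem_orderIdeal fun n => ?_
  have e : Φ u i - u i = (Φ u i - Φ (w n) i) - (u i - w (n + 1) i) := by rw [hw1]; ring
  rw [e]
  exact sub_mem (orderIdeal_anti (by omega) (hc n u (w n) hu0 (hw0 n) (huw n) i))
    (orderIdeal_anti (by omega) (huw (n + 1) i))

theorem constantCoeff_elim {N n : ℕ} {b : Fin N → MvPowerSeries σ ℂ}
    {t : Fin n → MvPowerSeries σ ℂ} (hb : ∀ k, constantCoeff (b k) = 0)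
    (ht : ∀ k, constantCoeff (t k) = 0) (s : Fin N ⊕ Fin n) :
    constantCoeff (Sum.elim b t s) = 0 := by
  cases s <;> simp [hb, ht]

/-- A formal parametrization `Z = γ(ζ, t)` of the formal variety `ρ(Z, ζ) = 0`, regular in the
sense that `∂ρ/∂Z (0)` and `∂γ/∂t (0)` have the maximal ranks `d` and `n = N - d`. -/
structure IsFormalParametrization {N n d : ℕ} (ρ : Fin d → MvPowerSeries (Fin N ⊕ Fin N) ℂ)
    (γ : Fin N → MvPowerSeries (Fin N ⊕ Fin n) ℂ) : Prop where
  dim : n + d = N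
  constantCoeff : ∀ k, MvPowerSeries.constantCoeff (γ k) = 0
  subst_eq_zero : ∀ j, subst (Sum.elim γ fun l : Fin N => X (Sum.inl l)) (ρ j) = 0
  rank_param : (Matrix.of fun (k : Fin N) (i : Fin n) =>
    MvPowerSeries.constantCoeff (pderiv ℂ (Sum.inr i) (γ k))).rank = n
  rank_eqn : (Matrix.of fun (j : Fin d) (k : Fin N) =>
    MvPowerSeries.constantCoeff (pderiv ℂ (Sum.inl k) (ρ j))).rank = d

open Matrix in
theorem exists_leftInverse_of_rank_eq {m n : ℕ} {K : Type*} [Field K]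
    (G : Matrix (Fin m) (Fin n) K) (h : G.rank = n) :
    ∃ P : Matrix (Fin n) (Fin m) K, P * G = 1 := by
  have hker : LinearMap.ker G.mulVecLin = ⊥ := by
    have := LinearMap.finrank_range_add_finrank_ker G.mulVecLin
    rw [Module.finrank_fin_fun] at this
    change G.rank + _ = n at this
    rw [h] at this
    exact Submodule.finrank_eq_zero.1 (by omega)
  obtain ⟨g, hg⟩ := LinearMap.exists_leftInverse_of_injective _ hker
  refine ⟨LinearMap.toMatrix' g, ?_⟩
  have h2 : G = LinearMap.toMatrix' G.mulVecLin := by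
    rw [← Matrix.toLin'_apply', LinearMap.toMatrix'_toLin']
  conv_lhs => rw [h2]
  rw [← LinearMap.toMatrix'_comp, hg, LinearMap.toMatrix'_id]

open Matrix in
-- By dimension, `R * G = 0` forces the range of `G` to be the kernel of `R`, and `P` is injective
-- on that range.
theorem eq_zero_of_leftInverse_of_ker {N n d : ℕ} {K : Type*} [Field K] (hN : n + d = N)
    {G : Matrix (Fin N) (Fin n) K} {P : Matrix (Fin n) (Fin N) K} {R : Matrix (Fin d) (Fin N) K}
    (hPG : P * G = 1) (hR : R.rank = d) (hRG : R * G = 0) {v : Fin N → K}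
    (hP : P *ᵥ v = 0) (hv : R *ᵥ v = 0) : v = 0 := by
  have hinj : Function.Injective G.mulVecLin := by
    intro x y hxy
    have : P *ᵥ (G *ᵥ x) = P *ᵥ (G *ᵥ y) := congrArg _ hxy
    simpa [Matrix.mulVec_mulVec, hPG] using this
  have hle : LinearMap.range G.mulVecLin ≤ LinearMap.ker R.mulVecLin := by
    rintro _ ⟨x, rfl⟩
    simp [Matrix.mulVec_mulVec, hRG]
  have h1 := LinearMap.finrank_range_add_finrank_ker R.mulVecLin
  rw [Module.finrank_fin_fun] at h1
  change R.rank + _ = N at h1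
  have h2 := LinearMap.finrank_range_of_inj hinj
  rw [Module.finrank_fin_fun] at h2
  have heq := Submodule.eq_of_le_of_finrank_eq hle (by omega)
  have hmem : v ∈ LinearMap.range G.mulVecLin := by
    rw [heq]; exact hv
  obtain ⟨x, rfl⟩ := hmem
  have : P *ᵥ (G *ᵥ x) = 0 := hP
  rw [Matrix.mulVec_mulVec, hPG, Matrix.one_mulVec] at this
  simp [this]

theorem IsFormalParametrization.mul_eq_zero {N n d : ℕ}
    {ρ : Fin d → MvPowerSeries (Fin N ⊕ Fin N) ℂ} {γ : Fin N → MvPowerSeries (Fin N ⊕ Fin n) ℂ}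
    (h : IsFormalParametrization ρ γ) (j : Fin d) (i : Fin n) :
    ∑ k, subst (Sum.elim γ fun l : Fin N => X (Sum.inl l)) (pderiv ℂ (Sum.inl k) (ρ j)) *
      pderiv ℂ (Sum.inr i) (γ k) = 0 := by
  have h1 := pderiv_subst (constantCoeff_elim h.constantCoeff
    (t := fun l : Fin N => X (Sum.inl l : Fin N ⊕ Fin n)) (by simp)) (Sum.inr i) (ρ j)
  rw [h.subst_eq_zero j, map_zero, Fintype.sum_sum_type] at h1
  have h2 : ∀ l : Fin N, pderiv ℂ (Sum.inr i) (X (Sum.inl l) : MvPowerSeries (Fin N ⊕ Fin n) ℂ)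
      = 0 := fun l => pderiv_X_of_ne (by simp)
  simpa [h2] using h1.symm

/-- Every formal point `(a, b)` of the variety `ρ(Z, ζ) = 0` is of the form
`(γ(b, τ), b)`. -/
theorem IsFormalParametrization.exists_parameter {N n d : ℕ}
    {ρ : Fin d → MvPowerSeries (Fin N ⊕ Fin N) ℂ} {γ : Fin N → MvPowerSeries (Fin N ⊕ Fin n) ℂ}
    (h : IsFormalParametrization ρ γ) {a b : Fin N → MvPowerSeries σ ℂ}
    (ha : ∀ k, MvPowerSeries.constantCoeff (a k) = 0)
    (hb : ∀ k, MvPowerSeries.constantCoeff (b k) = 0)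
    (hab : ∀ j, subst (Sum.elim a b) (ρ j) = 0) :
    ∃ t : Fin n → MvPowerSeries σ ℂ, (∀ i, MvPowerSeries.constantCoeff (t i) = 0) ∧
      ∀ k, a k = subst (Sum.elim b t) (γ k) := by
  classical
  set G := Matrix.of fun (k : Fin N) (i : Fin n) =>
    MvPowerSeries.constantCoeff (pderiv ℂ (Sum.inr i) (γ k)) with hG
  set R := Matrix.of fun (j : Fin d) (k : Fin N) =>
    MvPowerSeries.constantCoeff (pderiv ℂ (Sum.inl k) (ρ j)) with hR
  obtain ⟨P, hP⟩ := exists_leftInverse_of_rank_eq G h.rank_param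
  have hγ0 := constantCoeff_elim (n := N) h.constantCoeff
    (t := fun l : Fin N => X (Sum.inl l : Fin N ⊕ Fin n)) (by simp)
  have hRG : R * G = 0 := by
    ext j i
    have := congrArg MvPowerSeries.constantCoeff (h.mul_eq_zero j i)
    rw [map_sum, map_zero] at this
    rw [Matrix.mul_apply, Matrix.zero_apply, ← this]
    refine Finset.sum_congr rfl fun k _ => ?_
    rw [map_mul, constantCoeff_subst' hγ0]
    rfl
  -- A Newton iteration with frozen derivative for P (γ(b, t) - a) = 0: since `P` is a left inverse
  -- of ∂γ/∂t (0), the linear part in t cancels and the map is contracting.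
  obtain ⟨t, ht0, ht⟩ := exists_formal_fixedPoint (ι := Fin n) (σ := σ)
    (fun t i => t i - ∑ k, C (P i k) * (subst (Sum.elim b t) (γ k) - a k))
    (by
      intro t ht i
      simp [ht, ha, constantCoeff_subst' (constantCoeff_elim hb ht), h.constantCoeff])
    (by
      intro k u v hu hv huv i
      have e1 : ∀ l, subst (Sum.elim b u) (γ l) - subst (Sum.elim b v) (γ l) -
          ∑ i, C (G l i) * (u i - v i) ∈ orderIdeal σ (k + 2) := by
        intro l
        have := subst_sub_linear_mem_orderIdeal (constantCoeff_elim hb hu)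
          (constantCoeff_elim hb hv) (k := k) (by
            rintro (s | s)
            · simp
            · simpa using huv s) (γ l)
        simpa [Fintype.sum_sum_type, hG] using this
      have e2 : u i - v i = ∑ l, C (P i l) * ∑ i', C (G l i') * (u i' - v i') := by
        have h3 : ∀ i', ∑ l, P i l * G l i' = if i = i' then 1 else 0 := by
          intro i'
          rw [← Matrix.mul_apply, hP, Matrix.one_apply]
        simp_rw [Finset.mul_sum, ← mul_assoc, ← map_mul]
        rw [Finset.sum_comm]
        simp_rw [← Finset.sum_mul, ← map_sum, h3]
        simp
      have e3 : (u i - ∑ l, C (P i l) * (subst (Sum.elim b u) (γ l) - a l)) -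
          (v i - ∑ l, C (P i l) * (subst (Sum.elim b v) (γ l) - a l)) =
          - ∑ l, C (P i l) * (subst (Sum.elim b u) (γ l) - subst (Sum.elim b v) (γ l) -
            ∑ i, C (G l i) * (u i - v i)) := by
        have : ∀ x y : MvPowerSeries σ ℂ, (u i - x) - (v i - y) = (u i - v i) - (x - y) := by
          intros; ring
        rw [this, e2, ← Finset.sum_sub_distrib, ← Finset.sum_sub_distrib, ← Finset.sum_neg_distrib]
        refine Finset.sum_congr rfl fun l _ => by ring
      rw [e3]
      exact neg_mem (sum_mem fun l _ => Ideal.mul_mem_left _ _ (e1 l)))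
  refine ⟨t, ht0, fun k => ?_⟩
  have hδP : ∀ i, ∑ k, C (P i k) * (a k - subst (Sum.elim b t) (γ k)) = 0 := by
    intro i
    have := congrFun ht i
    simp only [sub_eq_self] at this
    rw [← neg_eq_zero, ← this, ← Finset.sum_neg_distrib]
    exact Finset.sum_congr rfl fun k _ => by ring
  set g : Fin N → MvPowerSeries σ ℂ := fun k => subst (Sum.elim b t) (γ k) with hg
  have hg0 : ∀ k, MvPowerSeries.constantCoeff (g k) = 0 := fun k => by
    rw [hg]; simp only; rw [constantCoeff_subst' (constantCoeff_elim hb ht0), h.constantCoeff]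
  have hρg : ∀ j, subst (Sum.elim g b) (ρ j) = 0 := by
    intro j
    have := congrArg (subst (Sum.elim b t)) (h.subst_eq_zero j)
    rw [subst_zero_series (constantCoeff_elim hb ht0),
      subst_subst hγ0 (constantCoeff_elim hb ht0)] at this
    rw [← this]
    congr 1
    funext s
    cases s with
    | inl k => rfl
    | inr k =>
      rw [Sum.elim_inr, Sum.elim_inr,
        subst_X (hasSubst_of_constantCoeff_zero (constantCoeff_elim hb ht0))]
      rfl
  -- The choice of `t` provides only `n` of the `N` equations. The others come from ρ(a, b) = ρ(g,
  -- b) = 0, linearized order by order: the lowest-order part of `a - g` is annihilated by both `P`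
  -- and `R`.
  suffices H : ∀ m, ∀ k, a k - g k ∈ orderIdeal σ (m + 1) from
    sub_eq_zero.1 (eq_zero_of_forall_mem_orderIdeal fun m =>
      orderIdeal_anti (Nat.le_succ m) (H m k))
  intro m
  induction m with
  | zero => exact fun k => mem_orderIdeal_one.2 (by rw [map_sub, ha, hg0, sub_zero])
  | succ m ih =>
    intro k e he
    have e1 : ∀ j, ∑ k, C (R j k) * (a k - g k) ∈ orderIdeal σ (m + 2) := by
      intro j
      have := subst_sub_linear_mem_orderIdeal (constantCoeff_elim ha hb)
          (constantCoeff_elim hg0 hb) (k := m) (by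
            rintro (s | s)
            · simpa using ih s
            · simp) (ρ j)
      rw [hab, hρg, sub_zero, zero_sub] at this
      simpa [Fintype.sum_sum_type, hR] using neg_mem this
    have hv := eq_zero_of_leftInverse_of_ker h.dim hP h.rank_eqn hRG
      (v := fun k => coeff e (a k - g k)) (by
        funext i
        have := congrArg (coeff e) (hδP i)
        simpa [Matrix.mulVec, dotProduct, coeff_C_mul] using this) (by
        funext j
        have := e1 j e he
        simpa [Matrix.mulVec, dotProduct, coeff_C_mul, hR] using this)
    exact congrFun hv k

end FormalSeries

/-! ### Uniqueness of formal flows. -/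

section Propagation

variable {σ τ υ κ : Type*}

/-- The ideal of series all of whose monomials have `w`-weight at least `k`. -/
def weightIdeal (w : κ → ℕ) (k : ℕ) : Ideal (MvPowerSeries κ ℂ) where
  carrier := {f | ∀ e : κ →₀ ℕ, Finsupp.weight w e < k → coeff e f = 0}
  zero_mem' := fun _ _ => by simp
  add_mem' := fun {f g} hf hg e he => by rw [map_add, hf e he, hg e he, add_zero]
  smul_mem' := fun c f hf e he => by
    classical
    rw [smul_eq_mul, coeff_mul]
    refine Finset.sum_eq_zero fun p hp => ?_
    rw [hf p.2 (lt_of_le_of_lt ?_ he), mul_zero]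
    rw [← Finset.HasAntidiagonal.mem_antidiagonal.1 hp, map_add]
    exact Nat.le_add_left _ _

/-- A set of formal power series vanishing for `t = 0`, whose `t`-derivatives lie in the ideal
generated by the set, consists of `0`. The variables `t` are those of non-zero weight. -/
theorem eq_zero_of_pderiv_mem_span (w : κ → ℕ) (I : Set (MvPowerSeries κ ℂ))
    (h0 : ∀ F ∈ I, F ∈ weightIdeal w 1)
    (h1 : ∀ F ∈ I, ∀ i, w i ≠ 0 → pderiv ℂ i F ∈ Ideal.span I) :
    ∀ F ∈ I, F = 0 := by
  have key : ∀ n, I ⊆ weightIdeal w n := by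
    intro n
    induction n with
    | zero => exact fun F _ e he => absurd he (Nat.not_lt_zero _)
    | succ n ih =>
      intro F hF e he
      by_cases hw : Finsupp.weight w e = 0
      · exact h0 F hF e (by omega)
      obtain ⟨i, hi, hwi⟩ : ∃ i ∈ e.support, w i ≠ 0 := by
        by_contra hc
        push Not at hc
        refine hw ?_
        rw [Finsupp.weight_apply]
        exact Finset.sum_eq_zero fun i hi => by simp [hc i hi]
      obtain ⟨e', rfl⟩ := exists_add_of_le (a := Finsupp.single i 1) (b := e) (by
        classical
        rw [Finsupp.single_le_iff]
        exact Nat.one_le_iff_ne_zero.2 (Finsupp.mem_support_iff.1 hi))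
      -- A coefficient of positive weight is, up to a non-zero factor, a coefficient of a derivative
      -- at smaller weight, and the derivative lies in the ideal generated by `I`, to which the
      -- induction hypothesis extends.
      have h2 : pderiv ℂ i F ∈ weightIdeal w n := (Ideal.span_le.2 ih) (h1 F hF i hwi)
      have h3 := h2 e' (by
        rw [map_add, Finsupp.weight_single, one_smul] at he
        omega)
      rw [coeff_pderiv, add_comm] at h3
      refine (mul_eq_zero.1 h3).resolve_right ?_
      exact Nat.cast_add_one_ne_zero (e' i)
  intro F hF
  ext e
  exact key _ hF e (Nat.lt_succ_self _)

/-- Modulo `weightIdeal w 1` each variable equals its substitute, hence so does each monomial; each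
coefficient of the substituted series is a finite sum of such contributions. -/
theorem sub_subst_mem_weightIdeal [Finite κ] (w : κ → ℕ) {a : κ → MvPowerSeries κ ℂ}
    (ha : ∀ i, constantCoeff (a i) = 0) (h : ∀ i, X i - a i ∈ weightIdeal w 1)
    (F : MvPowerSeries κ ℂ) : F - subst a F ∈ weightIdeal w 1 := by
  intro e he
  have hs := hasSubst_of_constantCoeff_zero ha
  have hX : HasSubst (X : κ → MvPowerSeries κ ℂ) := HasSubst.X
  have hF : subst (X : κ → MvPowerSeries κ ℂ) F = F := by rw [subst_self]; rfl
  conv_lhs => rw [← hF, hF]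
  rw [map_sub]
  conv_lhs => lhs; rw [← hF]
  rw [coeff_subst hs, coeff_subst hX, ← finsum_sub_distrib (coeff_subst_finite hX F e)
    (coeff_subst_finite hs F e)]
  refine finsum_eq_zero_of_forall_eq_zero fun d => ?_
  rw [← smul_sub, ← map_sub]
  have : (d.prod fun s e => (X s : MvPowerSeries κ ℂ) ^ e) - (d.prod fun s e => a s ^ e) ∈
      weightIdeal w 1 := by
    rw [← Ideal.Quotient.eq]
    simp only [Finsupp.prod, map_prod, map_pow]
    exact Finset.prod_congr rfl fun i _ => by rw [Ideal.Quotient.eq.2 (h i)]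
  rw [this e he, smul_zero]

/-- The action of the formal vector field with coefficients `X` on a formal power series. -/
noncomputable def applyField [Fintype τ] (Y : τ → MvPowerSeries τ ℂ) (f : MvPowerSeries τ ℂ) :
    MvPowerSeries τ ℂ := ∑ s, Y s * pderiv ℂ s f

/-- If a set `J` of power series is stable under a set `V` of formal vector fields, and `Ξ(t)` is a
formal mapping whose `t`-derivatives are combinations of the fields in `V` along `Ξ`, then `J`
vanishes along `Ξ` as soon as it does for `t = 0`. -/
theorem subst_eq_zero_of_flow [Fintype τ] (w : κ → ℕ) {Ξ : τ → MvPowerSeries κ ℂ}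
    (hΞ : ∀ s, constantCoeff (Ξ s) = 0) (J : Set (MvPowerSeries τ ℂ))
    (V : Set (τ → MvPowerSeries τ ℂ))
    (h0 : ∀ f ∈ J, subst Ξ f ∈ weightIdeal w 1)
    (hV : ∀ Y ∈ V, ∀ f ∈ J, applyField Y f ∈ J)
    (hspan : ∀ i, w i ≠ 0 → (fun s => pderiv ℂ i (Ξ s)) ∈
      Submodule.span (MvPowerSeries κ ℂ) ((fun Y s => subst Ξ (Y s)) '' V)) :
    ∀ f ∈ J, subst Ξ f = 0 := by
  have hs := hasSubst_of_constantCoeff_zero hΞ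
  intro f hf
  refine eq_zero_of_pderiv_mem_span w (subst Ξ '' J) ?_ ?_ _ ⟨f, hf, rfl⟩
  · rintro _ ⟨f, hf, rfl⟩
    exact h0 f hf
  · rintro _ ⟨f, hf, rfl⟩ i hi
    rw [pderiv_subst hΞ]
    -- The chain rule pairs the gradient of `f` along `Ξ` with the velocity of `Ξ`. For a velocity
    -- `Y ∘ Ξ` with `Y ∈ V` the pairing is `Y f` along `Ξ`, and `Y f ∈ J`; the general case is
    -- linear.
    have : ∀ v ∈ Submodule.span (MvPowerSeries κ ℂ) ((fun Y s => subst Ξ (Y s)) '' V),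
        ∑ u, subst Ξ (pderiv ℂ u f) * v u ∈ Ideal.span (subst Ξ '' J) := by
      intro v hv
      induction hv using Submodule.span_induction with
      | mem v hv =>
        obtain ⟨Y, hY, rfl⟩ := hv
        refine Ideal.subset_span ⟨applyField Y f, hV Y hY f hf, ?_⟩
        rw [applyField, subst_sum hΞ]
        exact Finset.sum_congr rfl fun u _ => by rw [subst_mul hs, mul_comm]
      | zero => simp
      | add v v' _ _ hv hv' =>
        simp only [Pi.add_apply, mul_add, Finset.sum_add_distrib]
        exact add_mem hv hv'
      | smul c v _ hv =>
        have : ∑ u, subst Ξ (pderiv ℂ u f) * (c • v) u =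
            c * ∑ u, subst Ξ (pderiv ℂ u f) * v u := by
          rw [Finset.mul_sum]
          exact Finset.sum_congr rfl fun u _ => by
            rw [Pi.smul_apply, smul_eq_mul]; ring
        rw [this]
        exact Ideal.mul_mem_left _ _ hv
    exact this _ (hspan i hi)

theorem weightIdeal_one_of_constantCoeff {F : MvPowerSeries κ ℂ} (h : constantCoeff F = 0) :
    F ∈ weightIdeal (fun _ => 1) 1 := by
  intro e he
  have h0 : Finsupp.weight (fun _ : κ => 1) e = 0 := by omega
  have : e = 0 := by
    ext i
    rw [Finsupp.weight_apply, Finsupp.sum, Finset.sum_eq_zero_iff] at h0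
    by_contra hi
    exact hi (by simpa using h0 i (Finsupp.mem_support_iff.2 hi))
  rw [this]
  simpa using h

end Propagation

/-! ### Conjugation of coefficients and the real structure on series in (Z, ζ). -/

section Conj

variable {σ τ : Type*}

@[simp] theorem constantCoeff_conjSeries (f : MvPowerSeries σ ℂ) :
    constantCoeff (conjSeries f) = starRingEnd ℂ (constantCoeff f) := by
  rw [conjSeries, constantCoeff_map]

theorem conjSeries_conjSeries (f : MvPowerSeries σ ℂ) : conjSeries (conjSeries f) = f := by
  ext e; simp [conjSeries]

theorem conjSeries_injective : Function.Injective (conjSeries (σ := σ)) :=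
  Function.LeftInverse.injective conjSeries_conjSeries

theorem conjSeries_X (s : σ) : conjSeries (X s : MvPowerSeries σ ℂ) = X s := map_X _ _

theorem conjSeries_zero : conjSeries (0 : MvPowerSeries σ ℂ) = 0 := map_zero _

theorem conjSeries_subst [Finite σ] {a : σ → MvPowerSeries τ ℂ}
    (ha : ∀ s, constantCoeff (a s) = 0) (f : MvPowerSeries σ ℂ) :
    conjSeries (subst a f) = subst (fun s => conjSeries (a s)) (conjSeries f) :=
  map_subst (hasSubst_of_constantCoeff_zero ha) f

theorem pderiv_conjSeries (s : σ) (f : MvPowerSeries σ ℂ) :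
    pderiv ℂ s (conjSeries f) = conjSeries (pderiv ℂ s f) := by
  ext e; simp [conjSeries, coeff_pderiv]

/-- The involution `f ↦ f̄(ζ, Z)` of the ring of power series in `(Z, ζ)`. -/
noncomputable def conjSwap {N : ℕ} (f : MvPowerSeries (Fin N ⊕ Fin N) ℂ) :
    MvPowerSeries (Fin N ⊕ Fin N) ℂ := rename Sum.swap (conjSeries f)

theorem conjSwap_eq_subst {N : ℕ} (f : MvPowerSeries (Fin N ⊕ Fin N) ℂ) :
    conjSwap f = subst (fun s => X (Sum.swap s)) (conjSeries f) :=
  rename_eq_subst _ _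

/-- Conjugation turns the formal point (a, b) into (b̄, ā); this is the reflection by which
(v^{j+1}, v̄^j) becomes (v^j, v̄^{j+1}). -/
theorem conjSeries_subst_elim {N : ℕ} {a b : Fin N → MvPowerSeries τ ℂ}
    (ha : ∀ s, constantCoeff (a s) = 0) (hb : ∀ s, constantCoeff (b s) = 0)
    (f : MvPowerSeries (Fin N ⊕ Fin N) ℂ) :
    conjSeries (subst (Sum.elim a b) f) =
      subst (Sum.elim (fun k => conjSeries (b k)) fun k => conjSeries (a k)) (conjSwap f) := by
  have hc := constantCoeff_elim (b := fun k => conjSeries (b k)) (t := fun k => conjSeries (a k))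
    (by simp [hb]) (by simp [ha])
  rw [conjSwap_eq_subst, subst_subst (by simp) hc, conjSeries_subst (constantCoeff_elim ha hb)]
  congr 1
  funext s
  rw [subst_X (hasSubst_of_constantCoeff_zero hc)]
  cases s <;> rfl

end Conj

/-! ### The iterated Segre mappings as points of the complexification. -/

section SegreMaps

variable {N n : ℕ} {γ : Fin N → MvPowerSeries (Fin N ⊕ Fin n) ℂ}

theorem constantCoeff_iteratedSegre (hγ : ∀ k, constantCoeff (γ k) = 0) (j : ℕ) (k : Fin N) :
    constantCoeff (iteratedSegre γ j k) = 0 := by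
  induction j generalizing k with
  | zero => simp [iteratedSegre]
  | succ j ih =>
    rw [iteratedSegre, constantCoeff_subst' (constantCoeff_elim _ _), hγ]
    · intro l; simp [ih]
    · intro l; simp

/-- The inclusion of `ℂ⟦t^1, …, t^j⟧` into `ℂ⟦t^1, …, t^{j+1}⟧`. -/
noncomputable def liftSeries {j n : ℕ} :
    MvPowerSeries (Fin j × Fin n) ℂ →ₐ[ℂ] MvPowerSeries (Fin (j + 1) × Fin n) ℂ :=
  rename fun s : Fin j × Fin n => ((s.1.castSucc, s.2) : Fin (j + 1) × Fin n)

theorem liftSeries_eq_subst {j n : ℕ} (f : MvPowerSeries (Fin j × Fin n) ℂ) :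
    liftSeries f = subst (fun s : Fin j × Fin n =>
      (X ((s.1.castSucc, s.2) : Fin (j + 1) × Fin n) : MvPowerSeries _ ℂ)) f :=
  rename_eq_subst _ _

theorem liftSeries_injective {j n : ℕ} : Function.Injective (liftSeries (j := j) (n := n)) :=
  rename_injective ⟨fun s : Fin j × Fin n => ((s.1.castSucc, s.2) : Fin (j + 1) × Fin n), by
    rintro ⟨a, b⟩ ⟨c, d⟩ h
    simpa using h⟩

theorem constantCoeff_liftSeries {j n : ℕ} (f : MvPowerSeries (Fin j × Fin n) ℂ) :
    constantCoeff (liftSeries f) = constantCoeff f := constantCoeff_rename _ _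

theorem subst_liftSeries {j n : ℕ} {σ : Type*} {a : Fin (j + 1) × Fin n → MvPowerSeries σ ℂ}
    (ha : ∀ s, constantCoeff (a s) = 0) (f : MvPowerSeries (Fin j × Fin n) ℂ) :
    subst a (liftSeries f) = subst (fun s => a (s.1.castSucc, s.2)) f := by
  rw [liftSeries_eq_subst, subst_subst (by simp) ha]
  congr 1
  funext s
  rw [subst_X (hasSubst_of_constantCoeff_zero ha)]

theorem liftSeries_subst {j n : ℕ} {σ : Type*} [Finite σ] {a : σ → MvPowerSeries (Fin j × Fin n) ℂ}
    (ha : ∀ s, constantCoeff (a s) = 0) (f : MvPowerSeries σ ℂ) :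
    liftSeries (subst a f) = subst (fun s => liftSeries (a s)) f := by
  simp_rw [liftSeries_eq_subst]
  rw [subst_subst ha (by simp)]

theorem pderiv_liftSeries_castSucc {j n : ℕ} (s : Fin j × Fin n)
    (f : MvPowerSeries (Fin j × Fin n) ℂ) :
    pderiv ℂ (s.1.castSucc, s.2) (liftSeries f) = liftSeries (pderiv ℂ s f) := by
  rw [liftSeries_eq_subst, pderiv_subst (by simp), liftSeries_eq_subst]
  rw [Finset.sum_eq_single s]
  · rw [pderiv_X_self, mul_one]
  · intro u _ hu
    rw [pderiv_X_of_ne, mul_zero]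
    intro h
    apply hu
    rw [Prod.mk.injEq, Fin.castSucc_inj] at h
    exact Prod.ext h.1 h.2
  · simp

theorem pderiv_liftSeries_last {j n : ℕ} (i : Fin n) (f : MvPowerSeries (Fin j × Fin n) ℂ) :
    pderiv ℂ (Fin.last j, i) (liftSeries f) = 0 := by
  rw [liftSeries_eq_subst, pderiv_subst (by simp)]
  refine Finset.sum_eq_zero fun u _ => ?_
  rw [pderiv_X_of_ne, mul_zero]
  intro h
  rw [Prod.mk.injEq] at h
  exact (Fin.castSucc_lt_last u.1).ne h.1

/-- The second component `v̄^j(t^1, …, t^j)` of the point `(v^{j+1}, v̄^j)`, as a series in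
`t^1, …, t^{j+1}`. -/
noncomputable def segreBase (γ : Fin N → MvPowerSeries (Fin N ⊕ Fin n) ℂ) (j : ℕ) (l : Fin N) :
    MvPowerSeries (Fin (j + 1) × Fin n) ℂ := liftSeries (conjSeries (iteratedSegre γ j l))

theorem constantCoeff_segreBase (hγ : ∀ k, constantCoeff (γ k) = 0) (j : ℕ) (k : Fin N) :
    constantCoeff (segreBase γ j k) = 0 := by
  rw [segreBase, constantCoeff_liftSeries]
  simp [constantCoeff_iteratedSegre hγ]

theorem iteratedSegre_succ (j : ℕ) (k : Fin N) :
    iteratedSegre γ (j + 1) k = subst (Sum.elim (segreBase γ j) fun i : Fin n =>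
      (X ((Fin.last j, i) : Fin (j + 1) × Fin n) : MvPowerSeries _ ℂ)) (γ k) := rfl

/-- The formal mapping `(v^{j+1}, v̄^j)` into the complexification of `M`. -/
noncomputable def segrePoint (γ : Fin N → MvPowerSeries (Fin N ⊕ Fin n) ℂ) (j : ℕ) :
    Fin N ⊕ Fin N → MvPowerSeries (Fin (j + 1) × Fin n) ℂ :=
  Sum.elim (iteratedSegre γ (j + 1)) (segreBase γ j)

theorem constantCoeff_segrePoint (hγ : ∀ k, constantCoeff (γ k) = 0) (j : ℕ)
    (s : Fin N ⊕ Fin N) : constantCoeff (segrePoint γ j s) = 0 :=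
  constantCoeff_elim (constantCoeff_iteratedSegre hγ _) (constantCoeff_segreBase hγ _) s

/-- Evaluation at the Segre point factors through the parametrization (γ(ζ, t), ζ), so what vanishes
on the latter vanishes at the former. -/
theorem subst_segrePoint (hγ : ∀ k, constantCoeff (γ k) = 0) (j : ℕ)
    (f : MvPowerSeries (Fin N ⊕ Fin N) ℂ) :
    subst (segrePoint γ j) f = subst (Sum.elim (segreBase γ j) fun i : Fin n =>
      (X ((Fin.last j, i) : Fin (j + 1) × Fin n) : MvPowerSeries _ ℂ))
      (subst (Sum.elim γ fun l : Fin N => X (Sum.inl l)) f) := by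
  have h1 := constantCoeff_elim (constantCoeff_segreBase hγ j)
    (t := fun i : Fin n => (X ((Fin.last j, i) : Fin (j + 1) × Fin n) : MvPowerSeries _ ℂ))
    (by simp)
  rw [subst_subst (constantCoeff_elim hγ (by simp)) h1]
  congr 1
  funext s
  cases s with
  | inl k => exact iteratedSegre_succ j k
  | inr l =>
    rw [Sum.elim_inr, subst_X (hasSubst_of_constantCoeff_zero h1)]
    rfl

end SegreMaps

/-! ### Ranks over a domain through minors. -/

section Rank

variable {m n : Type*} [Fintype m] [Fintype n]

theorem exists_submatrix_linearIndependent {K : Type*} [Field K] (A : Matrix m n K) {r : ℕ}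
    (h : r ≤ A.rank) : ∃ f : Fin r → m, LinearIndependent K (A.submatrix f id).row := by
  classical
  rw [Matrix.rank_eq_finrank_span_row] at h
  obtain ⟨κ, a, ha, hsp, hli⟩ := exists_linearIndependent' K A.row
  have : Finite κ := Finite.of_injective a ha
  have := Fintype.ofFinite κ
  rw [← hsp, finrank_span_eq_card hli] at h
  obtain ⟨e⟩ := Function.Embedding.nonempty_of_card_le (α := Fin r) (β := κ) (by simpa using h)
  exact ⟨a ∘ e, hli.comp e e.injective⟩

theorem le_rank_iff_exists_minor {K : Type*} [Field K] (A : Matrix m n K) (r : ℕ) :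
    r ≤ A.rank ↔ ∃ (f : Fin r → m) (g : Fin r → n), (A.submatrix f g).det ≠ 0 := by
  constructor
  · intro h
    obtain ⟨f, hf⟩ := exists_submatrix_linearIndependent A h
    have h1 : r ≤ (A.submatrix f id).transpose.rank := by
      rw [Matrix.rank_transpose, LinearIndependent.rank_matrix hf, Fintype.card_fin]
    obtain ⟨g, hg⟩ := exists_submatrix_linearIndependent _ h1
    refine ⟨f, g, ?_⟩
    have h2 := Matrix.linearIndependent_rows_iff_isUnit.1 hg
    rw [Matrix.isUnit_iff_isUnit_det, ← Matrix.det_transpose, isUnit_iff_ne_zero] at h2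
    exact h2
  · rintro ⟨f, g, h⟩
    have h1 := Matrix.rank_of_isUnit _ ((Matrix.isUnit_iff_isUnit_det _).2 (isUnit_iff_ne_zero.2 h))
    have h2 := Matrix.eRank_submatrix_le A f g
    have h3 := ENat.toNat_le_toNat h2 (ne_top_of_le_ne_top (by simp) (A.eRank_le_card_width))
    rw [Matrix.eRank_toNat_eq_rank, Matrix.eRank_toNat_eq_rank, h1, Fintype.card_fin] at h3
    exact h3

/-- The rank of a matrix over the field of fractions. -/
noncomputable def fracRank {R : Type*} [CommRing R] [IsDomain R] (A : Matrix m n R) : ℕ :=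
  (A.map (algebraMap R (FractionRing R))).rank

/-- Minors are computed in `R` itself, so ranks over different fields of fractions can be compared
along ring homomorphisms that do not extend to these fields, such as `constantCoeff`. -/
theorem le_fracRank_iff {R : Type*} [CommRing R] [IsDomain R] (A : Matrix m n R) (r : ℕ) :
    r ≤ fracRank A ↔ ∃ (f : Fin r → m) (g : Fin r → n), (A.submatrix f g).det ≠ 0 := by
  rw [fracRank, le_rank_iff_exists_minor]
  refine exists_congr fun f => exists_congr fun g => not_congr ?_
  rw [Matrix.submatrix_map, ← RingHom.mapMatrix_apply, ← RingHom.map_det]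
  exact map_eq_zero_iff _ (IsFractionRing.injective R (FractionRing R))

theorem fracRank_field {K : Type*} [Field K] (A : Matrix m n K) : fracRank A = A.rank :=
  eq_of_forall_le_iff fun r => by rw [le_fracRank_iff, le_rank_iff_exists_minor]

theorem fracRank_map_le {R S : Type*} [CommRing R] [IsDomain R] [CommRing S] [IsDomain S]
    (φ : R →+* S) (A : Matrix m n R) : fracRank (A.map φ) ≤ fracRank A := by
  rw [le_fracRank_iff]
  obtain ⟨f, g, h⟩ := (le_fracRank_iff (A.map φ) _).1 le_rfl
  refine ⟨f, g, fun h0 => h ?_⟩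
  rw [Matrix.submatrix_map, ← RingHom.mapMatrix_apply, ← RingHom.map_det, h0, map_zero]

theorem fracRank_map_of_injective {R S : Type*} [CommRing R] [IsDomain R] [CommRing S] [IsDomain S]
    (φ : R →+* S) (hφ : Function.Injective φ) (A : Matrix m n R) :
    fracRank (A.map φ) = fracRank A := by
  refine le_antisymm (fracRank_map_le φ A) ?_
  rw [le_fracRank_iff]
  obtain ⟨f, g, h⟩ := (le_fracRank_iff A _).1 le_rfl
  refine ⟨f, g, ?_⟩
  rw [Matrix.submatrix_map, ← RingHom.mapMatrix_apply, ← RingHom.map_det]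
  exact (map_ne_zero_iff φ hφ).2 h

theorem fracRank_mul_le_left {m n p : Type*} [Fintype n] [Fintype p] {R : Type*} [CommRing R] [IsDomain R]
    (A : Matrix m n R) (B : Matrix n p R) : fracRank (A * B) ≤ fracRank A := by
  rw [fracRank, Matrix.map_mul]
  exact Matrix.rank_mul_le_left _ _

theorem fracRank_submatrix_le {m' n' : Type*} [Fintype m'] [Fintype n'] {R : Type*} [CommRing R]
    [IsDomain R] (A : Matrix m n R) (f : m' → m) (g : n' → n) :
    fracRank (A.submatrix f g) ≤ fracRank A := by
  rw [le_fracRank_iff]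
  obtain ⟨f', g', h⟩ := (le_fracRank_iff (A.submatrix f g) _).1 le_rfl
  exact ⟨f ∘ f', g ∘ g', h⟩

end Rank

/-! ### Behaviour of the generic rank under substitution. -/

section GenericRank

instance isDomain_mvPowerSeries {σ : Type*} : IsDomain (MvPowerSeries σ ℂ) :=
  NoZeroDivisors.to_isDomain _

/-- Substitution as a ring homomorphism. -/
noncomputable def substHom {σ τ : Type*} [Finite σ] {a : σ → MvPowerSeries τ ℂ}
    (ha : ∀ s, constantCoeff (a s) = 0) : MvPowerSeries σ ℂ →+* MvPowerSeries τ ℂ :=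
  (substAlgHom (R := ℂ) (hasSubst_of_constantCoeff_zero ha)).toRingHom

theorem substHom_apply {σ τ : Type*} [Finite σ] {a : σ → MvPowerSeries τ ℂ}
    (ha : ∀ s, constantCoeff (a s) = 0) (f : MvPowerSeries σ ℂ) :
    substHom ha f = subst a f := substAlgHom_apply _ _

variable {N : ℕ} {σ τ : Type*} [Fintype σ] [Fintype τ]

/-- The Jacobian matrix of a tuple of formal power series. -/
noncomputable def jacobian {ι : Type*} (F : ι → MvPowerSeries σ ℂ) :
    Matrix ι σ (MvPowerSeries σ ℂ) := Matrix.of fun k s => pderiv ℂ s (F k)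

theorem genericRank_eq (F : Fin N → MvPowerSeries σ ℂ) : genericRank F = fracRank (jacobian F) :=
  rfl

theorem jacobian_subst {σ τ ι : Type*} [Fintype σ] (F : ι → MvPowerSeries σ ℂ) {a : σ → MvPowerSeries τ ℂ}
    (ha : ∀ s, constantCoeff (a s) = 0) :
    jacobian (fun k => subst a (F k)) =
      ((jacobian F).map (substHom ha)) *
        jacobian a := by
  ext1 k s
  rw [Matrix.mul_apply]
  simp only [jacobian, Matrix.of_apply, Matrix.map_apply]
  simp_rw [pderiv_subst ha, substHom_apply]

/-- By the chain rule the new Jacobian is a product whose left factor is the image of the old one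
under a ring homomorphism; neither operation raises the rank. -/
theorem genericRank_subst_le (F : Fin N → MvPowerSeries σ ℂ) {a : σ → MvPowerSeries τ ℂ}
    (ha : ∀ s, constantCoeff (a s) = 0) :
    genericRank (fun k => subst a (F k)) ≤ genericRank F := by
  rw [genericRank_eq, genericRank_eq, jacobian_subst F ha]
  exact (fracRank_mul_le_left _ _).trans (fracRank_map_le _ _)

theorem rank_constantCoeff_le_fracRank {σ m n : Type*} [Fintype m] [Fintype n]
    (A : Matrix m n (MvPowerSeries σ ℂ)) :
    (A.map constantCoeff).rank ≤ fracRank A := by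
  rw [← fracRank_field]
  exact fracRank_map_le _ _

theorem genericRank_le (F : Fin N → MvPowerSeries σ ℂ) : genericRank F ≤ N := by
  rw [genericRank_eq, fracRank]
  simpa using Matrix.rank_le_card_height ((jacobian F).map (algebraMap _ (FractionRing _)))

end GenericRank

/-! ### Monotonicity of the ranks, and the lower bound n. -/

section SegreRank

variable {N n : ℕ} {γ : Fin N → MvPowerSeries (Fin N ⊕ Fin n) ℂ}

/-- The series obtained by substituting `(0, t^1, …, t^j)` for `(t^1, …, t^{j+1})`. -/
noncomputable def shiftVar (j n : ℕ) : Fin (j + 1) × Fin n → MvPowerSeries (Fin j × Fin n) ℂ :=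
  fun s => Fin.cases (motive := fun _ => MvPowerSeries (Fin j × Fin n) ℂ) 0
    (fun a => X (a, s.2)) s.1

theorem constantCoeff_shiftVar (j n : ℕ) (s : Fin (j + 1) × Fin n) :
    constantCoeff (shiftVar j n s) = 0 := by
  obtain ⟨a, i⟩ := s
  induction a using Fin.cases <;> simp [shiftVar]

/-- At t^1 = 0 the series v̄^1 vanishes, so v^2(0, t) = γ(0, t) = v^1(t); the recursion carries the
shift to all later mappings. This realizes v^j as a substitution instance of v^{j+1}, whence the
monotonicity of the ranks. -/
theorem subst_shiftVar_iteratedSegre (hγ : ∀ k, constantCoeff (γ k) = 0) (j : ℕ) (hj : 1 ≤ j)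
    (k : Fin N) : subst (shiftVar j n) (iteratedSegre γ (j + 1) k) = iteratedSegre γ j k := by
  obtain ⟨j, rfl⟩ : ∃ j', j = j' + 1 := ⟨j - 1, by omega⟩
  clear hj
  have key : ∀ j : ℕ, (∀ l, subst (shiftVar (j + 1) n) (segreBase γ (j + 1) l) = segreBase γ j l) →
      ∀ k, subst (shiftVar (j + 1) n) (iteratedSegre γ (j + 2) k) = iteratedSegre γ (j + 1) k := by
    intro j h k
    rw [iteratedSegre_succ, subst_subst
      (constantCoeff_elim (constantCoeff_segreBase hγ _) (by simp)) (constantCoeff_shiftVar _ _),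
      iteratedSegre_succ]
    congr 1
    funext s
    cases s with
    | inl l => exact h l
    | inr i =>
      rw [Sum.elim_inr, subst_X (hasSubst_of_constantCoeff_zero (constantCoeff_shiftVar _ _)),
        Sum.elim_inr]
      rfl
  induction j generalizing k with
  | zero =>
    refine key 0 (fun l => ?_) k
    have h0 : ∀ f : MvPowerSeries (Fin 1 × Fin n) ℂ, constantCoeff f = 0 →
        subst (shiftVar 1 n) (liftSeries f) = 0 := by
      intro f hf
      rw [subst_liftSeries (constantCoeff_shiftVar _ _)]
      have : (fun s : Fin 1 × Fin n => shiftVar 1 n (s.1.castSucc, s.2)) = 0 := by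
        funext s
        obtain ⟨a, i⟩ := s
        obtain rfl : a = 0 := Subsingleton.elim _ _
        rfl
      rw [this]
      exact subst_zero_of_constantCoeff_zero hf
    rw [segreBase, h0 _ (by simp [constantCoeff_iteratedSegre hγ])]
    rw [segreBase]
    simp [iteratedSegre, conjSeries_zero]
  | succ j ih =>
    refine key (j + 1) (fun l => ?_) k
    rw [segreBase, subst_liftSeries (constantCoeff_shiftVar _ _), segreBase, ← ih l,
      conjSeries_subst (constantCoeff_shiftVar _ _), liftSeries_subst
        (by simp [constantCoeff_shiftVar])]
    congr 1
    funext s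
    obtain ⟨a, i⟩ := s
    induction a using Fin.cases with
    | zero =>
      simp only [shiftVar, Fin.castSucc_zero, Fin.cases_zero]
      rw [conjSeries_zero, map_zero]
    | succ a =>
      simp only [shiftVar, Fin.castSucc_succ, Fin.cases_succ]
      rw [conjSeries_X, liftSeries, rename_X]

theorem genericRank_iteratedSegre_le_succ (hγ : ∀ k, constantCoeff (γ k) = 0) (j : ℕ)
    (hj : 1 ≤ j) : genericRank (iteratedSegre γ j) ≤ genericRank (iteratedSegre γ (j + 1)) := by
  have := genericRank_subst_le (iteratedSegre γ (j + 1)) (constantCoeff_shiftVar j n)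
  simpa only [subst_shiftVar_iteratedSegre hγ j hj] using this

theorem fracRank_jacobian_conj_lift {j : ℕ} (F : Fin N → MvPowerSeries (Fin j × Fin n) ℂ) :
    fracRank ((jacobian F).map fun f => liftSeries (conjSeries f)) = genericRank F := by
  rw [genericRank_eq]
  refine fracRank_map_of_injective
    ((liftSeries : _ →ₐ[ℂ] _).toRingHom.comp (MvPowerSeries.map (starRingEnd ℂ))) ?_ _
  exact liftSeries_injective.comp conjSeries_injective

/-- The base point v̄^j does not involve t^{j+1}, so only the explicit dependence of γ on t
contributes to this block of the Jacobian. -/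
theorem map_constantCoeff_jacobian_iteratedSegre (hγ : ∀ k, constantCoeff (γ k) = 0) (j : ℕ) :
    ((jacobian (iteratedSegre γ (j + 1))).map constantCoeff).submatrix id
      (fun i : Fin n => (Fin.last j, i)) = Matrix.of fun (k : Fin N) (i : Fin n) =>
      constantCoeff (pderiv ℂ (Sum.inr i) (γ k)) := by
  ext k i
  simp only [jacobian, Matrix.submatrix_apply, Matrix.map_apply, Matrix.of_apply, id]
  have h2 := constantCoeff_elim (constantCoeff_segreBase hγ j)
    (t := fun i : Fin n => (X ((Fin.last j, i) : Fin (j + 1) × Fin n) : MvPowerSeries _ ℂ))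
    (by simp)
  rw [iteratedSegre_succ, pderiv_subst h2, Fintype.sum_sum_type, map_add, map_sum, map_sum,
    Finset.sum_eq_zero, zero_add, Finset.sum_eq_single i]
  · rw [map_mul, constantCoeff_subst' h2, Sum.elim_inr, pderiv_X_self]; simp
  · intro i' _ hi'
    rw [Sum.elim_inr, pderiv_X_of_ne, mul_zero, map_zero]
    simpa using hi'
  · simp
  · intro l _
    rw [Sum.elim_inl, segreBase, pderiv_liftSeries_last]; simp

theorem le_genericRank_iteratedSegre (hγ : ∀ k, constantCoeff (γ k) = 0)
    (hr : (Matrix.of fun (k : Fin N) (i : Fin n) =>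
      constantCoeff (pderiv ℂ (Sum.inr i) (γ k))).rank = n) (j : ℕ) :
    n ≤ genericRank (iteratedSegre γ (j + 1)) := by
  have h3 := fracRank_submatrix_le ((jacobian (iteratedSegre γ (j + 1))).map constantCoeff) id
      (fun i : Fin n => (Fin.last j, i))
  rw [map_constantCoeff_jacobian_iteratedSegre hγ, fracRank_field, hr, fracRank_field] at h3
  exact h3.trans (rank_constantCoeff_le_fracRank _)

end SegreRank

/-! ### Germs of smooth functions. -/

section Smooth

variable {N : ℕ} {F : Type*} [NormedAddCommGroup F] [NormedSpace ℝ F] {p : Fin N → ℂ}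

theorem smoothNear_iff {f : (Fin N → ℂ) → F} :
    SmoothNear f p ↔ ∀ᶠ q in 𝓝 p, ContDiffAt ℝ ∞ f q := by
  constructor
  · rintro ⟨U, hU, hp, hf⟩
    filter_upwards [hU.mem_nhds hp] with q hq
    exact hf.contDiffAt (hU.mem_nhds hq)
  · intro h
    obtain ⟨U, hUs, hU, hp⟩ := eventually_nhds_iff.1 h
    exact ⟨U, hU, hp, fun q hq => (hUs q hq).contDiffWithinAt⟩

theorem SmoothNear.eventually_smoothNear {f : (Fin N → ℂ) → F} (hf : SmoothNear f p) :
    ∀ᶠ q in 𝓝 p, SmoothNear f q := by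
  simp only [smoothNear_iff] at hf ⊢
  exact eventually_eventually_nhds.2 hf

theorem SmoothNear.contDiffAt {f : (Fin N → ℂ) → F} (hf : SmoothNear f p) :
    ContDiffAt ℝ ∞ f p := (smoothNear_iff.1 hf).self_of_nhds

theorem SmoothNear.differentiableAt {f : (Fin N → ℂ) → F} (hf : SmoothNear f p) :
    DifferentiableAt ℝ f p := hf.contDiffAt.differentiableAt (by simp)

theorem SmoothNear.congr {f g : (Fin N → ℂ) → F} (hf : SmoothNear f p) (h : g =ᶠ[𝓝 p] f) :
    SmoothNear g p := by
  rw [smoothNear_iff] at hf ⊢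
  filter_upwards [hf, h.eventuallyEq_nhds] with q hq hg
  exact hq.congr_of_eventuallyEq hg

theorem smoothNear_const (c : F) : SmoothNear (fun _ : Fin N → ℂ => c) p :=
  smoothNear_iff.2 (Eventually.of_forall fun _ => contDiffAt_const)

theorem SmoothNear.add {f g : (Fin N → ℂ) → F} (hf : SmoothNear f p) (hg : SmoothNear g p) :
    SmoothNear (fun q => f q + g q) p := by
  rw [smoothNear_iff] at *
  filter_upwards [hf, hg] with q h1 h2 using h1.add h2

theorem SmoothNear.sub {f g : (Fin N → ℂ) → F} (hf : SmoothNear f p) (hg : SmoothNear g p) :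
    SmoothNear (fun q => f q - g q) p := by
  rw [smoothNear_iff] at *
  filter_upwards [hf, hg] with q h1 h2 using h1.sub h2

theorem SmoothNear.mul {f g : (Fin N → ℂ) → ℂ} (hf : SmoothNear f p) (hg : SmoothNear g p) :
    SmoothNear (fun q => f q * g q) p := by
  rw [smoothNear_iff] at *
  filter_upwards [hf, hg] with q h1 h2 using h1.mul h2

theorem SmoothNear.sum {κ : Type*} {S : Finset κ} {f : κ → (Fin N → ℂ) → F}
    (hf : ∀ i ∈ S, SmoothNear (f i) p) : SmoothNear (fun q => ∑ i ∈ S, f i q) p := by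
  simp only [smoothNear_iff] at *
  have := (eventually_all_finset S).2 hf
  filter_upwards [this] with q h
  exact ContDiffAt.sum h

theorem SmoothNear.prod {κ : Type*} {S : Finset κ} {f : κ → (Fin N → ℂ) → ℂ}
    (hf : ∀ i ∈ S, SmoothNear (f i) p) : SmoothNear (fun q => ∏ i ∈ S, f i q) p := by
  simp only [smoothNear_iff] at *
  have := (eventually_all_finset S).2 hf
  filter_upwards [this] with q h
  exact contDiffAt_prod h

theorem SmoothNear.clm_comp {G : Type*} [NormedAddCommGroup G] [NormedSpace ℝ G] (L : F →L[ℝ] G)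
    {f : (Fin N → ℂ) → F} (hf : SmoothNear f p) : SmoothNear (fun q => L (f q)) p := by
  rw [smoothNear_iff] at *
  filter_upwards [hf] with q h using L.contDiff.contDiffAt.comp q h

theorem smoothNear_clm (L : (Fin N → ℂ) →L[ℝ] F) : SmoothNear (fun q => L q) p :=
  smoothNear_iff.2 (Eventually.of_forall fun _ => L.contDiff.contDiffAt)

theorem smoothNear_pi {ι : Type*} [Fintype ι] {f : (Fin N → ℂ) → ι → F} :
    SmoothNear f p ↔ ∀ i, SmoothNear (fun q => f q i) p := by
  simp only [smoothNear_iff, contDiffAt_pi, eventually_all]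

theorem SmoothNear.comp {f : (Fin N → ℂ) → F} {Φ : (Fin N → ℂ) → Fin N → ℂ}
    (hf : SmoothNear f (Φ p)) (hΦ : SmoothNear Φ p) : SmoothNear (fun q => f (Φ q)) p := by
  have hc := hΦ.contDiffAt.continuousAt
  rw [smoothNear_iff] at *
  filter_upwards [hΦ, hc.eventually hf] with q h1 h2 using h2.comp q h1

theorem SmoothNear.fderiv {f : (Fin N → ℂ) → F} (hf : SmoothNear f p) :
    SmoothNear (fun q => fderiv ℝ f q) p := by
  rw [smoothNear_iff] at *
  filter_upwards [hf] with q h using h.fderiv_right (by simp)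

end Smooth

/-! ### Wirtinger calculus. -/

section Wirtinger

variable {N : ℕ} {p : Fin N → ℂ}

/-- The coefficient of `dZ_k`, respectively `dZ̄_k`, in an `ℝ`-linear form. -/
noncomputable def wirtingerCoeff (s : Fin N ⊕ Fin N) : ((Fin N → ℂ) →L[ℝ] ℂ) →L[ℝ] ℂ :=
  (1 / 2 : ℂ) • (ContinuousLinearMap.apply ℝ ℂ (Pi.single (Sum.elim id id s) (1 : ℂ) : Fin N → ℂ) +
    (Sum.elim (fun _ => -Complex.I) (fun _ => Complex.I) s : ℂ) •
      ContinuousLinearMap.apply ℝ ℂ (Pi.single (Sum.elim id id s) Complex.I : Fin N → ℂ))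

theorem wirtingerCoeff_apply (s : Fin N ⊕ Fin N) (L : (Fin N → ℂ) →L[ℝ] ℂ) :
    wirtingerCoeff s L = 1 / 2 * (L (Pi.single (Sum.elim id id s) 1) +
      Sum.elim (fun _ => -Complex.I) (fun _ => Complex.I) s *
        L (Pi.single (Sum.elim id id s) Complex.I)) := rfl

theorem wirtingerCoeff_smul (s : Fin N ⊕ Fin N) (c : ℂ) (L : (Fin N → ℂ) →L[ℝ] ℂ) :
    wirtingerCoeff s (c • L) = c * wirtingerCoeff s L := by
  simp only [wirtingerCoeff_apply, _root_.smul_apply, smul_eq_mul]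
  ring

theorem wirtinger_eq (s : Fin N ⊕ Fin N) (f : (Fin N → ℂ) → ℂ) (q : Fin N → ℂ) :
    wirtinger s f q = wirtingerCoeff s (fderiv ℝ f q) := by
  cases s <;> simp only [wirtinger, wirtingerCoeff_apply, Sum.elim_inl, Sum.elim_inr, id] <;> ring

/-- The coordinate functions `Z_k` and `Z̄_k`. -/
noncomputable def coord (s : Fin N ⊕ Fin N) : (Fin N → ℂ) →L[ℝ] ℂ :=
  match s with
  | Sum.inl k => ContinuousLinearMap.proj k
  | Sum.inr k => Complex.conjCLE.toContinuousLinearMap.comp (ContinuousLinearMap.proj k)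

@[simp] theorem coord_inl (k : Fin N) (q : Fin N → ℂ) : coord (Sum.inl k) q = q k := rfl

@[simp] theorem coord_inr (k : Fin N) (q : Fin N → ℂ) :
    coord (Sum.inr k) q = starRingEnd ℂ (q k) := rfl

/-- The decomposition df = ∂f + ∂̄f of a real-linear form; the chain rule `wirtinger_comp` is its
consequence. -/
theorem clm_eq_sum_wirtingerCoeff (L : (Fin N → ℂ) →L[ℝ] ℂ) (v : Fin N → ℂ) :
    L v = ∑ s, wirtingerCoeff s L * coord s v := by
  have h1 : ∀ k, L (Pi.single k (v k)) =
      (v k).re * L (Pi.single k 1) + (v k).im * L (Pi.single k Complex.I) := by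
    intro k
    have : (Pi.single k (v k) : Fin N → ℂ) =
        (v k).re • (Pi.single k (1 : ℂ) : Fin N → ℂ) +
          (v k).im • (Pi.single k Complex.I : Fin N → ℂ) := by
      rw [← Pi.single_smul, ← Pi.single_smul, ← Pi.single_add]
      congr 1
      simp [Complex.re_add_im]
    rw [this, map_add, map_smul, map_smul]
    simp
  have h2 : v = ∑ k, Pi.single k (v k) := (Finset.univ_sum_single v).symm
  conv_lhs => rw [h2]
  rw [map_sum, Fintype.sum_sum_type, ← Finset.sum_add_distrib]
  refine Finset.sum_congr rfl fun k _ => ?_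
  rw [h1]
  simp only [wirtingerCoeff_apply, coord_inl, coord_inr, Sum.elim_inl, Sum.elim_inr, id]
  have h3 := Complex.re_add_im (v k)
  have h4 : starRingEnd ℂ (v k) = (v k).re - (v k).im * Complex.I := by
    apply Complex.ext <;> simp
  rw [h4]
  linear_combination (1 / 2 * (L (Pi.single k 1) - Complex.I * L (Pi.single k Complex.I))) * h3 +
    (v k).im * L (Pi.single k Complex.I) * Complex.I_mul_I

theorem wirtingerCoeff_coord [DecidableEq (Fin N ⊕ Fin N)] (s u : Fin N ⊕ Fin N) :
    wirtingerCoeff s (coord u) = if s = u then 1 else 0 := by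
  rcases s with k | k <;> rcases u with l | l <;>
    by_cases h : k = l <;>
    simp [wirtingerCoeff_apply, h]
  all_goals norm_num

theorem SmoothNear.wirtinger {f : (Fin N → ℂ) → ℂ} (hf : SmoothNear f p) (s : Fin N ⊕ Fin N) :
    SmoothNear (wirtinger s f) p := by
  have := hf.fderiv.clm_comp (wirtingerCoeff s)
  refine this.congr (Eventually.of_forall fun q => ?_)
  exact wirtinger_eq s f q

theorem wirtinger_congr {f g : (Fin N → ℂ) → ℂ} (h : f =ᶠ[𝓝 p] g) (s : Fin N ⊕ Fin N) :
    wirtinger s f =ᶠ[𝓝 p] wirtinger s g := by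
  filter_upwards [h.eventuallyEq_nhds] with q hq
  rw [wirtinger_eq, wirtinger_eq, hq.fderiv_eq]

theorem wirtinger_add {f g : (Fin N → ℂ) → ℂ} (hf : DifferentiableAt ℝ f p)
    (hg : DifferentiableAt ℝ g p) (s : Fin N ⊕ Fin N) :
    wirtinger s (fun q => f q + g q) p = wirtinger s f p + wirtinger s g p := by
  rw [wirtinger_eq, wirtinger_eq, wirtinger_eq, fderiv_fun_add hf hg, map_add]

theorem wirtinger_sum {κ : Type*} {S : Finset κ} {f : κ → (Fin N → ℂ) → ℂ}
    (hf : ∀ i ∈ S, DifferentiableAt ℝ (f i) p) (s : Fin N ⊕ Fin N) :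
    wirtinger s (fun q => ∑ i ∈ S, f i q) p = ∑ i ∈ S, wirtinger s (f i) p := by
  simp_rw [wirtinger_eq]
  rw [fderiv_fun_sum hf, map_sum]

theorem wirtinger_mul {f g : (Fin N → ℂ) → ℂ} (hf : DifferentiableAt ℝ f p)
    (hg : DifferentiableAt ℝ g p) (s : Fin N ⊕ Fin N) :
    wirtinger s (fun q => f q * g q) p = f p * wirtinger s g p + g p * wirtinger s f p := by
  rw [wirtinger_eq, wirtinger_eq, wirtinger_eq, fderiv_fun_mul hf hg, map_add, wirtingerCoeff_smul,
    wirtingerCoeff_smul]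

@[simp] theorem wirtinger_const (c : ℂ) (s : Fin N ⊕ Fin N) :
    wirtinger s (fun _ => c) p = 0 := by
  rw [wirtinger_eq]; simp

theorem wirtinger_coord [DecidableEq (Fin N ⊕ Fin N)] (s u : Fin N ⊕ Fin N) :
    wirtinger s (fun q => coord u q) p = if s = u then 1 else 0 := by
  rw [wirtinger_eq, ← wirtingerCoeff_coord, ContinuousLinearMap.fderiv]

theorem wirtinger_comm {f : (Fin N → ℂ) → ℂ} (hf : SmoothNear f p) (s u : Fin N ⊕ Fin N) :
    wirtinger s (wirtinger u f) p = wirtinger u (wirtinger s f) p := by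
  have hd : DifferentiableAt ℝ (fderiv ℝ f) p := hf.fderiv.differentiableAt
  have hsymm : IsSymmSndFDerivAt ℝ f p :=
    hf.contDiffAt.isSymmSndFDerivAt (by simpa using! (WithTop.coe_le_coe.2 le_top : ((2 : ℕ∞) : WithTop ℕ∞) ≤ ∞))
  have key : ∀ s u : Fin N ⊕ Fin N, wirtinger s (wirtinger u f) p = wirtingerCoeff s
      ((wirtingerCoeff u).comp (fderiv ℝ (fderiv ℝ f) p)) := by
    intro s u
    rw [wirtinger_eq]
    congr 1
    have : wirtinger u f = fun q => wirtingerCoeff u (fderiv ℝ f q) :=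
      funext fun q => wirtinger_eq u f q
    rw [this]
    exact ((wirtingerCoeff u).hasFDerivAt.comp p hd.hasFDerivAt).fderiv
  rw [key, key]
  simp only [wirtingerCoeff_apply, ContinuousLinearMap.comp_apply]
  have e := fun v w => hsymm.eq v w
  rw [e (Pi.single (Sum.elim id id u) 1) (Pi.single (Sum.elim id id s) 1),
    e (Pi.single (Sum.elim id id u) 1) (Pi.single (Sum.elim id id s) Complex.I),
    e (Pi.single (Sum.elim id id u) Complex.I) (Pi.single (Sum.elim id id s) 1),
    e (Pi.single (Sum.elim id id u) Complex.I) (Pi.single (Sum.elim id id s) Complex.I)]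
  ring

theorem wirtinger_comp {f : (Fin N → ℂ) → ℂ} {Φ : (Fin N → ℂ) → Fin N → ℂ}
    (hf : DifferentiableAt ℝ f (Φ p)) (hΦ : DifferentiableAt ℝ Φ p) (s : Fin N ⊕ Fin N) :
    wirtinger s (fun q => f (Φ q)) p =
      ∑ u, wirtinger u f (Φ p) * wirtinger s (fun q => coord u (Φ q)) p := by
  have h1 : ∀ u : Fin N ⊕ Fin N, fderiv ℝ (fun q => coord u (Φ q)) p =
      (coord u).comp (fderiv ℝ Φ p) := fun u =>
    ((coord u).hasFDerivAt.comp p hΦ.hasFDerivAt).fderiv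
  have h2 : fderiv ℝ (fun q => f (Φ q)) p = (fderiv ℝ f (Φ p)).comp (fderiv ℝ Φ p) :=
    (hf.hasFDerivAt.comp p hΦ.hasFDerivAt).fderiv
  have h3 : (fderiv ℝ f (Φ p)).comp (fderiv ℝ Φ p) = ∑ u, wirtinger u f (Φ p) •
      (coord u).comp (fderiv ℝ Φ p) := by
    ext v
    rw [ContinuousLinearMap.comp_apply, clm_eq_sum_wirtingerCoeff]
    simp [wirtinger_eq]
  simp_rw [wirtinger_eq s, h1, h2, h3, map_sum, wirtingerCoeff_smul]

theorem wirtinger_conj (f : (Fin N → ℂ) → ℂ) (s : Fin N ⊕ Fin N) :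
    wirtinger s (fun q => starRingEnd ℂ (f q)) p = starRingEnd ℂ (wirtinger s.swap f p) := by
  have h1 : fderiv ℝ (fun q => starRingEnd ℂ (f q)) p =
      Complex.conjCLE.toContinuousLinearMap.comp (fderiv ℝ f p) :=
    Complex.conjCLE.comp_fderiv
  rw [wirtinger_eq, h1, wirtinger_eq]
  cases s <;> simp [wirtingerCoeff_apply, Complex.conj_ofNat]

theorem wirtinger_ofReal {r : (Fin N → ℂ) → ℝ} (hr : DifferentiableAt ℝ r p)
    (s : Fin N ⊕ Fin N) : wirtinger s (fun q => (r q : ℂ)) p =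
      wirtingerCoeff s (Complex.ofRealCLM.comp (fderiv ℝ r p)) := by
  rw [wirtinger_eq]
  congr 1
  exact (Complex.ofRealCLM.hasFDerivAt.comp p hr.hasFDerivAt).fderiv

end Wirtinger

/-! ### Taylor series in (Z, Z̄) as a homomorphism compatible with derivatives, conjugation and
composition. -/

section Taylor

variable {N : ℕ} {p : Fin N → ℂ}

/-- The composition of the Wirtinger derivatives listed in `l`. -/
noncomputable def wirtingerList (l : List (Fin N ⊕ Fin N)) (f : (Fin N → ℂ) → ℂ) :
    (Fin N → ℂ) → ℂ := l.foldr wirtinger f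

theorem SmoothNear.wirtingerList {f : (Fin N → ℂ) → ℂ} (hf : SmoothNear f p)
    (l : List (Fin N ⊕ Fin N)) : SmoothNear (wirtingerList l f) p := by
  induction l with
  | nil => exact hf
  | cons s l ih => exact ih.wirtinger s

theorem wirtingerList_congr {f g : (Fin N → ℂ) → ℂ} (h : f =ᶠ[𝓝 p] g)
    (l : List (Fin N ⊕ Fin N)) : wirtingerList l f =ᶠ[𝓝 p] wirtingerList l g := by
  induction l with
  | nil => exact h
  | cons s l ih => exact wirtinger_congr ih s

theorem wirtingerList_perm {f : (Fin N → ℂ) → ℂ} (hf : SmoothNear f p)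
    {l l' : List (Fin N ⊕ Fin N)} (h : l.Perm l') :
    wirtingerList l f =ᶠ[𝓝 p] wirtingerList l' f := by
  induction h with
  | nil => exact EventuallyEq.rfl
  | cons s _ ih => exact wirtinger_congr ih s
  | swap s u l =>
    filter_upwards [(hf.wirtingerList l).eventually_smoothNear] with q hq
    exact wirtinger_comm hq u s
  | trans _ _ ih ih' => exact ih.trans ih'

/-- A list in which each index `s` occurs `m s` times. -/
noncomputable def indexList (m : (Fin N ⊕ Fin N) →₀ ℕ) : List (Fin N ⊕ Fin N) :=
  (List.finRange N).flatMap fun k => List.replicate (m (Sum.inl k)) (Sum.inl k) ++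
    List.replicate (m (Sum.inr k)) (Sum.inr k)

theorem wirtingerList_append (l l' : List (Fin N ⊕ Fin N)) (f : (Fin N → ℂ) → ℂ) :
    wirtingerList (l ++ l') f = wirtingerList l (wirtingerList l' f) := List.foldr_append

theorem wirtingerList_replicate (j : ℕ) (s : Fin N ⊕ Fin N) (f : (Fin N → ℂ) → ℂ) :
    wirtingerList (List.replicate j s) f = (wirtinger s)^[j] f := by
  induction j with
  | zero => rfl
  | succ j ih =>
    rw [List.replicate_succ, Function.iterate_succ_apply', ← ih]
    rfl

theorem iteratedWirtinger_eq (m : (Fin N ⊕ Fin N) →₀ ℕ) (f : (Fin N → ℂ) → ℂ) :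
    iteratedWirtinger m f = wirtingerList (indexList m) f := by
  rw [iteratedWirtinger, indexList]
  induction List.finRange N with
  | nil => rfl
  | cons k l ih =>
    rw [List.foldr_cons, ih, List.flatMap_cons, wirtingerList_append, wirtingerList_append,
      wirtingerList_replicate, wirtingerList_replicate]

theorem count_indexList [BEq (Fin N ⊕ Fin N)] [LawfulBEq (Fin N ⊕ Fin N)] (m : (Fin N ⊕ Fin N) →₀ ℕ)
    (s : Fin N ⊕ Fin N) : (indexList m).count s = m s := by
  rw [indexList, List.count_flatMap, ← List.ofFn_eq_map, List.sum_ofFn]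
  cases s with
  | inl k =>
    rw [Finset.sum_eq_single k]
    · simp [List.count_replicate]
    · intro l _ hl
      simp [List.count_replicate, hl]
    · simp
  | inr k =>
    rw [Finset.sum_eq_single k]
    · simp [List.count_replicate]
    · intro l _ hl
      simp [List.count_replicate, hl]
    · simp

theorem taylorSeries_congr {f g : (Fin N → ℂ) → ℂ} (h : f =ᶠ[𝓝 0] g) :
    taylorSeries f = taylorSeries g := by
  funext m
  rw [taylorSeries, taylorSeries, iteratedWirtinger_eq, iteratedWirtinger_eq,
    (wirtingerList_congr h _).eq_of_nhds]

theorem coeff_taylorSeries (m : (Fin N ⊕ Fin N) →₀ ℕ) (f : (Fin N → ℂ) → ℂ) :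
    coeff m (taylorSeries f) =
      wirtingerList (indexList m) f 0 / ((∏ s, (m s).factorial : ℕ) : ℂ) := by
  rw [← iteratedWirtinger_eq]
  rfl

theorem constantCoeff_taylorSeries (f : (Fin N → ℂ) → ℂ) :
    constantCoeff (taylorSeries f) = f 0 := by
  rw [← coeff_zero_eq_constantCoeff_apply]
  have h : (indexList (0 : (Fin N ⊕ Fin N) →₀ ℕ)) = [] := by
    simp [indexList, List.flatMap_eq_nil_iff]
  rw [coeff_taylorSeries, h]
  simp [wirtingerList]

/-- Wirtinger derivatives of a smooth function commute, so the additional derivative can be taken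
innermost; the factor `m s + 1` is the quotient of the factorials. -/
theorem pderiv_taylorSeries {f : (Fin N → ℂ) → ℂ} (hf : SmoothNear f 0) (s : Fin N ⊕ Fin N) :
    pderiv ℂ s (taylorSeries f) = taylorSeries (wirtinger s f) := by
  classical
  ext m
  rw [coeff_pderiv, coeff_taylorSeries, coeff_taylorSeries]
  have h1 : (indexList (m + Finsupp.single s 1)).Perm (indexList m ++ [s]) := by
    let _ : BEq (Fin N ⊕ Fin N) := instBEqOfDecidableEq
    have _ : LawfulBEq (Fin N ⊕ Fin N) := inferInstance
    rw [List.perm_iff_count]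
    intro u
    rw [count_indexList, List.count_append, count_indexList, Finsupp.add_apply,
      Finsupp.single_apply, List.count_singleton]
    simp
  have h2 := (wirtingerList_perm hf h1).eq_of_nhds
  rw [wirtingerList_append] at h2
  rw [h2]
  have h3 : (∏ u, ((m + Finsupp.single s 1 : (Fin N ⊕ Fin N) →₀ ℕ) u).factorial : ℕ) =
      (m s + 1) * ∏ u, (m u).factorial := by
    rw [← Finset.mul_prod_erase _ _ (Finset.mem_univ s),
      ← Finset.mul_prod_erase _ (fun u => (m u).factorial) (Finset.mem_univ s), ← mul_assoc]
    congr 1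
    · simp [Nat.factorial_succ]
    · refine Finset.prod_congr rfl fun u hu => ?_
      rw [Finsupp.add_apply, Finsupp.single_apply, if_neg (Finset.ne_of_mem_erase hu).symm,
        add_zero]
  rw [h3]
  have h4 : ((m s : ℂ) + 1) ≠ 0 := Nat.cast_add_one_ne_zero _
  have h5 : ((∏ u, (m u).factorial : ℕ) : ℂ) ≠ 0 := by
    exact_mod_cast Finset.prod_ne_zero_iff.2 fun u _ => Nat.factorial_ne_zero _
  have h6 : wirtingerList [s] f = wirtinger s f := rfl
  rw [h6]
  push_cast at h5 ⊢
  field_simp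

/-- Together with `pderiv_taylorSeries` this gives the induction scheme for sums, products,
conjugates and compositions: an identity of Taylor series to order `k + 1` follows from its value at
0 and the differentiated identity to order `k`. -/
theorem mem_orderIdeal_succ {σ : Type*} {k : ℕ} {F : MvPowerSeries σ ℂ}
    (h0 : constantCoeff F = 0) (h : ∀ s, pderiv ℂ s F ∈ orderIdeal σ k) :
    F ∈ orderIdeal σ (k + 1) := by
  intro e he
  by_cases he0 : e = 0
  · simpa [he0] using h0
  obtain ⟨s, d, rfl⟩ := exists_eq_single_add he0
  rw [map_add, Finsupp.degree_single] at he
  have := h s d (by omega)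
  rw [coeff_pderiv, add_comm] at this
  exact (mul_eq_zero.1 this).resolve_right (Nat.cast_add_one_ne_zero _)

theorem taylorSeries_add {f g : (Fin N → ℂ) → ℂ} (hf : SmoothNear f 0) (hg : SmoothNear g 0) :
    taylorSeries (fun q => f q + g q) = taylorSeries f + taylorSeries g := by
  rw [← sub_eq_zero]
  refine eq_zero_of_forall_mem_orderIdeal fun k => ?_
  induction k generalizing f g with
  | zero => exact mem_orderIdeal_zero _
  | succ k ih =>
    refine mem_orderIdeal_succ (by simp [constantCoeff_taylorSeries]) fun s => ?_
    have h1 : wirtinger s (fun q => f q + g q) =ᶠ[𝓝 0]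
        fun q => wirtinger s f q + wirtinger s g q := by
      filter_upwards [hf.eventually_smoothNear, hg.eventually_smoothNear] with q h1 h2
      exact wirtinger_add h1.differentiableAt h2.differentiableAt s
    rw [map_sub, map_add, pderiv_taylorSeries (hf.add hg), pderiv_taylorSeries hf,
      pderiv_taylorSeries hg, taylorSeries_congr h1]
    exact ih (hf.wirtinger s) (hg.wirtinger s)

theorem taylorSeries_mul {f g : (Fin N → ℂ) → ℂ} (hf : SmoothNear f 0) (hg : SmoothNear g 0) :
    taylorSeries (fun q => f q * g q) = taylorSeries f * taylorSeries g := by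
  rw [← sub_eq_zero]
  refine eq_zero_of_forall_mem_orderIdeal fun k => ?_
  induction k generalizing f g with
  | zero => exact mem_orderIdeal_zero _
  | succ k ih =>
    refine mem_orderIdeal_succ (by simp [constantCoeff_taylorSeries]) fun s => ?_
    have h1 : wirtinger s (fun q => f q * g q) =ᶠ[𝓝 0]
        fun q => f q * wirtinger s g q + g q * wirtinger s f q := by
      filter_upwards [hf.eventually_smoothNear, hg.eventually_smoothNear] with q h1 h2
      exact wirtinger_mul h1.differentiableAt h2.differentiableAt s
    rw [map_sub, pderiv_taylorSeries (hf.mul hg), Derivation.leibniz, pderiv_taylorSeries hf,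
      pderiv_taylorSeries hg, taylorSeries_congr h1,
      taylorSeries_add (hf.mul (hg.wirtinger s)) (hg.mul (hf.wirtinger s)), smul_eq_mul,
      smul_eq_mul, add_sub_add_comm]
    exact add_mem (ih hf (hg.wirtinger s)) (ih hg (hf.wirtinger s))

theorem taylorSeries_const (c : ℂ) :
    taylorSeries (fun _ : Fin N → ℂ => c) = C c := by
  have h0 : ∀ s : Fin N ⊕ Fin N, wirtinger s (fun _ : Fin N → ℂ => c) = fun _ => 0 :=
    fun s => funext fun q => wirtinger_const c s
  have h1 : taylorSeries (fun _ : Fin N → ℂ => (0 : ℂ)) = 0 := by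
    have := taylorSeries_add (smoothNear_const (p := (0 : Fin N → ℂ)) (0 : ℂ))
      (smoothNear_const (0 : ℂ))
    simpa using this
  refine pderiv.ext (fun s => ?_) (by simp [constantCoeff_taylorSeries])
  rw [pderiv_taylorSeries (smoothNear_const c), h0, h1, pderiv_C]

theorem taylorSeries_zero : taylorSeries (fun _ : Fin N → ℂ => (0 : ℂ)) = 0 := by
  rw [taylorSeries_const, map_zero]

theorem taylorSeries_const_mul (c : ℂ) {f : (Fin N → ℂ) → ℂ} (hf : SmoothNear f 0) :
    taylorSeries (fun q => c * f q) = c • taylorSeries f := by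
  rw [taylorSeries_mul (smoothNear_const c) hf, taylorSeries_const, smul_eq_C_mul]

theorem taylorSeries_sub {f g : (Fin N → ℂ) → ℂ} (hf : SmoothNear f 0) (hg : SmoothNear g 0) :
    taylorSeries (fun q => f q - g q) = taylorSeries f - taylorSeries g := by
  have h := taylorSeries_add hf ((smoothNear_const (-1 : ℂ)).mul hg)
  rw [taylorSeries_const_mul _ hg] at h
  have e : (fun q => f q - g q) = fun q => f q + -1 * g q := by funext q; ring
  rw [e, h]
  simp [sub_eq_add_neg]

theorem taylorSeries_sum {κ : Type*} {S : Finset κ} {f : κ → (Fin N → ℂ) → ℂ}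
    (hf : ∀ i ∈ S, SmoothNear (f i) 0) :
    taylorSeries (fun q => ∑ i ∈ S, f i q) = ∑ i ∈ S, taylorSeries (f i) := by
  classical
  induction S using Finset.induction_on with
  | empty => simpa using taylorSeries_zero
  | insert i S hi ih =>
    have hS : ∀ i ∈ S, SmoothNear (f i) 0 := fun i hi => hf i (Finset.mem_insert_of_mem hi)
    simp_rw [Finset.sum_insert hi]
    rw [taylorSeries_add (hf i (Finset.mem_insert_self _ _)) (SmoothNear.sum hS), ih hS]

theorem taylorSeries_coord (s : Fin N ⊕ Fin N) :
    taylorSeries (fun q => coord s q) = X s := by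
  classical
  have hs : SmoothNear (fun q => coord s q) (0 : Fin N → ℂ) := smoothNear_clm _
  refine pderiv.ext (fun u => ?_) (by simp [constantCoeff_taylorSeries])
  rw [pderiv_taylorSeries hs]
  have : wirtinger u (fun q => coord s q) = fun _ => if u = s then 1 else 0 :=
    funext fun q => wirtinger_coord u s
  rw [this, taylorSeries_const, pderiv_X, Pi.single_apply]
  by_cases h : s = u
  · simp [h]
  · simp [h, Ne.symm h]

theorem pderiv_conjSwap (s : Fin N ⊕ Fin N) (F : MvPowerSeries (Fin N ⊕ Fin N) ℂ) :
    pderiv ℂ s (conjSwap F) = conjSwap (pderiv ℂ s.swap F) := by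
  rw [conjSwap_eq_subst, pderiv_subst (by simp), conjSwap_eq_subst, Finset.sum_eq_single s.swap]
  · rw [Sum.swap_swap, pderiv_X_self, mul_one, pderiv_conjSeries]
  · intro u _ hu
    rw [pderiv_X_of_ne, mul_zero]
    rintro rfl
    exact hu (Sum.swap_swap u).symm
  · simp

theorem constantCoeff_conjSwap (F : MvPowerSeries (Fin N ⊕ Fin N) ℂ) :
    constantCoeff (conjSwap F) = starRingEnd ℂ (constantCoeff F) := by
  rw [conjSwap_eq_subst, constantCoeff_subst' (by simp), constantCoeff_conjSeries]

theorem SmoothNear.conj {f : (Fin N → ℂ) → ℂ} (hf : SmoothNear f p) :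
    SmoothNear (fun q => starRingEnd ℂ (f q)) p :=
  hf.clm_comp Complex.conjCLE.toContinuousLinearMap

theorem taylorSeries_conj {f : (Fin N → ℂ) → ℂ} (hf : SmoothNear f 0) :
    taylorSeries (fun q => starRingEnd ℂ (f q)) = conjSwap (taylorSeries f) := by
  rw [← sub_eq_zero]
  refine eq_zero_of_forall_mem_orderIdeal fun k => ?_
  induction k generalizing f with
  | zero => exact mem_orderIdeal_zero _
  | succ k ih =>
    refine mem_orderIdeal_succ
      (by simp [constantCoeff_taylorSeries, constantCoeff_conjSwap]) fun s => ?_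
    have h1 : wirtinger s (fun q => starRingEnd ℂ (f q)) =
        fun q => starRingEnd ℂ (wirtinger s.swap f q) := funext fun q => wirtinger_conj f s
    rw [map_sub, pderiv_taylorSeries hf.conj, pderiv_conjSwap, pderiv_taylorSeries hf, h1]
    exact ih (hf.wirtinger _)

/-- The Taylor series of a composition. -/
theorem taylorSeries_comp {f : (Fin N → ℂ) → ℂ} {Φ : (Fin N → ℂ) → Fin N → ℂ} (hΦ0 : Φ 0 = 0)
    (hΦ : SmoothNear Φ 0) (hf : SmoothNear f 0) :
    taylorSeries (fun q => f (Φ q)) =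
      subst (fun u => taylorSeries fun q => coord u (Φ q)) (taylorSeries f) := by
  have hc : ∀ u, constantCoeff (taylorSeries fun q => coord u (Φ q)) = 0 := fun u => by
    rw [constantCoeff_taylorSeries, hΦ0, map_zero]
  have hcs : ∀ u : Fin N ⊕ Fin N, SmoothNear (fun q => coord u (Φ q)) 0 :=
    fun u => hΦ.clm_comp (coord u)
  have hcomp : ∀ {g : (Fin N → ℂ) → ℂ}, SmoothNear g 0 → SmoothNear (fun q => g (Φ q)) 0 :=
    fun {g} hg => SmoothNear.comp (by rwa [hΦ0]) hΦ
  rw [← sub_eq_zero]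
  refine eq_zero_of_forall_mem_orderIdeal fun k => ?_
  induction k generalizing f with
  | zero => exact mem_orderIdeal_zero _
  | succ k ih =>
    refine mem_orderIdeal_succ ?_ fun s => ?_
    · rw [map_sub, constantCoeff_subst' hc, constantCoeff_taylorSeries,
        constantCoeff_taylorSeries, hΦ0, sub_self]
    have h1 : wirtinger s (fun q => f (Φ q)) =ᶠ[𝓝 0]
        fun q => ∑ u, wirtinger u f (Φ q) * wirtinger s (fun q => coord u (Φ q)) q := by
      have hcont := hΦ.contDiffAt.continuousAt
      have hf' := hf.eventually_smoothNear
      rw [← hΦ0] at hf'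
      filter_upwards [hΦ.eventually_smoothNear, hcont.eventually hf'] with q h1 h2
      exact wirtinger_comp h2.differentiableAt h1.differentiableAt s
    rw [map_sub, pderiv_taylorSeries (hcomp hf), taylorSeries_congr h1, pderiv_subst hc,
      taylorSeries_sum fun u _ => (hcomp (hf.wirtinger u)).mul ((hcs u).wirtinger s),
      ← Finset.sum_sub_distrib]
    refine sum_mem fun u _ => ?_
    rw [taylorSeries_mul (hcomp (hf.wirtinger u)) ((hcs u).wirtinger s),
      pderiv_taylorSeries (hcs u), pderiv_taylorSeries hf, ← sub_mul]
    exact Ideal.mul_mem_right _ _ (ih (hf.wirtinger u))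

end Taylor

/-! ### Lagrange multipliers and the complexified tangent space. -/

section Tangent

variable {N d : ℕ} {M : Set (Fin N → ℂ)} {r : Fin d → (Fin N → ℂ) → ℝ}

/-- `f` vanishes on `M` near `p`. -/
def VanishesNear (M : Set (Fin N → ℂ)) (f : (Fin N → ℂ) → ℂ) (p : Fin N → ℂ) : Prop :=
  ∃ U : Set (Fin N → ℂ), IsOpen U ∧ p ∈ U ∧ ∀ Z ∈ M ∩ U, f Z = 0

theorem vanishesNear_iff {f : (Fin N → ℂ) → ℂ} {p : Fin N → ℂ} :
    VanishesNear M f p ↔ ∀ᶠ q in 𝓝 p, q ∈ M → f q = 0 := by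
  constructor
  · rintro ⟨U, hU, hp, hf⟩
    filter_upwards [hU.mem_nhds hp] with q hq hM using hf q ⟨hM, hq⟩
  · intro h
    obtain ⟨U, hUs, hU, hp⟩ := eventually_nhds_iff.1 h
    exact ⟨U, hU, hp, fun q hq => hUs q hq.2 hq.1⟩

theorem VanishesNear.eventually {f : (Fin N → ℂ) → ℂ} {p : Fin N → ℂ} (h : VanishesNear M f p) :
    ∀ᶠ q in 𝓝 p, VanishesNear M f q := by
  simp only [vanishesNear_iff] at h ⊢
  exact eventually_eventually_nhds.2 h

theorem IsDefiningFunction.eventually_mem_iff (hr : IsDefiningFunction M r) :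
    ∀ᶠ p in 𝓝 0, (p ∈ M ↔ ∀ j, r j p = 0) := by
  obtain ⟨U, hU, h0, h⟩ := hr.eq_zeros
  filter_upwards [hU.mem_nhds h0] with p hp
  have := Set.ext_iff.1 h p
  simpa [hp] using this

theorem IsDefiningFunction.smoothNear_ofReal (hr : IsDefiningFunction M r) (j : Fin d) :
    SmoothNear (fun Z => (r j Z : ℂ)) 0 := (hr.smooth j).clm_comp Complex.ofRealCLM

theorem IsDefiningFunction.vanishesNear (hr : IsDefiningFunction M r) (j : Fin d) :
    VanishesNear M (fun Z => (r j Z : ℂ)) 0 := by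
  rw [vanishesNear_iff]
  filter_upwards [hr.eventually_mem_iff] with p hp hpM
  rw [hp.1 hpM j, Complex.ofReal_zero]

/-- A function constant on the level set of `r` has a trivial local extremum there, so the Lagrange
multiplier theorem applies; independence of the `dr_j` makes the multiplier of `φ` non-zero. -/
theorem exists_multipliers_real {φ : (Fin N → ℂ) → ℝ} {p : Fin N → ℂ}
    (hrs : ∀ j, SmoothNear (r j) p) (hli : LinearIndependent ℝ fun j => fderiv ℝ (r j) p)
    (hφ : SmoothNear φ p) (h : ∀ᶠ q in 𝓝 p, (∀ j, r j q = r j p) → φ q = φ p) :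
    ∃ c : Fin d → ℝ, fderiv ℝ φ p = ∑ j, c j • fderiv ℝ (r j) p := by
  have hext : IsLocalExtrOn φ {x | ∀ i, r i x = r i p} p := by
    left
    refine eventually_nhdsWithin_iff.2 ?_
    filter_upwards [h] with q hq hqs
    exact (hq hqs).ge
  obtain ⟨Λ, Λ₀, hne, hsum⟩ := hext.exists_multipliers_of_hasStrictFDerivAt
    (fun i => (hrs i).contDiffAt.hasStrictFDerivAt (by simp))
    (hφ.contDiffAt.hasStrictFDerivAt (by simp))
  have hΛ₀ : Λ₀ ≠ 0 := by
    rintro rfl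
    rw [zero_smul, add_zero] at hsum
    have := Fintype.linearIndependent_iff.1 hli Λ hsum
    exact hne (Prod.ext (funext this) rfl)
  refine ⟨fun j => -(Λ₀⁻¹ * Λ j), ?_⟩
  have h2 : fderiv ℝ φ p = -(Λ₀⁻¹ • ∑ i, Λ i • fderiv ℝ (r i) p) := by
    rw [eq_neg_iff_add_eq_zero, ← smul_right_injective _ hΛ₀ |>.eq_iff, smul_zero, smul_add,
      smul_smul, mul_inv_cancel₀ hΛ₀, one_smul, add_comm]
    exact hsum
  rw [h2, Finset.smul_sum, ← Finset.sum_neg_distrib]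
  exact Finset.sum_congr rfl fun j _ => by ext v; simp [mul_assoc]

/-- The differential of a function vanishing on `M` is a combination of the differentials of the
defining functions. -/
theorem IsDefiningFunction.exists_multipliers (hr : IsDefiningFunction M r) :
    ∀ᶠ p in 𝓝 0, p ∈ M → ∀ f : (Fin N → ℂ) → ℂ, SmoothNear f p → VanishesNear M f p →
      ∃ c : Fin d → ℂ, ∀ s, wirtinger s f p =
        ∑ j, c j * wirtinger s (fun Z => (r j Z : ℂ)) p := by
  have hcont : ContinuousAt (fun p => fun j => fderiv ℝ (r j) p) 0 :=
    continuousAt_pi.2 fun j => (hr.smooth j).fderiv.contDiffAt.continuousAt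
  -- Independence is an open condition, so the multipliers exist at all points of `M` near the
  -- origin and not only at 0.
  have hli : ∀ᶠ p in 𝓝 0, LinearIndependent ℝ fun j => fderiv ℝ (r j) p :=
    hcont.eventually (isOpen_setOfPred_linearIndependent.mem_nhds hr.linearIndependent)
  filter_upwards [hli, hr.eventually_mem_iff.eventually_nhds,
    eventually_all.2 fun j => (hr.smooth j).eventually_smoothNear] with p hli hmem hsm hpM f hf hv
  have hrp := hmem.self_of_nhds.1 hpM
  rw [vanishesNear_iff] at hv
  have hfp : f p = 0 := hv.self_of_nhds hpM
  have hz : ∀ᶠ q in 𝓝 p, (∀ j, r j q = r j p) → f q = f p := by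
    filter_upwards [hv, hmem] with q h1 h2 h3
    rw [hfp]
    exact h1 (h2.2 fun j => by rw [h3, hrp])
  obtain ⟨c, hc⟩ := exists_multipliers_real hsm hli (hf.clm_comp Complex.reCLM)
    (hz.mono fun q hq h => congrArg Complex.re (hq h))
  obtain ⟨c', hc'⟩ := exists_multipliers_real hsm hli (hf.clm_comp Complex.imCLM)
    (hz.mono fun q hq h => congrArg Complex.im (hq h))
  have hre : fderiv ℝ (fun q => Complex.reCLM (f q)) p = Complex.reCLM.comp (fderiv ℝ f p) :=
    (Complex.reCLM.hasFDerivAt.comp p hf.differentiableAt.hasFDerivAt).fderiv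
  have him : fderiv ℝ (fun q => Complex.imCLM (f q)) p = Complex.imCLM.comp (fderiv ℝ f p) :=
    (Complex.imCLM.hasFDerivAt.comp p hf.differentiableAt.hasFDerivAt).fderiv
  have key : fderiv ℝ f p = ∑ j, ((c j : ℂ) + c' j * Complex.I) •
      Complex.ofRealCLM.comp (fderiv ℝ (r j) p) := by
    ext v
    have h1 := DFunLike.congr_fun (hre.symm.trans hc) v
    have h2 := DFunLike.congr_fun (him.symm.trans hc') v
    apply Complex.ext
    · simpa using h1
    · simpa using h2
  refine ⟨fun j => (c j : ℂ) + c' j * Complex.I, fun s => ?_⟩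
  rw [wirtinger_eq, key, map_sum]
  refine Finset.sum_congr rfl fun j _ => ?_
  rw [wirtingerCoeff_smul, wirtinger_ofReal (hsm j).differentiableAt]

theorem IsDefiningFunction.eventually_mem_complexTangentSpace_iff (hr : IsDefiningFunction M r) :
    ∀ᶠ p in 𝓝 0, p ∈ M → ∀ v, v ∈ complexTangentSpace M p ↔
      ∀ j, ∑ s, v s * wirtinger s (fun Z => (r j Z : ℂ)) p = 0 := by
  filter_upwards [hr.exists_multipliers,
    eventually_all.2 fun j => (hr.smoothNear_ofReal j).eventually_smoothNear,
    eventually_all.2 fun j => (hr.vanishesNear j).eventually] with p hp hsm hv hpM v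
  constructor
  · exact fun h j => h _ (hsm j) (hv j)
  · intro h f hf hfv
    obtain ⟨c, hc⟩ := hp hpM f hf hfv
    simp_rw [hc, Finset.mul_sum]
    rw [Finset.sum_comm]
    refine Finset.sum_eq_zero fun j _ => ?_
    rw [← mul_zero (c j), ← h j, Finset.mul_sum]
    exact Finset.sum_congr rfl fun s _ => by ring

/-- The complex differentials of the defining functions, `s` running through all `Z_k`, `Z̄_k`. -/
noncomputable def diffMatrix (r : Fin d → (Fin N → ℂ) → ℝ) (p : Fin N → ℂ) :
    Matrix (Fin d) (Fin N ⊕ Fin N) ℂ :=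
  Matrix.of fun j s => wirtinger s (fun Z => (r j Z : ℂ)) p

/-- Genericity provides one defining function `r₀` with independent complex differentials. Each
∂r₀_j is a combination of the ∂r_k, so the rank is at least `d` for every defining function. -/
theorem IsDefiningFunction.rank_diffMatrix_inl (hr : IsDefiningFunction M r)
    (hM : IsGenericSubmanifold M d) : ((diffMatrix r 0).submatrix id Sum.inl).rank = d := by
  obtain ⟨h0, r₀, hr₀, hli⟩ := hM
  have h1 : ((diffMatrix r₀ 0).submatrix id Sum.inl).rank = d := by
    simpa using LinearIndependent.rank_matrix (M := (diffMatrix r₀ 0).submatrix id Sum.inl) hli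
  choose c hc using fun j => (hr.exists_multipliers.self_of_nhds h0) _ (hr₀.smoothNear_ofReal j)
    (hr₀.vanishesNear j)
  have h2 : (diffMatrix r₀ 0).submatrix id Sum.inl =
      Matrix.of c * (diffMatrix r 0).submatrix id Sum.inl := by
    ext j k
    simp [Matrix.mul_apply, diffMatrix, hc]
  have h3 := Matrix.rank_mul_le_right (Matrix.of c) ((diffMatrix r 0).submatrix id Sum.inl)
  rw [← h2, h1] at h3
  exact le_antisymm (Matrix.rank_le_height _) h3

theorem conj_wirtinger_ofReal (r : Fin d → (Fin N → ℂ) → ℝ) (j : Fin d)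
    (s : Fin N ⊕ Fin N) : wirtinger s.swap (fun Z => (r j Z : ℂ)) 0 =
      starRingEnd ℂ (wirtinger s (fun Z => (r j Z : ℂ)) 0) := by
  have := wirtinger_conj (p := 0) (fun Z => (r j Z : ℂ)) s.swap
  simpa using this

theorem IsDefiningFunction.rank_diffMatrix_inr (hr : IsDefiningFunction M r)
    (hM : IsGenericSubmanifold M d) : ((diffMatrix r 0).submatrix id Sum.inr).rank = d := by
  have h : (diffMatrix r 0).submatrix id Sum.inr =
      ((diffMatrix r 0).submatrix id Sum.inl).map (starRingEnd ℂ) := by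
    ext j k
    exact conj_wirtinger_ofReal r j (Sum.inl k)
  rw [h, ← fracRank_field, fracRank_map_of_injective _ (starRingEnd ℂ).injective, fracRank_field,
    hr.rank_diffMatrix_inl hM]

end Tangent

/-! ### Tangent vector fields, brackets and their formal counterparts. -/

section Fields

variable {N d : ℕ} {M : Set (Fin N → ℂ)} {r : Fin d → (Fin N → ℂ) → ℝ} {p : Fin N → ℂ}

theorem SmoothNear.det {k : ℕ} {A : (Fin N → ℂ) → Matrix (Fin k) (Fin k) ℂ}
    (hA : ∀ i j, SmoothNear (fun q => A q i j) p) : SmoothNear (fun q => (A q).det) p := by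
  simp_rw [Matrix.det_apply, Units.smul_def, zsmul_eq_mul]
  exact SmoothNear.sum fun π _ => (smoothNear_const _).mul (SmoothNear.prod fun i _ => hA _ _)

theorem SmoothNear.adjugate {k : ℕ} {A : (Fin N → ℂ) → Matrix (Fin k) (Fin k) ℂ}
    (hA : ∀ i j, SmoothNear (fun q => A q i j) p) (i j : Fin k) :
    SmoothNear (fun q => (A q).adjugate i j) p := by
  simp_rw [Matrix.adjugate_apply]
  refine SmoothNear.det fun a b => ?_
  simp_rw [Matrix.updateRow_apply]
  by_cases h : a = j
  · simp only [h, if_true]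
    exact smoothNear_const _
  · simp only [h, if_false]
    exact hA a b

open scoped ComplexOrder in
theorem det_mul_conjTranspose_ne_zero {κ : Type*} [Fintype κ] (A : Matrix (Fin d) κ ℂ)
    (hA : A.rank = d) : (A * A.conjTranspose).det ≠ 0 := by
  have h : (A * A.conjTranspose).rank = d := by rw [Matrix.rank_self_mul_conjTranspose, hA]
  have h2 : LinearIndependent ℂ (A * A.conjTranspose).row := by
    rw [linearIndependent_iff_card_eq_finrank_span, Set.finrank, ← Matrix.rank_eq_finrank_span_row,
      h, Fintype.card_fin]
  exact isUnit_iff_ne_zero.1 ((Matrix.isUnit_iff_isUnit_det _).1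
    (Matrix.linearIndependent_rows_iff_isUnit.1 h2))

open Matrix in
/-- Smooth vector fields annihilating the defining functions, with coefficients supported in the
set `S` of coordinates: the orthogonal projections of the coordinate vectors, up to a factor. -/
theorem IsDefiningFunction.exists_fields (hr : IsDefiningFunction M r)
    (S : Set (Fin N ⊕ Fin N)) [DecidablePred (· ∈ S)]
    (hS : (Matrix.of fun j s => if s ∈ S then diffMatrix r 0 j s else 0).rank = d) :
    ∃ (g : (Fin N → ℂ) → ℂ) (E : Fin N ⊕ Fin N → Fin d → (Fin N → ℂ) → ℂ)
      (Y : Fin N ⊕ Fin N → VField N), SmoothNear g 0 ∧ g 0 ≠ 0 ∧ (∀ s j, SmoothNear (E s j) 0) ∧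
      (∀ u, SmoothNear (Y u) 0) ∧ (∀ u q s, s ∉ S → Y u q s = 0) ∧
      (∀ u q j, ∑ s, Y u q s * wirtinger s (fun Z => (r j Z : ℂ)) q = 0) ∧
      (∀ u ∈ S, ∀ q s, Y u q s = (if s = u then g q else 0) -
        ∑ j, E s j q * wirtinger u (fun Z => (r j Z : ℂ)) q) := by
  -- Zeroing the columns outside `S` confines the projection to fields supported in `S`: all fields
  -- for the full index set, (1,0) fields for the range of `Sum.inl`.
  set D : (Fin N → ℂ) → Matrix (Fin d) (Fin N ⊕ Fin N) ℂ := fun q =>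
    Matrix.of fun j s => if s ∈ S then diffMatrix r q j s else 0 with hD
  set G : (Fin N → ℂ) → Matrix (Fin d) (Fin d) ℂ := fun q => D q * (D q)ᴴ with hG
  have hDs : ∀ j s, SmoothNear (fun q => D q j s) 0 := by
    intro j s
    by_cases h : s ∈ S
    · simp only [hD, Matrix.of_apply, h, if_true]
      exact (hr.smoothNear_ofReal j).wirtinger s
    · simp only [hD, Matrix.of_apply, h, if_false]
      exact smoothNear_const _
  have hGs : ∀ i j, SmoothNear (fun q => G q i j) 0 := by
    intro i j
    simp only [hG, Matrix.mul_apply, Matrix.conjTranspose_apply]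
    exact SmoothNear.sum fun s _ => (hDs i s).mul (hDs j s).conj
  set E : Fin N ⊕ Fin N → Fin d → (Fin N → ℂ) → ℂ := fun s j q =>
    ((D q)ᴴ * (G q).adjugate) s j with hE
  have hEs : ∀ s j, SmoothNear (E s j) 0 := by
    intro s j
    simp only [hE, Matrix.mul_apply, Matrix.conjTranspose_apply]
    exact SmoothNear.sum fun i _ => (hDs i s).conj.mul (SmoothNear.adjugate hGs i j)
  have hgs : SmoothNear (fun q => (G q).det) 0 := SmoothNear.det hGs
  -- The columns of det(G) 1_S - D* adj(G) D with G = D D*. Clearing the denominator det(G) keeps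
  -- the fields smooth and makes them annihilate the `r j` at every point, even where det(G) = 0.
  set Y : Fin N ⊕ Fin N → VField N := fun u q s =>
    (if s ∈ S then (if s = u then (G q).det else 0) else 0) - ∑ j, E s j q * D q j u with hY
  refine ⟨fun q => (G q).det, E, Y, hgs, det_mul_conjTranspose_ne_zero _ hS, hEs, ?_, ?_, ?_, ?_⟩
  · intro u
    rw [smoothNear_pi]
    intro s
    refine SmoothNear.sub ?_ (SmoothNear.sum fun j _ => (hEs s j).mul (hDs j u))
    split_ifs
    exacts [hgs, smoothNear_const _, smoothNear_const _]
  · intro u q s hs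
    have : ∀ j, E s j q = 0 := by
      intro j
      simp [hE, Matrix.mul_apply, hD, hs]
    simp [hY, hs, this]
  · intro u q j
    have h1 : ∀ s, Y u q s * wirtinger s (fun Z => (r j Z : ℂ)) q =
        D q j s * (if s = u then (G q).det else 0) -
          ∑ i, D q j s * E s i q * D q i u := by
      intro s
      by_cases hs : s ∈ S
      · have : D q j s = wirtinger s (fun Z => (r j Z : ℂ)) q := by simp [hD, hs, diffMatrix]
        rw [← this]
        simp only [hY, hs, if_true, sub_mul, Finset.sum_mul]
        rw [mul_comm]
        congr 1
        exact Finset.sum_congr rfl fun i _ => by ring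
      · have h2 : D q j s = 0 := by simp [hD, hs]
        have : ∀ j, E s j q = 0 := by
          intro j
          simp [hE, Matrix.mul_apply, hD, hs]
        simp [hY, hs, this, h2]
    simp_rw [h1]
    rw [Finset.sum_sub_distrib, Finset.sum_comm]
    have h3 : ∀ i, ∑ s, D q j s * E s i q * D q i u = (if j = i then (G q).det else 0) * D q i u := by
      intro i
      rw [← Finset.sum_mul]
      congr 1
      have : (D q * ((D q)ᴴ * (G q).adjugate)) j i = (if j = i then (G q).det else 0) := by
        rw [← Matrix.mul_assoc, Matrix.mul_adjugate]
        simp [Matrix.one_apply, hG]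
      rw [← this, Matrix.mul_apply]
    simp_rw [h3]
    simp [mul_comm]
  · intro u hu q s
    have h2 : ∀ j, D q j u = wirtinger u (fun Z => (r j Z : ℂ)) q := by
      intro j; simp [hD, hu, diffMatrix]
    simp only [hY, h2]
    congr 1
    by_cases hsu : s = u
    · subst hsu; simp [hu]
    · simp [hsu]

theorem IsDefiningFunction.isTangentField (hr : IsDefiningFunction M r) {Y : VField N}
    (hY : SmoothNear Y 0)
    (h : ∀ q j, ∑ s, Y q s * wirtinger s (fun Z => (r j Z : ℂ)) q = 0) : IsTangentField M Y := by
  refine ⟨hY, ?_⟩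
  obtain ⟨U, hUs, hU, hp⟩ := eventually_nhds_iff.1 hr.eventually_mem_complexTangentSpace_iff
  exact ⟨U, hU, hp, fun q hq => (hUs q hq.2 hq.1 _).2 (h q)⟩

/-- The formal vector field of Taylor series of the coefficients of `Y`. -/
noncomputable def formalField (Y : VField N) : Fin N ⊕ Fin N → MvPowerSeries (Fin N ⊕ Fin N) ℂ :=
  fun s => taylorSeries fun q => Y q s

/-- The action of a vector field on a function. -/
noncomputable def applyVField (Y : VField N) (f : (Fin N → ℂ) → ℂ) : (Fin N → ℂ) → ℂ :=
  fun q => ∑ s, Y q s * wirtinger s f q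

theorem SmoothNear.applyVField {Y : VField N} {f : (Fin N → ℂ) → ℂ} (hY : SmoothNear Y p)
    (hf : SmoothNear f p) : SmoothNear (applyVField Y f) p :=
  SmoothNear.sum fun s _ => (smoothNear_pi.1 hY s).mul (hf.wirtinger s)

theorem taylorSeries_applyVField {Y : VField N} {f : (Fin N → ℂ) → ℂ} (hY : SmoothNear Y 0)
    (hf : SmoothNear f 0) :
    taylorSeries (applyVField Y f) = applyField (formalField Y) (taylorSeries f) := by
  rw [applyField]
  unfold applyVField
  rw [taylorSeries_sum fun s _ => (smoothNear_pi.1 hY s).mul (hf.wirtinger s)]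
  refine Finset.sum_congr rfl fun s _ => ?_
  rw [taylorSeries_mul (smoothNear_pi.1 hY s) (hf.wirtinger s), pderiv_taylorSeries hf, formalField]

theorem IsTangentField.eventually {Y : VField N} (hY : IsTangentField M Y) :
    ∀ᶠ q in 𝓝 0, q ∈ M → Y q ∈ complexTangentSpace M q := by
  obtain ⟨_, U, hU, h0, h⟩ := hY
  filter_upwards [hU.mem_nhds h0] with q hq hM using h q ⟨hM, hq⟩

theorem isTangentField_of_eventually {Y : VField N} (hY : SmoothNear Y 0)
    (h : ∀ᶠ q in 𝓝 0, q ∈ M → Y q ∈ complexTangentSpace M q) : IsTangentField M Y := by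
  refine ⟨hY, ?_⟩
  obtain ⟨U, hUs, hU, hp⟩ := eventually_nhds_iff.1 h
  exact ⟨U, hU, hp, fun q hq => hUs q hq.2 hq.1⟩

theorem vanishesNear_applyVField {Y : VField N} {f : (Fin N → ℂ) → ℂ}
    (hY : ∀ᶠ q in 𝓝 p, q ∈ M → Y q ∈ complexTangentSpace M q) (hf : SmoothNear f p)
    (hv : VanishesNear M f p) : VanishesNear M (applyVField Y f) p := by
  rw [vanishesNear_iff]
  filter_upwards [hY, hf.eventually_smoothNear, hv.eventually] with q h1 h2 h3 hM
  exact h1 hM f h2 h3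

theorem wirtinger_applyVField {Y : VField N} {f : (Fin N → ℂ) → ℂ} (hY : SmoothNear Y p)
    (hf : SmoothNear f p) (u : Fin N ⊕ Fin N) : wirtinger u (applyVField Y f) p =
      ∑ s, (Y p s * wirtinger u (wirtinger s f) p +
        wirtinger s f p * wirtinger u (fun q => Y q s) p) := by
  unfold applyVField
  rw [wirtinger_sum fun s _ =>
    ((smoothNear_pi.1 hY s).mul (hf.wirtinger s)).differentiableAt]
  exact Finset.sum_congr rfl fun s _ => wirtinger_mul (smoothNear_pi.1 hY s).differentiableAt
    (hf.wirtinger s).differentiableAt u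

theorem applyVField_bracket {X Y : VField N} {f : (Fin N → ℂ) → ℂ} (hX : SmoothNear X p)
    (hY : SmoothNear Y p) (hf : SmoothNear f p) :
    applyVField (bracket X Y) f p =
      applyVField X (applyVField Y f) p - applyVField Y (applyVField X f) p := by
  have h1 : ∀ {X Y : VField N}, SmoothNear Y p → applyVField X (applyVField Y f) p =
      (∑ u, ∑ s, X p u * Y p s * wirtinger u (wirtinger s f) p) +
        ∑ u, ∑ s, X p u * wirtinger s f p * wirtinger u (fun q => Y q s) p := by
    intro X Y hY
    rw [applyVField, ← Finset.sum_add_distrib]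
    refine Finset.sum_congr rfl fun u _ => ?_
    rw [wirtinger_applyVField hY hf, Finset.mul_sum, ← Finset.sum_add_distrib]
    exact Finset.sum_congr rfl fun s _ => by ring
  have h2 : ∑ u, ∑ s, X p u * Y p s * wirtinger u (wirtinger s f) p =
      ∑ u, ∑ s, Y p u * X p s * wirtinger u (wirtinger s f) p := by
    rw [Finset.sum_comm]
    refine Finset.sum_congr rfl fun u _ => Finset.sum_congr rfl fun s _ => ?_
    rw [wirtinger_comm hf, mul_comm (X p s)]
  rw [h1 hY, h1 hX, h2, add_sub_add_left_eq_sub, applyVField]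
  simp only [bracket, Finset.sum_mul, sub_mul, Finset.sum_sub_distrib]
  rw [Finset.sum_comm]
  congr 1
  · exact Finset.sum_congr rfl fun u _ => Finset.sum_congr rfl fun s _ => by ring
  · rw [Finset.sum_comm]
    exact Finset.sum_congr rfl fun u _ => Finset.sum_congr rfl fun s _ => by ring

theorem smoothNear_bracket {X Y : VField N} (hX : SmoothNear X p) (hY : SmoothNear Y p) :
    SmoothNear (bracket X Y) p := by
  rw [smoothNear_pi] at hX hY ⊢
  exact fun s => SmoothNear.sum fun u _ => ((hX u).mul ((hY s).wirtinger u)).sub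
    ((hY u).mul ((hX s).wirtinger u))

theorem formalField_bracket {X Y : VField N} (hX : SmoothNear X 0) (hY : SmoothNear Y 0)
    (s : Fin N ⊕ Fin N) : formalField (bracket X Y) s =
      applyField (formalField X) (formalField Y s) - applyField (formalField Y) (formalField X s) := by
  have hYs := smoothNear_pi.1 hY s
  have hXs := smoothNear_pi.1 hX s
  have h : (fun q => bracket X Y q s) = fun q => applyVField X (fun q => Y q s) q -
      applyVField Y (fun q => X q s) q := by
    funext q
    simp [bracket, applyVField, Finset.sum_sub_distrib]
  rw [formalField, h, taylorSeries_sub (hX.applyVField hYs) (hY.applyVField hXs),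
    taylorSeries_applyVField hX hYs, taylorSeries_applyVField hY hXs]
  rfl

/-- For brackets: tangent fields map functions vanishing on `M` to such functions, hence so do their
compositions and the commutator. -/
theorem MemLieAlgebra.isTangentField {X : VField N} (hX : MemLieAlgebra M X) :
    IsTangentField M X := by
  induction hX with
  | type_one_zero X h _ => exact h
  | type_zero_one X h _ => exact h
  | add X Y _ _ hX hY =>
    refine isTangentField_of_eventually (hX.1.add hY.1) ?_
    filter_upwards [hX.eventually, hY.eventually] with q h1 h2 hM
    exact add_mem (h1 hM) (h2 hM)
  | smul c X _ hX =>
    refine isTangentField_of_eventually (smoothNear_pi.2 fun s =>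
      (smoothNear_const c).mul (smoothNear_pi.1 hX.1 s)) ?_
    filter_upwards [hX.eventually] with q h1 hM
    exact Submodule.smul_mem _ c (h1 hM)
  | commutator X Y _ _ hX hY =>
    refine isTangentField_of_eventually (smoothNear_bracket hX.1 hY.1) ?_
    filter_upwards [hX.eventually.eventually_nhds, hY.eventually.eventually_nhds,
      hX.1.eventually_smoothNear, hY.1.eventually_smoothNear] with q h1 h2 h3 h4 hM f hf hv
    have := applyVField_bracket h3 h4 hf
    rw [applyVField] at this
    rw [this]
    have e1 := vanishesNear_iff.1
      (vanishesNear_applyVField h1 (h4.applyVField hf) (vanishesNear_applyVField h2 hf hv))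
    have e2 := vanishesNear_iff.1
      (vanishesNear_applyVField h2 (h3.applyVField hf) (vanishesNear_applyVField h1 hf hv))
    rw [e1.self_of_nhds hM, e2.self_of_nhds hM, sub_zero]

theorem MemLieAlgebra.smoothNear {X : VField N} (hX : MemLieAlgebra M X) : SmoothNear X 0 :=
  hX.isTangentField.1

end Fields

/-! ### Formal tangent directions are spanned by tangent fields. -/

section Spanning

variable {N n d : ℕ} {M : Set (Fin N → ℂ)} {r : Fin d → (Fin N → ℂ) → ℝ}

/-- Both spanning claims come from g w = ∑ w_u Y_u, valid for vectors w supported in `S` and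
annihilated by the differentials: these kill the correction terms in `Y`. Since g(0) ≠ 0, the series
of g along Ξ is a unit, so no denominators appear. -/
theorem IsDefiningFunction.exists_spanning_fields (hr : IsDefiningFunction M r)
    (S : Set (Fin N ⊕ Fin N)) [DecidablePred (· ∈ S)]
    (hS : (Matrix.of fun j s => if s ∈ S then diffMatrix r 0 j s else 0).rank = d) :
    ∃ Y : Fin N ⊕ Fin N → VField N, (∀ u, IsTangentField M (Y u)) ∧
      (∀ u q s, s ∉ S → Y u q s = 0) ∧
      (∀ v : Fin N ⊕ Fin N → ℂ, (∀ s ∉ S, v s = 0) → (∀ j, ∑ s, diffMatrix r 0 j s * v s = 0) →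
        v ∈ Submodule.span ℂ (Set.range fun u => Y u 0)) ∧
      ∀ {κ : Type} {Ξ : Fin N ⊕ Fin N → MvPowerSeries κ ℂ} (_ : ∀ s, constantCoeff (Ξ s) = 0)
        (w : Fin N ⊕ Fin N → MvPowerSeries κ ℂ) (_ : ∀ s ∉ S, w s = 0)
        (_ : ∀ j, ∑ s, subst Ξ (pderiv ℂ s (taylorSeries fun Z => (r j Z : ℂ))) * w s = 0),
        w ∈ Submodule.span (MvPowerSeries κ ℂ)
          (Set.range fun u s => subst Ξ (formalField (Y u) s)) := by
  obtain ⟨g, E, Y, hg, hg0, hE, hY, hYS, hYr, hYE⟩ := hr.exists_fields S hS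
  refine ⟨Y, fun u => hr.isTangentField (hY u) (hYr u), hYS, ?_, ?_⟩
  · intro v hvS hv
    have key : v = (g 0)⁻¹ • ∑ u, v u • Y u 0 := by
      rw [eq_inv_smul_iff₀ hg0]
      funext s
      simp only [Pi.smul_apply, Finset.sum_apply, smul_eq_mul]
      have h1 : ∀ u, v u * Y u 0 s = (if s = u then g 0 * v u else 0) -
          ∑ j, E s j 0 * (diffMatrix r 0 j u * v u) := by
        intro u
        by_cases hu : u ∈ S
        · rw [hYE u hu, mul_sub, Finset.mul_sum]
          congr 1
          · split_ifs <;> ring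
          · exact Finset.sum_congr rfl fun j _ => by simp only [diffMatrix, Matrix.of_apply]; ring
        · simp [hvS u hu]
      simp_rw [h1]
      rw [Finset.sum_sub_distrib, Finset.sum_comm]
      simp_rw [← Finset.mul_sum, hv]
      simp
    rw [key]
    exact Submodule.smul_mem _ _ (Submodule.sum_mem _ fun u _ =>
      Submodule.smul_mem _ _ (Submodule.subset_span ⟨u, rfl⟩))
  · intro κ Ξ hΞ w hwS hw
    have hs := hasSubst_of_constantCoeff_zero hΞ
    set γ := subst Ξ (taylorSeries g) with hγ
    have hu : IsUnit γ := by
      rw [MvPowerSeries.isUnit_iff_constantCoeff, hγ, constantCoeff_subst' hΞ,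
        constantCoeff_taylorSeries]
      exact isUnit_iff_ne_zero.2 hg0
    have hrs : ∀ j u, SmoothNear (wirtinger u fun Z => (r j Z : ℂ)) 0 :=
      fun j u => (hr.smoothNear_ofReal j).wirtinger u
    have hform : ∀ u ∈ S, ∀ s, formalField (Y u) s = (if s = u then taylorSeries g else 0) -
        ∑ j, taylorSeries (E s j) * pderiv ℂ u (taylorSeries fun Z => (r j Z : ℂ)) := by
      intro u hu s
      have e : (fun q => Y u q s) = fun q => (if s = u then g q else 0) -
        ∑ j, E s j q * wirtinger u (fun Z => (r j Z : ℂ)) q := funext fun q => hYE u hu q s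
      have h1 : SmoothNear (fun q => if s = u then g q else 0) 0 := by
        split_ifs
        exacts [hg, smoothNear_const _]
      rw [formalField, e, taylorSeries_sub h1 (SmoothNear.sum fun j _ => (hE s j).mul (hrs j u)),
        taylorSeries_sum fun j _ => (hE s j).mul (hrs j u)]
      congr 1
      · split_ifs
        exacts [rfl, taylorSeries_zero]
      · exact Finset.sum_congr rfl fun j _ => by
          rw [taylorSeries_mul (hE s j) (hrs j u), pderiv_taylorSeries (hr.smoothNear_ofReal j)]
    have key : γ • w = ∑ u, w u • fun s => subst Ξ (formalField (Y u) s) := by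
      funext s
      simp only [Pi.smul_apply, Finset.sum_apply, smul_eq_mul]
      have h1 : ∀ u, w u * subst Ξ (formalField (Y u) s) = (if s = u then γ * w u else 0) -
          ∑ j, subst Ξ (taylorSeries (E s j)) *
            (subst Ξ (pderiv ℂ u (taylorSeries fun Z => (r j Z : ℂ))) * w u) := by
        intro u
        by_cases hu : u ∈ S
        · rw [hform u hu, subst_sub hs, subst_sum hΞ, mul_sub, Finset.mul_sum]
          congr 1
          · split_ifs
            · rw [mul_comm]
            · rw [subst_zero_series hΞ, mul_zero]
          · exact Finset.sum_congr rfl fun j _ => by rw [subst_mul hs]; ring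
        · simp [hwS u hu]
      simp_rw [h1]
      rw [Finset.sum_sub_distrib, Finset.sum_comm]
      simp_rw [← Finset.mul_sum, hw]
      simp
    obtain ⟨γ', hγ'⟩ := hu.exists_left_inv
    have : w = γ' • ∑ u, w u • fun s => subst Ξ (formalField (Y u) s) := by
      rw [← key, smul_smul, hγ', one_smul]
    rw [this]
    exact Submodule.smul_mem _ _ (Submodule.sum_mem _ fun u _ =>
      Submodule.smul_mem _ _ (Submodule.subset_span ⟨u, rfl⟩))

theorem rank_masked_of_rank_submatrix (S : Set (Fin N ⊕ Fin N)) [DecidablePred (· ∈ S)]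
    (A : Matrix (Fin d) (Fin N ⊕ Fin N) ℂ) (f : Fin N → Fin N ⊕ Fin N) (hf : ∀ k, f k ∈ S)
    (h : (A.submatrix id f).rank = d) :
    (Matrix.of fun j s => if s ∈ S then A j s else 0).rank = d := by
  have h1 := Matrix.rank_le_card_height (Matrix.of fun j s => if s ∈ S then A j s else 0)
  refine le_antisymm (by simpa using h1) ?_
  have e : A.submatrix id f = (Matrix.of fun j s => if s ∈ S then A j s else 0).submatrix id f := by
    ext j k
    simp [hf]
  have h2 := fracRank_submatrix_le (Matrix.of fun j s => if s ∈ S then A j s else 0) id f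
  rwa [← e, fracRank_field, fracRank_field, h] at h2

theorem IsSegreVarietyMapping.isFormalParametrization
    {γ : Fin N → MvPowerSeries (Fin N ⊕ Fin n) ℂ} (hγ : IsSegreVarietyMapping r γ)
    (hN : n + d = N) (hr : IsDefiningFunction M r) (hM : IsGenericSubmanifold M d) :
    IsFormalParametrization (fun j => taylorSeries fun Z => (r j Z : ℂ)) γ where
  dim := hN
  constantCoeff := hγ.constantCoeff
  subst_eq_zero := hγ.subst_eq_zero
  rank_param := hγ.rank_eq
  rank_eqn := by
    refine Eq.trans (congrArg Matrix.rank ?_) (hr.rank_diffMatrix_inl hM)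
    ext j k
    simp only [Matrix.of_apply, Matrix.submatrix_apply, diffMatrix, id]
    rw [pderiv_taylorSeries (hr.smoothNear_ofReal j), constantCoeff_taylorSeries]

/-- The Taylor series of a function vanishing on `M` vanishes on the complexification of `M`. -/
theorem IsSegreVarietyMapping.subst_taylorSeries_eq_zero
    {γ : Fin N → MvPowerSeries (Fin N ⊕ Fin n) ℂ} (hγ : IsSegreVarietyMapping r γ)
    (hN : n + d = N) (hr : IsDefiningFunction M r) (hM : IsGenericSubmanifold M d)
    {f : (Fin N → ℂ) → ℂ} (hf : SmoothNear f 0) (hv : VanishesNear M f 0)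
    {σ : Type} {a b : Fin N → MvPowerSeries σ ℂ}
    (ha : ∀ k, MvPowerSeries.constantCoeff (a k) = 0)
    (hb : ∀ k, MvPowerSeries.constantCoeff (b k) = 0)
    (hab : ∀ j, subst (Sum.elim a b) (taylorSeries fun Z => (r j Z : ℂ)) = 0) :
    subst (Sum.elim a b) (taylorSeries f) = 0 := by
  have hp := hγ.isFormalParametrization hN hr hM
  set Ξ : Fin N ⊕ Fin N → MvPowerSeries (Fin N ⊕ Fin n) ℂ :=
    Sum.elim γ fun l : Fin N => X (Sum.inl l) with hΞ
  have hΞ0 : ∀ s, MvPowerSeries.constantCoeff (Ξ s) = 0 :=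
    constantCoeff_elim hγ.constantCoeff (by simp)
  obtain ⟨Y, hYt, -, -, hYs⟩ := hr.exists_spanning_fields Set.univ
    (rank_masked_of_rank_submatrix _ _ Sum.inl (by simp) (hr.rank_diffMatrix_inl hM))
  -- The Taylor series of functions vanishing on `M` form a set stable under tangent fields. The
  -- velocities of (γ(ζ, t), ζ) are combinations of such fields, because this point satisfies ρ = 0;
  -- so the flow lemma, with all variables of weight one, reduces the claim to f(0) = 0.
  have key : subst Ξ (taylorSeries f) = 0 := by
    refine subst_eq_zero_of_flow (fun _ => 1) hΞ0
      {F | ∃ f, SmoothNear f 0 ∧ VanishesNear M f 0 ∧ taylorSeries f = F}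
      (Set.range fun u => formalField (Y u)) ?_ ?_ ?_ _ ⟨f, hf, hv, rfl⟩
    · rintro _ ⟨f, hf, hv, rfl⟩
      refine weightIdeal_one_of_constantCoeff ?_
      rw [constantCoeff_subst' hΞ0, constantCoeff_taylorSeries]
      exact (vanishesNear_iff.1 hv).self_of_nhds hM.1
    · rintro _ ⟨u, rfl⟩ _ ⟨f, hf, hv, rfl⟩
      exact ⟨applyVField (Y u) f, (hYt u).1.applyVField hf,
        vanishesNear_applyVField (hYt u).eventually hf hv, taylorSeries_applyVField (hYt u).1 hf⟩
    · intro i _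
      rw [← Set.range_comp]
      refine hYs hΞ0 _ (by simp) fun j => ?_
      have := pderiv_subst hΞ0 i (taylorSeries fun Z => (r j Z : ℂ))
      rw [hγ.subst_eq_zero, map_zero] at this
      exact this.symm
  obtain ⟨t, ht0, ht⟩ := hp.exists_parameter ha hb hab
  have hbt := constantCoeff_elim hb ht0
  have := congrArg (subst (Sum.elim b t)) key
  rw [subst_zero_series hbt, subst_subst hΞ0 hbt] at this
  rw [← this]
  congr 1
  funext s
  cases s with
  | inl k => exact ht k
  | inr l =>
    rw [hΞ, Sum.elim_inr, Sum.elim_inr, subst_X (hasSubst_of_constantCoeff_zero hbt)]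
    rfl

end Spanning

/-! ### The ideal of the formal orbit. -/

section Words

variable {N n d : ℕ} {M : Set (Fin N → ℂ)} {r : Fin d → (Fin N → ℂ) → ℝ}

/-- The composition of the formal vector fields listed in `l`. -/
noncomputable def applyWord (l : List (VField N)) (F : MvPowerSeries (Fin N ⊕ Fin N) ℂ) :
    MvPowerSeries (Fin N ⊕ Fin N) ℂ :=
  l.foldr (fun Y G => applyField (formalField Y) G) F

/-- The formal power series annihilated at `0` by all compositions of fields in the Lie algebra
`𝔤_M`. -/
def orbitIdeal (M : Set (Fin N → ℂ)) : Set (MvPowerSeries (Fin N ⊕ Fin N) ℂ) :=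
  {F | ∀ l : List (VField N), (∀ Y ∈ l, MemLieAlgebra M Y) → constantCoeff (applyWord l F) = 0}

theorem applyField_mem_orbitIdeal {Y : VField N} (hY : MemLieAlgebra M Y)
    {F : MvPowerSeries (Fin N ⊕ Fin N) ℂ} (hF : F ∈ orbitIdeal M) :
    applyField (formalField Y) F ∈ orbitIdeal M := by
  intro l hl
  have := hF (l ++ [Y]) (by
    intro Y' hY'
    rcases List.mem_append.1 hY' with h | h
    · exact hl _ h
    · rw [List.mem_singleton.1 h]; exact hY)
  rwa [applyWord, List.foldr_append] at this

theorem taylorSeries_mem_orbitIdeal (h0 : (0 : Fin N → ℂ) ∈ M) {f : (Fin N → ℂ) → ℂ}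
    (hf : SmoothNear f 0) (hv : VanishesNear M f 0) : taylorSeries f ∈ orbitIdeal M := by
  intro l hl
  suffices H : ∃ f', SmoothNear f' 0 ∧ VanishesNear M f' 0 ∧
      applyWord l (taylorSeries f) = taylorSeries f' by
    obtain ⟨f', _, h2, h3⟩ := H
    rw [h3, constantCoeff_taylorSeries]
    exact (vanishesNear_iff.1 h2).self_of_nhds h0
  induction l with
  | nil => exact ⟨f, hf, hv, rfl⟩
  | cons Y l ih =>
    obtain ⟨f', h1, h2, h3⟩ := ih fun Y' hY' => hl Y' (List.mem_cons_of_mem _ hY')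
    have hY := (hl Y List.mem_cons_self).isTangentField
    refine ⟨applyVField Y f', hY.1.applyVField h1, vanishesNear_applyVField hY.eventually h1 h2, ?_⟩
    rw [taylorSeries_applyVField hY.1 h1, ← h3]
    rfl

/-- The complex conjugate of a vector field. -/
noncomputable def conjVField (Y : VField N) : VField N :=
  fun q s => starRingEnd ℂ (Y q s.swap)

theorem sum_swap (f : Fin N ⊕ Fin N → ℂ) : ∑ s, f (Sum.swap s) = ∑ s, f s :=
  Equiv.sum_comp (Equiv.sumComm _ _) f

theorem IsTangentField.conj {Y : VField N} (hY : IsTangentField M Y) :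
    IsTangentField M (conjVField Y) := by
  refine isTangentField_of_eventually (smoothNear_pi.2 fun s =>
    (smoothNear_pi.1 hY.1 s.swap).conj) ?_
  filter_upwards [hY.eventually] with q hq hM f hf hv
  have h1 : VanishesNear M (fun q => starRingEnd ℂ (f q)) q := by
    have hv' : VanishesNear M f q := hv
    rw [vanishesNear_iff] at hv' ⊢
    filter_upwards [hv'] with q h1 h2
    rw [h1 h2, map_zero]
  have h2 := congrArg (starRingEnd ℂ) (hq hM _ hf.conj h1)
  rw [map_zero, map_sum, ← sum_swap] at h2
  rw [← h2]
  refine Finset.sum_congr rfl fun s _ => ?_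
  rw [wirtinger_conj, map_mul, Complex.conj_conj, Sum.swap_swap]
  rfl

theorem conjVField_bracket (X Y : VField N) :
    conjVField (bracket X Y) = bracket (conjVField X) (conjVField Y) := by
  funext q s
  simp only [conjVField, bracket, map_sum, map_sub, map_mul]
  rw [← Equiv.sum_comp (Equiv.sumComm (Fin N) (Fin N))]
  refine Finset.sum_congr rfl fun u _ => ?_
  rw [wirtinger_conj, wirtinger_conj]
  simp

theorem MemLieAlgebra.conj {Y : VField N} (hY : MemLieAlgebra M Y) :
    MemLieAlgebra M (conjVField Y) := by
  induction hY with
  | type_one_zero X h h' =>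
    refine .type_zero_one _ h.conj fun q k => ?_
    simp [conjVField, h']
  | type_zero_one X h h' =>
    refine .type_one_zero _ h.conj fun q k => ?_
    simp [conjVField, h']
  | add X Y _ _ hX hY =>
    have : conjVField (X + Y) = conjVField X + conjVField Y := by
      funext q s; simp [conjVField]
    rw [this]
    exact hX.add _ _ hY
  | smul c X _ hX =>
    have : conjVField (c • X) = starRingEnd ℂ c • conjVField X := by
      funext q s; simp [conjVField]
    rw [this]
    exact hX.smul _ _
  | commutator X Y _ _ hX hY =>
    rw [conjVField_bracket]
    exact hX.commutator _ _ hY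

theorem conjSwap_conjSwap (F : MvPowerSeries (Fin N ⊕ Fin N) ℂ) : conjSwap (conjSwap F) = F := by
  rw [conjSwap_eq_subst, conjSwap_eq_subst, conjSeries_subst (by simp), conjSeries_conjSeries,
    subst_subst (by simp [conjSeries_X]) (by simp)]
  have : (fun s : Fin N ⊕ Fin N => subst (fun s => (X (Sum.swap s) : MvPowerSeries _ ℂ))
      (conjSeries (X (Sum.swap s) : MvPowerSeries (Fin N ⊕ Fin N) ℂ))) = X := by
    funext s
    rw [conjSeries_X, subst_X (hasSubst_of_constantCoeff_zero (by simp)), Sum.swap_swap]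
  rw [this, subst_self]
  rfl

theorem applyField_conjSwap {Y : VField N} (hY : SmoothNear Y 0)
    (F : MvPowerSeries (Fin N ⊕ Fin N) ℂ) : applyField (formalField (conjVField Y)) (conjSwap F) =
      conjSwap (applyField (formalField Y) F) := by
  have h1 : ∀ G : Fin N ⊕ Fin N → MvPowerSeries (Fin N ⊕ Fin N) ℂ,
      conjSwap (∑ s, G s) = ∑ s, conjSwap (G s) := by
    intro G; simp [conjSwap, conjSeries]
  rw [applyField, applyField, h1, ← Equiv.sum_comp (Equiv.sumComm (Fin N) (Fin N))]
  refine Finset.sum_congr rfl fun s _ => ?_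
  rw [pderiv_conjSwap, formalField, formalField]
  have h2 : ∀ G G' : MvPowerSeries (Fin N ⊕ Fin N) ℂ,
      conjSwap (G * G') = conjSwap G * conjSwap G' := by
    intro G G'; simp [conjSwap, conjSeries]
  rw [h2, ← taylorSeries_conj (smoothNear_pi.1 hY s)]
  simp [conjVField]

/-- Conjugation of fields exchanges the (1,0) and (0,1) generators and preserves brackets, so 𝔤_M is
stable under it and the formal orbit is invariant under reflection. -/
theorem conjSwap_mem_orbitIdeal {F : MvPowerSeries (Fin N ⊕ Fin N) ℂ} (hF : F ∈ orbitIdeal M) :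
    conjSwap F ∈ orbitIdeal M := by
  intro l hl
  have h : ∀ l : List (VField N), (∀ Y ∈ l, MemLieAlgebra M Y) →
      applyWord l (conjSwap F) = conjSwap (applyWord (l.map conjVField) F) := by
    intro l hl
    induction l with
    | nil => rfl
    | cons Y l ih =>
      have hY := hl Y List.mem_cons_self
      have e : conjVField (conjVField Y) = Y := by
        funext q s; simp [conjVField]
      have := applyField_conjSwap hY.conj.smoothNear (applyWord (l.map conjVField) F)
      rw [e, ← ih fun Y' hY' => hl Y' (List.mem_cons_of_mem _ hY')] at this
      exact this
  rw [h l hl, constantCoeff_conjSwap, hF _ ?_, map_zero]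
  intro Y hY
  obtain ⟨Y', hY', rfl⟩ := List.mem_map.1 hY
  exact (hl _ hY').conj

end Words

/-! ### The Segre mappings stay in the formal orbit. -/

section SegreOrbit

variable {N n d : ℕ} {M : Set (Fin N → ℂ)} {r : Fin d → (Fin N → ℂ) → ℝ}
  {γ : Fin N → MvPowerSeries (Fin N ⊕ Fin n) ℂ}

/-- The substitution of `c` for the last group `t^{j+1}` of indeterminates. -/
noncomputable def lastSubst {j n : ℕ} (c : Fin n → MvPowerSeries (Fin (j + 1) × Fin n) ℂ) :
    Fin (j + 1) × Fin n → MvPowerSeries (Fin (j + 1) × Fin n) ℂ :=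
  fun s => if s.1 = Fin.last j then c s.2 else X s

theorem constantCoeff_lastSubst {j n : ℕ} {c : Fin n → MvPowerSeries (Fin (j + 1) × Fin n) ℂ}
    (hc : ∀ i, constantCoeff (c i) = 0) (s : Fin (j + 1) × Fin n) :
    constantCoeff (lastSubst c s) = 0 := by
  rw [lastSubst]
  split_ifs
  exacts [hc _, constantCoeff_X _]

theorem lastSubst_last {j n : ℕ} (c : Fin n → MvPowerSeries (Fin (j + 1) × Fin n) ℂ) (i : Fin n) :
    lastSubst c (Fin.last j, i) = c i := by simp [lastSubst]

theorem subst_lastSubst_liftSeries {j n : ℕ} {c : Fin n → MvPowerSeries (Fin (j + 1) × Fin n) ℂ}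
    (hc : ∀ i, constantCoeff (c i) = 0) (f : MvPowerSeries (Fin j × Fin n) ℂ) :
    subst (lastSubst c) (liftSeries f) = liftSeries f := by
  rw [subst_liftSeries (constantCoeff_lastSubst hc), liftSeries_eq_subst]
  congr 1
  funext s
  simp [lastSubst, (Fin.castSucc_lt_last s.1).ne]

/-- The point `(γ(b, t), b)` of the formal variety parametrized by `γ`. -/
noncomputable def graphPoint {σ : Type*} (γ : Fin N → MvPowerSeries (Fin N ⊕ Fin n) ℂ)
    (b : Fin N → MvPowerSeries σ ℂ) (t : Fin n → MvPowerSeries σ ℂ) :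
    Fin N ⊕ Fin N → MvPowerSeries σ ℂ :=
  Sum.elim (fun k => subst (Sum.elim b t) (γ k)) b

section GraphPoint

variable {σ τ : Type*} {b : Fin N → MvPowerSeries σ ℂ} {t : Fin n → MvPowerSeries σ ℂ}

theorem constantCoeff_graphPoint (hγ : ∀ k, constantCoeff (γ k) = 0)
    (hb : ∀ k, constantCoeff (b k) = 0) (ht : ∀ i, constantCoeff (t i) = 0) (s : Fin N ⊕ Fin N) :
    constantCoeff (graphPoint γ b t s) = 0 :=
  constantCoeff_elim (fun k => by rw [constantCoeff_subst' (constantCoeff_elim hb ht), hγ]) hb s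

theorem subst_subst_graphPoint [Finite σ] (hγ : ∀ k, constantCoeff (γ k) = 0)
    (hb : ∀ k, constantCoeff (b k) = 0) (ht : ∀ i, constantCoeff (t i) = 0)
    {c : σ → MvPowerSeries τ ℂ} (hc : ∀ s, constantCoeff (c s) = 0)
    (F : MvPowerSeries (Fin N ⊕ Fin N) ℂ) : subst c (subst (graphPoint γ b t) F) =
      subst (graphPoint γ (fun l => subst c (b l)) fun i => subst c (t i)) F := by
  rw [subst_subst (constantCoeff_graphPoint hγ hb ht) hc]
  congr 1
  funext s
  cases s with
  | inl k =>
    rw [graphPoint, graphPoint, Sum.elim_inl, Sum.elim_inl,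
      subst_subst (constantCoeff_elim hb ht) hc]
    congr 1
    funext s
    cases s <;> rfl
  | inr l => rfl

theorem subst_graphPoint_eq (hγ : ∀ k, constantCoeff (γ k) = 0)
    (hb : ∀ k, constantCoeff (b k) = 0) (ht : ∀ i, constantCoeff (t i) = 0)
    (F : MvPowerSeries (Fin N ⊕ Fin N) ℂ) : subst (graphPoint γ b t) F =
      subst (Sum.elim b t) (subst (Sum.elim γ fun l : Fin N => X (Sum.inl l)) F) := by
  rw [subst_subst (constantCoeff_elim hγ (by simp)) (constantCoeff_elim hb ht)]
  congr 1
  funext s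
  cases s with
  | inl k => rfl
  | inr l =>
    rw [Sum.elim_inr, subst_X (hasSubst_of_constantCoeff_zero (constantCoeff_elim hb ht))]
    rfl

end GraphPoint

theorem X_sub_lastSubst_mem_weightIdeal {j n : ℕ} (s : Fin (j + 1) × Fin n) :
    X s - lastSubst 0 s ∈ weightIdeal (fun s : Fin (j + 1) × Fin n =>
      if s.1 = Fin.last j then 1 else 0) 1 := by
  intro e he
  rw [lastSubst]
  split_ifs with hs
  · classical
    rw [Pi.zero_apply, sub_zero, coeff_X, if_neg]
    rintro rfl
    rw [Finsupp.weight_single, if_pos hs] at he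
    simp at he
  · rw [sub_self, map_zero]

/-- If the formal orbit contains the point `(γ(b, τ), b)`, it contains `(γ(b, t), b)`. -/
theorem IsSegreVarietyMapping.subst_orbitIdeal_of_parameter (hγ : IsSegreVarietyMapping r γ)
    (hr : IsDefiningFunction M r) (hM : IsGenericSubmanifold M d) {j : ℕ}
    {b : Fin N → MvPowerSeries (Fin j × Fin n) ℂ} (hb : ∀ k, MvPowerSeries.constantCoeff (b k) = 0)
    {τ : Fin n → MvPowerSeries (Fin j × Fin n) ℂ} (hτ : ∀ i, MvPowerSeries.constantCoeff (τ i) = 0)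
    (h : ∀ F ∈ orbitIdeal M, subst (graphPoint γ b τ) F = 0) :
    ∀ F ∈ orbitIdeal M, subst (graphPoint γ (fun l => liftSeries (b l))
      fun i => (X ((Fin.last j, i) : Fin (j + 1) × Fin n) : MvPowerSeries _ ℂ)) F = 0 := by
  classical
  have hγ0 := hγ.constantCoeff
  obtain ⟨b', hb'⟩ : ∃ b' : Fin N → MvPowerSeries (Fin (j + 1) × Fin n) ℂ,
    b' = fun l => liftSeries (b l) := ⟨_, rfl⟩
  obtain ⟨τ', hτ'⟩ : ∃ τ' : Fin n → MvPowerSeries (Fin (j + 1) × Fin n) ℂ,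
    τ' = fun l => liftSeries (τ l) := ⟨_, rfl⟩
  obtain ⟨x, hx⟩ : ∃ x : Fin n → MvPowerSeries (Fin (j + 1) × Fin n) ℂ,
    x = fun i => X (Fin.last j, i) := ⟨_, rfl⟩
  have hb0 : ∀ l, MvPowerSeries.constantCoeff (b' l) = 0 := fun l => by
    rw [hb', constantCoeff_liftSeries, hb]
  have hτ0 : ∀ i, MvPowerSeries.constantCoeff (τ' i) = 0 := fun l => by
    rw [hτ', constantCoeff_liftSeries, hτ]
  have hx0 : ∀ i, MvPowerSeries.constantCoeff (x i) = 0 := fun i => by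
    rw [hx, constantCoeff_X]
  have ht : ∀ i, MvPowerSeries.constantCoeff (x i + τ' i) = 0 := fun i => by
    rw [map_add, hτ0, hx0, add_zero]
  have hc : ∀ i, MvPowerSeries.constantCoeff (x i - τ' i) = 0 := fun i => by
    rw [map_sub, hτ0, hx0, sub_zero]
  have hsub : ∀ c : Fin n → MvPowerSeries (Fin (j + 1) × Fin n) ℂ,
      (∀ i, MvPowerSeries.constantCoeff (c i) = 0) →
      ∀ F : MvPowerSeries (Fin N ⊕ Fin N) ℂ, subst (lastSubst c)
        (subst (graphPoint γ b' fun i => x i + τ' i) F) =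
          subst (graphPoint γ b' fun i => c i + τ' i) F := by
    intro c hc F
    have hl := constantCoeff_lastSubst hc
    have hs := hasSubst_of_constantCoeff_zero hl
    rw [subst_subst_graphPoint hγ0 hb0 ht hl]
    congr 2
    · funext l
      rw [hb', subst_lastSubst_liftSeries hc]
    · funext i
      rw [subst_add hs, hτ', subst_lastSubst_liftSeries hc, hx, subst_X hs, lastSubst_last]
  -- The translation by τ places the known point of the orbit at x = 0, where the flow lemma needs
  -- its initial condition.
  obtain ⟨Ξ, hΞ⟩ : ∃ Ξ, Ξ = graphPoint γ b' fun i => x i + τ' i := ⟨_, rfl⟩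
  have hΞ0 : ∀ s, MvPowerSeries.constantCoeff (Ξ s) = 0 := by
    rw [hΞ]; exact constantCoeff_graphPoint hγ0 hb0 ht
  obtain ⟨Y, hYt, hYS, -, hYs⟩ := hr.exists_spanning_fields (Set.range Sum.inl)
    (rank_masked_of_rank_submatrix _ _ Sum.inl (by simp) (hr.rank_diffMatrix_inl hM))
  have hρ : ∀ j, subst Ξ (taylorSeries fun Z => (r j Z : ℂ)) = 0 := by
    intro j'
    rw [hΞ, subst_graphPoint_eq hγ0 hb0 ht, hγ.subst_eq_zero,
      subst_zero_series (constantCoeff_elim hb0 ht)]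
  have key : ∀ F ∈ orbitIdeal M, subst Ξ F = 0 := by
    refine subst_eq_zero_of_flow (fun s => if s.1 = Fin.last j then 1 else 0) hΞ0 (orbitIdeal M)
      (Set.range fun u => formalField (Y u)) ?_ ?_ ?_
    · intro F hF
      have h0 : subst (lastSubst (0 : Fin n → MvPowerSeries (Fin (j + 1) × Fin n) ℂ))
          (subst Ξ F) = 0 := by
        rw [hΞ, hsub 0 (by simp)]
        have h2 := congrArg liftSeries (h F hF)
        rw [map_zero, liftSeries_eq_subst, subst_subst_graphPoint hγ0 hb hτ (by simp)] at h2
        simp_rw [← liftSeries_eq_subst] at h2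
        rw [← h2, hb', hτ']
        simp_rw [Pi.zero_apply, zero_add]
      have h1 := sub_subst_mem_weightIdeal (fun s : Fin (j + 1) × Fin n =>
        if s.1 = Fin.last j then 1 else 0) (a := lastSubst 0)
        (constantCoeff_lastSubst (by simp)) X_sub_lastSubst_mem_weightIdeal (subst Ξ F)
      rwa [h0, sub_zero] at h1
    · rintro _ ⟨u, rfl⟩ F hF
      exact applyField_mem_orbitIdeal
        (.type_one_zero _ (hYt u) fun q k => hYS u q _ (by simp)) hF
    · rintro ⟨a, i⟩ hi
      obtain rfl : a = Fin.last j := by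
        by_contra hne
        exact hi (if_neg hne)
      rw [← Set.range_comp]
      -- The base does not involve x, so the velocity in x has only Z-components: it is a
      -- combination of (1,0) fields.
      refine hYs hΞ0 _ ?_ fun j' => ?_
      · rintro (k | l) hs
        · exact absurd ⟨k, rfl⟩ hs
        · rw [hΞ, graphPoint, Sum.elim_inr, hb']
          exact pderiv_liftSeries_last i _
      · have := pderiv_subst hΞ0 (Fin.last j, i) (taylorSeries fun Z => (r j' Z : ℂ))
        rw [hρ, map_zero] at this
        exact this.symm
  intro F hF
  -- The substitution x ↦ x - τ undoes the translation.
  have h4 := hsub _ hc F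
  rw [← hΞ, key F hF, subst_zero_series (constantCoeff_lastSubst hc)] at h4
  rw [← hb', ← hx, h4]
  simp_rw [sub_add_cancel]

/-- If (v^{j+1}, v̄^j) lies in the orbit, so does its reflection (v^j, v̄^{j+1}). The latter
satisfies ρ = 0 and is therefore (γ(v̄^{j+1}, τ), v̄^{j+1}) for some τ; moving τ to the free
variable t^{j+2} along (1,0) fields gives (v^{j+2}, v̄^{j+1}). The induction starts at the origin.
-/
theorem IsSegreVarietyMapping.subst_segrePoint_orbitIdeal (hγ : IsSegreVarietyMapping r γ)
    (hN : n + d = N) (hr : IsDefiningFunction M r) (hM : IsGenericSubmanifold M d) (j : ℕ) :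
    ∀ F ∈ orbitIdeal M, subst (segrePoint γ j) F = 0 := by
  have hv : ∀ j k, MvPowerSeries.constantCoeff (conjSeries (iteratedSegre γ j k)) = 0 := by
    intro j k
    simp [constantCoeff_iteratedSegre hγ.constantCoeff]
  have hstep : ∀ j, (∃ τ : Fin n → MvPowerSeries (Fin j × Fin n) ℂ,
      (∀ i, MvPowerSeries.constantCoeff (τ i) = 0) ∧ ∀ F ∈ orbitIdeal M,
        subst (graphPoint γ (fun l => conjSeries (iteratedSegre γ j l)) τ) F = 0) →
      ∀ F ∈ orbitIdeal M, subst (segrePoint γ j) F = 0 := by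
    rintro j ⟨τ, hτ, h⟩
    exact hγ.subst_orbitIdeal_of_parameter hr hM (hv j) hτ h
  refine hstep j ?_
  induction j with
  | zero =>
    refine ⟨0, by simp, fun F hF => ?_⟩
    have hF0 : MvPowerSeries.constantCoeff F = 0 := hF [] (by simp)
    have h0 : (fun l => conjSeries (iteratedSegre γ 0 l)) = 0 := by
      funext l; simp [iteratedSegre, conjSeries_zero]
    rw [h0]
    have h1 : graphPoint γ (0 : Fin N → MvPowerSeries (Fin 0 × Fin n) ℂ) 0 = 0 := by
      funext s
      cases s with
      | inl k =>
        have : (Sum.elim 0 0 : Fin N ⊕ Fin n → MvPowerSeries (Fin 0 × Fin n) ℂ) = 0 := by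
          funext s; cases s <;> rfl
        rw [graphPoint, Sum.elim_inl, this]
        exact subst_zero_of_constantCoeff_zero (hγ.constantCoeff k)
      | inr l => rfl
    rw [h1]
    exact subst_zero_of_constantCoeff_zero hF0
  | succ j ih =>
    have hP := hstep j ih
    have h1 : ∀ F ∈ orbitIdeal M, subst (Sum.elim (fun k => conjSeries (segreBase γ j k))
        fun l => conjSeries (iteratedSegre γ (j + 1) l)) F = 0 := by
      intro F hF
      have := congrArg conjSeries (hP _ (conjSwap_mem_orbitIdeal hF))
      rwa [segrePoint, conjSeries_subst_elim (constantCoeff_iteratedSegre hγ.constantCoeff _)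
        (constantCoeff_segreBase hγ.constantCoeff _), conjSwap_conjSwap, conjSeries_zero] at this
    obtain ⟨τ, hτ, h2⟩ := (hγ.isFormalParametrization hN hr hM).exists_parameter
      (a := fun k => conjSeries (segreBase γ j k))
      (by simp [constantCoeff_segreBase hγ.constantCoeff]) (hv (j + 1))
      fun j' => h1 _ (taylorSeries_mem_orbitIdeal hM.1 (hr.smoothNear_ofReal j')
        (hr.vanishesNear j'))
    refine ⟨τ, hτ, fun F hF => ?_⟩
    rw [graphPoint]
    simp_rw [← h2]
    exact h1 F hF

end SegreOrbit

/-! ### Formal vector fields as derivations. -/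

section FormalFields

variable {τ : Type*}

theorem pderiv_comm (s u : τ) (f : MvPowerSeries τ ℂ) :
    pderiv ℂ s (pderiv ℂ u f) = pderiv ℂ u (pderiv ℂ s f) := by
  classical
  ext e
  simp only [coeff_pderiv]
  rw [add_right_comm]
  by_cases h : s = u
  · rw [h]
  · simp [h, Ne.symm h, mul_right_comm]

variable [Fintype τ]

/-- `applyField` as a derivation. -/
noncomputable def fieldDerivation (Y : τ → MvPowerSeries τ ℂ) :
    Derivation ℂ (MvPowerSeries τ ℂ) (MvPowerSeries τ ℂ) := ∑ s, Y s • pderiv ℂ s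

theorem fieldDerivation_apply (Y : τ → MvPowerSeries τ ℂ) (f : MvPowerSeries τ ℂ) :
    fieldDerivation Y f = applyField Y f := by
  rw [fieldDerivation, applyField]
  refine (congrFun (map_sum Derivation.coeFnAddMonoidHom (fun s => Y s • pderiv ℂ s)
    Finset.univ) f).trans ?_
  rw [Finset.sum_apply]
  rfl

theorem applyField_mul (Y : τ → MvPowerSeries τ ℂ) (f g : MvPowerSeries τ ℂ) :
    applyField Y (f * g) = applyField Y f * g + f * applyField Y g := by
  rw [← fieldDerivation_apply, Derivation.leibniz, fieldDerivation_apply, fieldDerivation_apply,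
    smul_eq_mul, smul_eq_mul]
  ring

theorem applyField_add (Y : τ → MvPowerSeries τ ℂ) (f g : MvPowerSeries τ ℂ) :
    applyField Y (f + g) = applyField Y f + applyField Y g := by
  simp only [← fieldDerivation_apply, map_add]

theorem applyField_const_mul (Y : τ → MvPowerSeries τ ℂ) (c : ℂ) (f : MvPowerSeries τ ℂ) :
    applyField Y (C c * f) = C c * applyField Y f := by
  simp only [← fieldDerivation_apply, ← smul_eq_C_mul]
  exact Derivation.map_smul _ _ _

theorem applyField_bracket (Y Y' : τ → MvPowerSeries τ ℂ) (f : MvPowerSeries τ ℂ) :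
    applyField (fun s => applyField Y (Y' s) - applyField Y' (Y s)) f =
      applyField Y (applyField Y' f) - applyField Y' (applyField Y f) := by
  have h1 : ∀ Y Y' : τ → MvPowerSeries τ ℂ, applyField Y (applyField Y' f) =
      (∑ u, ∑ s, Y u * Y' s * pderiv ℂ u (pderiv ℂ s f)) +
        ∑ s, applyField Y (Y' s) * pderiv ℂ s f := by
    intro Y Y'
    simp only [applyField, map_sum, Derivation.leibniz, smul_eq_mul, Finset.mul_sum, Finset.sum_mul]
    rw [Finset.sum_comm (f := fun s u => Y u * pderiv ℂ u (Y' s) * pderiv ℂ s f),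
      ← Finset.sum_add_distrib]
    refine Finset.sum_congr rfl fun u _ => ?_
    rw [← Finset.sum_add_distrib]
    exact Finset.sum_congr rfl fun s _ => by ring
  have h2 : ∑ u, ∑ s, Y u * Y' s * pderiv ℂ u (pderiv ℂ s f) =
      ∑ u, ∑ s, Y' u * Y s * pderiv ℂ u (pderiv ℂ s f) := by
    rw [Finset.sum_comm]
    exact Finset.sum_congr rfl fun u _ => Finset.sum_congr rfl fun s _ => by
      rw [pderiv_comm, mul_comm (Y s)]
  rw [h1 Y Y', h1 Y' Y, h2, add_sub_add_left_eq_sub, applyField]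
  simp only [sub_mul, Finset.sum_sub_distrib]

theorem constantCoeff_applyField (Y : τ → MvPowerSeries τ ℂ) (f : MvPowerSeries τ ℂ) :
    constantCoeff (applyField Y f) =
      ∑ s, constantCoeff (Y s) * constantCoeff (pderiv ℂ s f) := by
  simp [applyField]

theorem applyField_mem_orderIdeal (Y : τ → MvPowerSeries τ ℂ) {k : ℕ} {f : MvPowerSeries τ ℂ}
    (hf : f ∈ orderIdeal τ (k + 1)) : applyField Y f ∈ orderIdeal τ k :=
  Ideal.sum_mem _ fun s _ => Ideal.mul_mem_left _ _ (pderiv_mem_orderIdeal s hf)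

end FormalFields

/-! ### Compositions of fields evaluated at the origin. -/

section Words

variable {N : ℕ} {M : Set (Fin N → ℂ)}

/-- The value at the origin of the composition of vector fields `l` applied to `F`. -/
noncomputable def wordValue (l : List (VField N)) (F : MvPowerSeries (Fin N ⊕ Fin N) ℂ) : ℂ :=
  constantCoeff (applyWord l F)

theorem applyWord_append (l l' : List (VField N)) (F : MvPowerSeries (Fin N ⊕ Fin N) ℂ) :
    applyWord (l ++ l') F = applyWord l (applyWord l' F) := by
  rw [applyWord, List.foldr_append]; rfl

theorem applyWord_cons (Y : VField N) (l : List (VField N))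
    (F : MvPowerSeries (Fin N ⊕ Fin N) ℂ) :
    applyWord (Y :: l) F = applyField (formalField Y) (applyWord l F) := rfl

theorem wordValue_concat (l : List (VField N)) (Y : VField N)
    (F : MvPowerSeries (Fin N ⊕ Fin N) ℂ) :
    wordValue (l ++ [Y]) F = wordValue l (applyField (formalField Y) F) := by
  rw [wordValue, applyWord_append]; rfl

theorem applyWord_add (l : List (VField N)) (F G : MvPowerSeries (Fin N ⊕ Fin N) ℂ) :
    applyWord l (F + G) = applyWord l F + applyWord l G := by
  induction l with
  | nil => rfl
  | cons Y l ih => rw [applyWord_cons, ih, applyField_add]; rfl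

theorem applyWord_const_mul (l : List (VField N)) (c : ℂ) (F : MvPowerSeries (Fin N ⊕ Fin N) ℂ) :
    applyWord l (C c * F) = C c * applyWord l F := by
  induction l with
  | nil => rfl
  | cons Y l ih => rw [applyWord_cons, ih, applyField_const_mul]; rfl

/-- `wordValue` as a linear form. -/
noncomputable def wordForm (l : List (VField N)) : MvPowerSeries (Fin N ⊕ Fin N) ℂ →ₗ[ℂ] ℂ where
  toFun := wordValue l
  map_add' F G := by rw [wordValue, applyWord_add, map_add]; rfl
  map_smul' c F := by
    rw [wordValue, smul_eq_C_mul, applyWord_const_mul, map_mul, constantCoeff_C]; rfl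

theorem wordForm_apply (l : List (VField N)) (F : MvPowerSeries (Fin N ⊕ Fin N) ℂ) :
    wordForm l F = wordValue l F := rfl

theorem wordValue_of_mem_orderIdeal {l : List (VField N)} {k : ℕ} (hl : l.length < k)
    {F : MvPowerSeries (Fin N ⊕ Fin N) ℂ} (hF : F ∈ orderIdeal _ k) : wordValue l F = 0 := by
  have : ∀ (l : List (VField N)) (k : ℕ) (F : MvPowerSeries (Fin N ⊕ Fin N) ℂ),
      F ∈ orderIdeal _ (k + l.length) → applyWord l F ∈ orderIdeal _ k := by
    intro l
    induction l with
    | nil => exact fun k F hF => hF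
    | cons Y l ih =>
      intro k F hF
      rw [applyWord_cons]
      refine applyField_mem_orderIdeal _ (ih (k + 1) F ?_)
      rwa [List.length_cons, add_comm l.length, ← add_assoc] at hF
  exact mem_orderIdeal_one.1 (this l 1 F (orderIdeal_anti (by omega) hF))

/-- All letters of the word are consumed by the order of `p`, so no derivative is left for `g`. -/
theorem wordValue_mul_of_mem_orderIdeal {l : List (VField N)}
    {p : MvPowerSeries (Fin N ⊕ Fin N) ℂ} (hp : p ∈ orderIdeal _ l.length)
    (g : MvPowerSeries (Fin N ⊕ Fin N) ℂ) :
    wordValue l (g * p) = constantCoeff g * wordValue l p := by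
  have h1 : g * p = C (constantCoeff g) * p + (g - C (constantCoeff g)) * p := by ring
  have h2 : wordValue l ((g - C (constantCoeff g)) * p) = 0 := by
    refine wordValue_of_mem_orderIdeal (Nat.lt_succ_self _) ?_
    rw [Nat.succ_eq_add_one, add_comm]
    exact mul_mem_orderIdeal (mem_orderIdeal_one.2 (by simp)) hp
  rw [h1, ← wordForm_apply, map_add, wordForm_apply, wordForm_apply, h2, add_zero, ← smul_eq_C_mul,
    ← wordForm_apply, map_smul, smul_eq_mul, wordForm_apply]

/-- The words in the Lie algebra `𝔤_M`. -/
def IsWord (M : Set (Fin N → ℂ)) (l : List (VField N)) : Prop := ∀ Y ∈ l, MemLieAlgebra M Y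

theorem IsWord.append {l l' : List (VField N)} (h : IsWord M l) (h' : IsWord M l') :
    IsWord M (l ++ l') := fun Y hY => (List.mem_append.1 hY).elim (h Y) (h' Y)

theorem isWord_singleton {Y : VField N} (hY : MemLieAlgebra M Y) : IsWord M [Y] := by
  intro Y' h
  rwa [List.mem_singleton.1 h]

/-- `F` is annihilated by words of length less than `k`. -/
def VanishesToOrder (M : Set (Fin N → ℂ)) (k : ℕ) (F : MvPowerSeries (Fin N ⊕ Fin N) ℂ) : Prop :=
  ∀ l, IsWord M l → l.length < k → wordValue l F = 0

theorem VanishesToOrder.applyField {k : ℕ} {F : MvPowerSeries (Fin N ⊕ Fin N) ℂ}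
    (hF : VanishesToOrder M (k + 1) F) {Y : VField N} (hY : MemLieAlgebra M Y) :
    VanishesToOrder M k (applyField (formalField Y) F) := by
  intro l hl hk
  rw [← wordValue_concat]
  exact hF _ (hl.append (isWord_singleton hY)) (by simpa using hk)

theorem applyField_formalField_bracket {X Y : VField N} (hX : SmoothNear X 0)
    (hY : SmoothNear Y 0) (F : MvPowerSeries (Fin N ⊕ Fin N) ℂ) :
    applyField (formalField (bracket X Y)) F =
      applyField (formalField X) (applyField (formalField Y) F) -
        applyField (formalField Y) (applyField (formalField X) F) := by
  rw [← applyField_bracket]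
  congr 1
  funext s
  exact formalField_bracket hX hY s

/-- Exchanging two neighbours costs a word with their bracket as a single letter. It is one letter
shorter and still a word in 𝔤_M, hence annihilates `F`: leading words behave like symmetric tensors.
-/
theorem VanishesToOrder.wordValue_perm {k : ℕ} {F : MvPowerSeries (Fin N ⊕ Fin N) ℂ}
    (hF : VanishesToOrder M k F) {l l' : List (VField N)} (hp : l.Perm l') (hl : IsWord M l)
    (hk : l.length ≤ k) : wordValue l F = wordValue l' F := by
  suffices H : ∀ l₀, IsWord M (l₀ ++ l) → (l₀ ++ l).length ≤ k →
      wordValue (l₀ ++ l) F = wordValue (l₀ ++ l') F from H [] hl hk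
  clear hl hk
  induction hp with
  | nil => exact fun _ _ _ => rfl
  | cons Y _ ih =>
    intro l₀ h1 h2
    have := ih (l₀ ++ [Y]) (by simpa using h1) (by simpa using h2)
    simpa using this
  | swap X Y l =>
    intro l₀ h1 h2
    have hX : MemLieAlgebra M X := h1 X (by simp)
    have hY : MemLieAlgebra M Y := h1 Y (by simp)
    have h3 : wordValue (l₀ ++ bracket Y X :: l) F = 0 := by
      refine hF _ ?_ (by simp at h2 ⊢; omega)
      intro Z hZ
      simp only [List.mem_append, List.mem_cons] at hZ
      rcases hZ with h | rfl | h
      · exact h1 Z (by simp [h])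
      · exact hY.commutator _ _ hX
      · exact h1 Z (by simp [h])
    rw [wordValue, applyWord_append, applyWord_cons,
      applyField_formalField_bracket hY.smoothNear hX.smoothNear] at h3
    change wordForm l₀ (_ - _) = 0 at h3
    rw [map_sub, sub_eq_zero] at h3
    rw [wordValue, applyWord_append, wordValue, applyWord_append]
    exact h3
  | trans h _ ih1 ih2 =>
    intro l₀ h1 h2
    rw [ih1 l₀ h1 h2]
    refine ih2 l₀ (fun Y hY => h1 Y ?_) ?_
    · exact ((h.append_left l₀).mem_iff).2 hY
    · rwa [← (h.append_left l₀).length_eq]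

theorem constantCoeff_formalField (Y : VField N) (s : Fin N ⊕ Fin N) :
    constantCoeff (formalField Y s) = Y 0 s := constantCoeff_taylorSeries _

/-- By symmetry the letter may be moved to the outermost position, where only its value at the
origin matters. -/
theorem VanishesToOrder.wordValue_sum {k : ℕ} {F : MvPowerSeries (Fin N ⊕ Fin N) ℂ}
    (hF : VanishesToOrder M k F) {l : List (VField N)} (hl : IsWord M l) (hk : l.length + 1 ≤ k)
    {ι : Type*} [Fintype ι] {E : ι → VField N} (hE : ∀ i, MemLieAlgebra M (E i)) {Y : VField N}
    (hY : MemLieAlgebra M Y) {c : ι → ℂ} (h : Y 0 = ∑ i, c i • E i 0) :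
    wordValue (l ++ [Y]) F = ∑ i, c i * wordValue (l ++ [E i]) F := by
  have h1 : ∀ {Z : VField N}, MemLieAlgebra M Z → wordValue (l ++ [Z]) F =
      ∑ s, Z 0 s * constantCoeff (pderiv ℂ s (applyWord l F)) := by
    intro Z hZ
    rw [hF.wordValue_perm (List.perm_append_singleton Z l) (hl.append (isWord_singleton hZ))
      (by simpa using hk), wordValue, applyWord_cons, constantCoeff_applyField]
    simp_rw [constantCoeff_formalField]
  rw [h1 hY]
  simp_rw [h1 (hE _), h, Finset.sum_apply, Pi.smul_apply, smul_eq_mul, Finset.sum_mul,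
    Finset.mul_sum]
  rw [Finset.sum_comm]
  simp_rw [mul_assoc]

end Words

/-! ### A formal version of Nagano's theorem. -/

section Nagano

variable {N : ℕ} {M : Set (Fin N → ℂ)}

/-- The linear form with coefficients `a`, as a formal power series. -/
noncomputable def linearSeries (a : Fin N ⊕ Fin N → ℂ) : MvPowerSeries (Fin N ⊕ Fin N) ℂ :=
  ∑ s, C (a s) * X s

theorem linearSeries_mem_orderIdeal (a : Fin N ⊕ Fin N → ℂ) :
    linearSeries a ∈ orderIdeal _ 1 :=
  Ideal.sum_mem _ fun _ _ => Ideal.mul_mem_left _ _ (mem_orderIdeal_one.2 (constantCoeff_X _))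

theorem pderiv_linearSeries (a : Fin N ⊕ Fin N → ℂ) (s : Fin N ⊕ Fin N) :
    pderiv ℂ s (linearSeries a) = C (a s) := by
  classical
  rw [linearSeries, map_sum, Finset.sum_eq_single s]
  · simp
  · intro u _ hu
    simp [pderiv_X_of_ne hu]
  · simp

theorem constantCoeff_applyField_linearSeries (Y : VField N) (a : Fin N ⊕ Fin N → ℂ) :
    constantCoeff (applyField (formalField Y) (linearSeries a)) = ∑ s, Y 0 s * a s := by
  rw [constantCoeff_applyField]
  simp_rw [pderiv_linearSeries, constantCoeff_formalField, constantCoeff_C]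

/-- Euler's identity ∑ x_i ∂_i F = (deg F) F for the leading words of `F`, with `p i` in the role of
∂_i F. Applying the innermost letter Y by the Leibniz rule, the terms with Y x_i add up to one copy
of the word on `F` because the x_i(Y(0)) are the coordinates of Y(0); the remaining terms are the
identity for Y F in one degree less. -/
theorem sum_wordValue_linearSeries_mul {ι : Type*} [Fintype ι] {E : ι → VField N}
    (hE : ∀ i, MemLieAlgebra M (E i)) (x : ι → Fin N ⊕ Fin N → ℂ)
    (hx : ∀ Y, MemLieAlgebra M Y → Y 0 = ∑ i, (∑ s, Y 0 s * x i s) • E i 0) (m : ℕ) :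
    ∀ (F : MvPowerSeries (Fin N ⊕ Fin N) ℂ) (p : ι → MvPowerSeries (Fin N ⊕ Fin N) ℂ),
      VanishesToOrder M (m + 1) F → (∀ i, p i ∈ orderIdeal _ m) →
      (∀ l, IsWord M l → l.length = m → ∀ i, wordValue l (p i) = wordValue (l ++ [E i]) F) →
      ∀ l, IsWord M l → l.length = m + 1 →
        ∑ i, wordValue l (linearSeries (x i) * p i) = (m + 1) * wordValue l F := by
  induction m with
  | zero =>
    intro F p hF hp hpF l hl hlen
    obtain ⟨Y, rfl⟩ := List.length_eq_one_iff.1 hlen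
    have hY := hl Y (by simp)
    rw [← List.nil_append [Y], hF.wordValue_sum (l := []) (by simp [IsWord]) le_rfl hE hY (hx Y hY)]
    simp only [Nat.cast_zero, zero_add, one_mul]
    refine Finset.sum_congr rfl fun i _ => ?_
    rw [wordValue_concat, applyField_mul, ← hpF [] (by simp [IsWord]) rfl, wordValue, applyWord,
      List.foldr_nil, map_add, map_mul, map_mul, constantCoeff_applyField_linearSeries,
      mem_orderIdeal_one.1 (linearSeries_mem_orderIdeal _), zero_mul, add_zero]
    rfl
  | succ m ih =>
    intro F p hF hp hpF l hl hlen
    rcases List.eq_nil_or_concat l with rfl | ⟨l, Y, rfl⟩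
    · simp at hlen
    rw [List.concat_eq_append] at *
    have hY := hl Y (by simp)
    have hl' : IsWord M l := fun Z hZ => hl Z (by simp [hZ])
    have hlen' : l.length = m + 1 := by simpa using hlen
    have h1 : ∀ i, wordValue (l ++ [Y]) (linearSeries (x i) * p i) =
        (∑ s, Y 0 s * x i s) * wordValue (l ++ [E i]) F +
          wordValue l (linearSeries (x i) * applyField (formalField Y) (p i)) := by
      intro i
      rw [wordValue_concat, applyField_mul, ← wordForm_apply, map_add, wordForm_apply,
        wordForm_apply, wordValue_mul_of_mem_orderIdeal (hlen' ▸ hp i),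
        constantCoeff_applyField_linearSeries, hpF l hl' hlen']
    simp_rw [h1]
    rw [Finset.sum_add_distrib, ← hF.wordValue_sum hl' (by omega) hE hY (hx Y hY),
      ih (applyField (formalField Y) F) (fun i => applyField (formalField Y) (p i))
        (hF.applyField hY) (fun i => applyField_mem_orderIdeal _ (hp i)) ?_ l hl' hlen',
      ← wordValue_concat]
    · push_cast; ring
    · intro l' hl' hlen' i
      rw [← wordValue_concat, hpF _ (hl'.append (isWord_singleton hY)) (by simp [hlen']),
        ← wordValue_concat]
      refine hF.wordValue_perm ?_ ((hl'.append (isWord_singleton hY)).append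
        (isWord_singleton (hE i))) (by simp [hlen'])
      rw [List.append_assoc, List.append_assoc]
      exact List.Perm.append_left _ (List.Perm.swap _ _ _)

/-- The values at the origin of the vector fields in `𝔤_M`. -/
def lieValues (M : Set (Fin N → ℂ)) : Submodule ℂ (Fin N ⊕ Fin N → ℂ) :=
  Submodule.span ℂ {v | ∃ X : VField N, MemLieAlgebra M X ∧ X 0 = v}

/-- The linear forms `x i` extend the dual basis from `lieValues M` to the whole space, through a
left inverse of the inclusion. -/
theorem exists_lieValues_basis (M : Set (Fin N → ℂ)) :
    ∃ (E : Fin (Module.finrank ℂ (lieValues M)) → VField N)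
      (x : Fin (Module.finrank ℂ (lieValues M)) → Fin N ⊕ Fin N → ℂ),
      (∀ i, MemLieAlgebra M (E i)) ∧ (LinearIndependent ℂ fun i => E i 0) ∧
      ∀ Y, MemLieAlgebra M Y → Y 0 = ∑ i, (∑ s, Y 0 s * x i s) • E i 0 := by
  obtain ⟨f, hf, hsp, hli⟩ : ∃ f : Fin (Module.finrank ℂ (lieValues M)) → Fin N ⊕ Fin N → ℂ,
      (∀ i, ∃ X : VField N, MemLieAlgebra M X ∧ X 0 = f i) ∧
      Submodule.span ℂ (Set.range f) = lieValues M ∧ LinearIndependent ℂ f :=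
    Submodule.exists_fun_fin_finrank_span_eq ℂ _
  choose E hE hE0 using hf
  have hli' : LinearIndependent ℂ fun i => E i 0 := by simpa only [hE0] using hli
  obtain ⟨φ, hφ⟩ := (Finsupp.linearCombination ℂ fun i => E i 0).exists_leftInverse_of_injective
    (LinearMap.ker_eq_bot.2 hli')
  refine ⟨E, fun i s => φ (Pi.single s 1) i, hE, hli', fun Y hY => ?_⟩
  have h1 : ∀ v : Fin N ⊕ Fin N → ℂ, ∀ i, ∑ s, v s * φ (Pi.single s 1) i = φ v i := by
    intro v i
    conv_rhs => rw [pi_eq_sum_univ' v, map_sum]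
    simp
  simp_rw [h1]
  have h2 : Y 0 ∈ Submodule.span ℂ (Set.range fun i => E i 0) := by
    simp only [hE0]
    rw [hsp]
    exact Submodule.subset_span ⟨Y, hY, rfl⟩
  obtain ⟨c, hc⟩ := (Finsupp.mem_span_range_iff_exists_finsupp).1 h2
  have h3 : φ (Y 0) = c := by
    rw [← hc]
    exact DFunLike.congr_fun hφ c
  rw [h3]
  conv_lhs => rw [← hc]
  rw [Finsupp.sum_fintype _ _ (by simp)]

/-- A power series vanishing to order `k` along `𝔤_M` has the same words of length `k` as some
power series of order `k`. -/
theorem VanishesToOrder.exists_mem_orderIdeal {k : ℕ} {F : MvPowerSeries (Fin N ⊕ Fin N) ℂ}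
    (hF : VanishesToOrder M k F) : ∃ p ∈ orderIdeal (Fin N ⊕ Fin N) k,
      ∀ l, IsWord M l → l.length = k → wordValue l p = wordValue l F := by
  induction k generalizing F with
  | zero => exact ⟨F, mem_orderIdeal_zero _, fun _ _ _ => rfl⟩
  | succ k ih =>
    obtain ⟨E, x, hE, -, hx⟩ := exists_lieValues_basis M
    choose p hp hpF using fun i => ih (hF.applyField (hE i))
    -- Reconstruction from first derivatives: Euler's identity divided by the degree `k + 1`.
    refine ⟨C ((k + 1 : ℂ)⁻¹) * ∑ i, linearSeries (x i) * p i, Ideal.mul_mem_left _ _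
      (Ideal.sum_mem _ fun i _ => ?_), fun l hl hlen => ?_⟩
    · rw [add_comm k]
      exact mul_mem_orderIdeal (linearSeries_mem_orderIdeal _) (hp i)
    · have := sum_wordValue_linearSeries_mul hE x hx k F p hF hp
        (fun l hl hlen i => by rw [hpF i l hl hlen, wordValue_concat]) l hl hlen
      rw [← smul_eq_C_mul, ← wordForm_apply, map_smul, map_sum]
      simp_rw [wordForm_apply]
      rw [this, smul_eq_mul, ← mul_assoc, inv_mul_cancel₀, one_mul]
      exact_mod_cast Nat.succ_ne_zero k

/-- Every linear form vanishing on the values of `𝔤_M` at the origin is the linear part of a power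
series in the ideal of the formal orbit. -/
theorem exists_mem_orbitIdeal (a : Fin N ⊕ Fin N → ℂ)
    (ha : ∀ v ∈ lieValues M, ∑ s, v s * a s = 0) :
    ∃ F ∈ orbitIdeal M, F - linearSeries a ∈ orderIdeal _ 2 := by
  -- Subtracting a series of order `k + 2` with the same words of that length makes `F` vanish one
  -- order further along 𝔤_M, without disturbing its lower-order terms.
  have hstep : ∀ (k : ℕ) (F : {F // VanishesToOrder M (k + 2) F}),
      ∃ G : {F // VanishesToOrder M (k + 3) F}, G.1 - F.1 ∈ orderIdeal (Fin N ⊕ Fin N) (k + 2) := by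
    rintro k ⟨F, hF⟩
    obtain ⟨p, hp, hpF⟩ := hF.exists_mem_orderIdeal
    refine ⟨⟨F - p, fun l hl hlen => ?_⟩, ?_⟩
    · rw [← wordForm_apply, map_sub, wordForm_apply, wordForm_apply, sub_eq_zero]
      rcases Nat.lt_succ_iff_lt_or_eq.1 hlen with h | h
      · rw [hF l hl h, wordValue_of_mem_orderIdeal h hp]
      · exact (hpF l hl h).symm
    · simpa using neg_mem hp
  choose S hS using hstep
  -- The hypothesis on `a` says precisely that words of length one annihilate the linear form.
  have h0 : VanishesToOrder M 2 (linearSeries a) := by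
    intro l hl hlen
    match l, hl, hlen with
    | [], _, _ => exact mem_orderIdeal_one.1 (linearSeries_mem_orderIdeal a)
    | [Y], hl, _ =>
      rw [← List.nil_append [Y], wordValue_concat]
      refine (constantCoeff_applyField_linearSeries Y a).trans (ha _ (Submodule.subset_span ?_))
      exact ⟨Y, hl Y (by simp), rfl⟩
    | _ :: _ :: _, _, h => simp at h
  let G : ∀ k : ℕ, {F // VanishesToOrder M (k + 2) F} := fun k =>
    Nat.rec ⟨linearSeries a, h0⟩ S k
  have hG : ∀ k, (G (k + 1)).1 - (G k).1 ∈ orderIdeal (Fin N ⊕ Fin N) (k + 2) :=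
    fun k => hS k (G k)
  have hG' : ∀ k m, (G (k + m)).1 - (G k).1 ∈ orderIdeal (Fin N ⊕ Fin N) (k + 2) := by
    intro k m
    induction m with
    | zero => simp
    | succ m ih =>
      have := add_mem (orderIdeal_anti (by omega) (hG (k + m))) ih
      rwa [sub_add_sub_cancel] at this
  -- The corrections have increasing order, so each coefficient stabilizes and the limit is taken
  -- diagonally.
  let F : MvPowerSeries (Fin N ⊕ Fin N) ℂ := fun e => coeff e (G e.degree).1
  have hF : ∀ k, F - (G k).1 ∈ orderIdeal (Fin N ⊕ Fin N) (k + 2) := by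
    intro k e he
    have h1 : coeff e F = coeff e (G e.degree).1 := rfl
    rw [map_sub, h1]
    rcases le_total k e.degree with h | h
    · obtain ⟨m, hm⟩ := Nat.exists_eq_add_of_le h
      have := hG' k m e he
      rw [map_sub] at this
      rw [hm]
      exact this
    · obtain ⟨m, hm⟩ := Nat.exists_eq_add_of_le h
      have := hG' e.degree m e (by omega)
      rw [map_sub, ← hm] at this
      rw [← neg_sub, this, neg_zero]
  refine ⟨F, fun l hl => ?_, hF 0⟩
  have h1 : F = (G l.length).1 + (F - (G l.length).1) := by ring
  change wordForm l F = 0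
  rw [h1, map_add, wordForm_apply, wordForm_apply, (G l.length).2 l hl (by omega),
    wordValue_of_mem_orderIdeal (by omega) (hF l.length), add_zero]

end Nagano

/-! ### Dimension counts for the two projections. -/

section LinearAlgebra

variable {K : Type*} [Field K] {N n d : ℕ}

theorem finrank_map_add_finrank_inf_ker {W W' : Type*} [AddCommGroup W] [Module K W]
    [FiniteDimensional K W] [AddCommGroup W'] [Module K W'] (V : Submodule K W) (P : W →ₗ[K] W') :
    Module.finrank K (V.map P) + Module.finrank K (V ⊓ LinearMap.ker P : Submodule K W) =
      Module.finrank K V := by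
  have h := LinearMap.finrank_range_add_finrank_ker (P.domRestrict V)
  rw [LinearMap.range_domRestrict] at h
  rw [← h, add_right_inj]
  refine (LinearEquiv.finrank_eq ?_).trans rfl
  have e : (LinearMap.ker (P.domRestrict V)).map V.subtype = V ⊓ LinearMap.ker P := by
    ext v
    simp only [Submodule.mem_map, LinearMap.mem_ker, Submodule.mem_inf]
    constructor
    · rintro ⟨⟨w, hw⟩, h1, rfl⟩
      exact ⟨hw, h1⟩
    · rintro ⟨h1, h2⟩
      exact ⟨⟨v, h1⟩, h2, rfl⟩
  exact (LinearEquiv.ofEq _ _ e.symm).trans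
    (Submodule.equivMapOfInjective _ V.injective_subtype _).symm

/-- The vectors annihilated by `D` whose components in one half of the coordinates vanish. -/
theorem finrank_ker_inf_ker_le (hN : n + d = N) (D : Matrix (Fin d) (Fin N ⊕ Fin N) K)
    (f f' : Fin N → Fin N ⊕ Fin N)
    (hf : ∀ F : Fin N ⊕ Fin N → K, ∑ s, F s = ∑ k, F (f k) + ∑ k, F (f' k))
    (hc : ∀ s, (∃ k, f k = s) ∨ ∃ k, f' k = s) (hD : (D.submatrix id f).rank = d) :
    Module.finrank K (LinearMap.ker D.mulVecLin ⊓ LinearMap.ker (LinearMap.funLeft K K f') :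
      Submodule K _) ≤ n := by
  rw [← finrank_map_add_finrank_inf_ker _ (LinearMap.funLeft K K f)]
  have h1 : LinearMap.ker D.mulVecLin ⊓ LinearMap.ker (LinearMap.funLeft K K f') ⊓
      LinearMap.ker (LinearMap.funLeft K K f) = ⊥ := by
    rw [eq_bot_iff]
    rintro v ⟨⟨-, h2⟩, h3⟩
    refine funext fun s => ?_
    rcases hc s with ⟨k, rfl⟩ | ⟨k, rfl⟩
    · exact congrFun h3 k
    · exact congrFun h2 k
  have h2 : (LinearMap.ker D.mulVecLin ⊓ LinearMap.ker (LinearMap.funLeft K K f')).map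
      (LinearMap.funLeft K K f) ≤ LinearMap.ker (D.submatrix id f).mulVecLin := by
    rintro _ ⟨v, ⟨hv, hv'⟩, rfl⟩
    refine funext fun j => ?_
    have h3 := congrFun hv j
    have h4 : ∀ k, v (f' k) = 0 := congrFun hv'
    rw [Matrix.mulVecLin_apply, Matrix.mulVec, dotProduct, hf] at h3
    simp only [h4, mul_zero, Finset.sum_const_zero, add_zero] at h3
    exact h3
  have h3 := LinearMap.finrank_range_add_finrank_ker (D.submatrix id f).mulVecLin
  rw [Module.finrank_fin_fun] at h3
  change (D.submatrix id f).rank + _ = N at h3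
  rw [h1, finrank_bot, add_zero]
  have := Submodule.finrank_mono h2
  omega

variable {κ : Type*} [Fintype κ]

theorem map_funLeft_range_mulVecLin {ι ι' : Type*} (A : Matrix ι κ K) (f : ι' → ι) :
    (LinearMap.range A.mulVecLin).map (LinearMap.funLeft K K f) =
      LinearMap.range (A.submatrix f id).mulVecLin := by
  rw [← LinearMap.range_comp]
  rfl

theorem range_mulVecLin_le_ker (A : Matrix (Fin N ⊕ Fin N) κ K)
    (D : Matrix (Fin d) (Fin N ⊕ Fin N) K) (hDA : D * A = 0) :
    LinearMap.range A.mulVecLin ≤ LinearMap.ker D.mulVecLin := by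
  rintro _ ⟨v, rfl⟩
  rw [LinearMap.mem_ker, Matrix.mulVecLin_apply, Matrix.mulVecLin_apply, Matrix.mulVec_mulVec, hDA,
    Matrix.zero_mulVec]

/-- Rank-nullity for the projection of the range of `A` to the second half. Its kernel consists of
vectors annihilated by `D` with zero second half, a space of dimension at most `N - d = n`, and the
columns selected by `g` already have that rank. -/
theorem rank_eq_add_rank_submatrix_inr (hN : n + d = N) (A : Matrix (Fin N ⊕ Fin N) κ K)
    (D : Matrix (Fin d) (Fin N ⊕ Fin N) K) (hDA : D * A = 0)
    (hD : (D.submatrix id Sum.inl).rank = d) (g : Fin n → κ) (hg0 : ∀ i l, A (Sum.inr l) (g i) = 0)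
    (hg : n ≤ (A.submatrix Sum.inl g).rank) :
    A.rank = n + (A.submatrix Sum.inr id).rank := by
  have h1 := finrank_map_add_finrank_inf_ker (LinearMap.range A.mulVecLin)
    (LinearMap.funLeft K K (Sum.inr : Fin N → Fin N ⊕ Fin N))
  rw [map_funLeft_range_mulVecLin] at h1
  change (A.submatrix Sum.inr id).rank + _ = A.rank at h1
  rw [← h1, add_comm, add_left_inj]
  apply le_antisymm
  · refine (Submodule.finrank_mono (inf_le_inf_right _ (range_mulVecLin_le_ker A D hDA))).trans ?_
    refine finrank_ker_inf_ker_le hN D Sum.inl Sum.inr Fintype.sum_sum_type ?_ hD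
    rintro (k | k) <;> simp
  · have h2 : LinearMap.range (A.submatrix id g).mulVecLin ≤ LinearMap.range A.mulVecLin ⊓
        LinearMap.ker (LinearMap.funLeft K K (Sum.inr : Fin N → Fin N ⊕ Fin N)) := by
      classical
      rw [Matrix.range_mulVecLin, Submodule.span_le]
      rintro _ ⟨i, rfl⟩
      refine ⟨⟨Pi.single (g i) 1, ?_⟩, ?_⟩
      · rw [Matrix.mulVecLin_apply, Matrix.mulVec_single_one]
        rfl
      · refine funext fun l => hg0 i l
    have h3 := Submodule.finrank_mono h2
    have h4 : (A.submatrix Sum.inl g).rank ≤ (A.submatrix id g).rank := by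
      have := fracRank_submatrix_le (A.submatrix id g) Sum.inl id
      rwa [fracRank_field, fracRank_field] at this
    exact (hg.trans h4).trans h3

/-- By `hA` the kernel of the projection on the range of `A` has the largest possible dimension `n`,
so it contains every vector that `D` and the projection annihilate. The halves are given by abstract
`f`, `f'` so that they can be exchanged. -/
theorem mem_range_of_rank_submatrix_eq (hN : n + d = N) (A : Matrix (Fin N ⊕ Fin N) κ K)
    (D : Matrix (Fin d) (Fin N ⊕ Fin N) K) (hDA : D * A = 0) (f f' : Fin N → Fin N ⊕ Fin N)
    (hf : ∀ F : Fin N ⊕ Fin N → K, ∑ s, F s = ∑ k, F (f k) + ∑ k, F (f' k))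
    (hc : ∀ s, (∃ k, f k = s) ∨ ∃ k, f' k = s) (hD : (D.submatrix id f).rank = d)
    (hA : n + (A.submatrix f' id).rank ≤ A.rank)
    {v : Fin N ⊕ Fin N → K} (hv : ∀ k, v (f' k) = 0) (hDv : D.mulVec v = 0) :
    v ∈ LinearMap.range A.mulVecLin := by
  have h1 := finrank_map_add_finrank_inf_ker (LinearMap.range A.mulVecLin)
    (LinearMap.funLeft K K f')
  rw [map_funLeft_range_mulVecLin] at h1
  change (A.submatrix f' id).rank + _ = A.rank at h1
  have h2 := finrank_ker_inf_ker_le hN D f f' hf hc hD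
  have h3 := Submodule.eq_of_le_of_finrank_le
    (inf_le_inf_right (LinearMap.ker (LinearMap.funLeft K K f'))
      (range_mulVecLin_le_ker A D hDA)) (by omega)
  have h4 : v ∈ LinearMap.ker D.mulVecLin ⊓ LinearMap.ker (LinearMap.funLeft K K f') :=
    ⟨hDv, funext hv⟩
  rw [← h3] at h4
  exact h4.1

theorem rank_add_rank_le_of_mul_eq_zero {ι ι' : Type*} [Fintype ι] [Fintype ι']
    (B : Matrix ι' ι K) (A : Matrix ι κ K) (h : B * A = 0) :
    A.rank + B.rank ≤ Fintype.card ι := by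
  have h1 := LinearMap.finrank_range_add_finrank_ker B.mulVecLin
  rw [Module.finrank_fintype_fun_eq_card] at h1
  change B.rank + _ = _ at h1
  have h2 : LinearMap.range A.mulVecLin ≤ LinearMap.ker B.mulVecLin := by
    rintro _ ⟨v, rfl⟩
    rw [LinearMap.mem_ker, Matrix.mulVecLin_apply, Matrix.mulVecLin_apply, Matrix.mulVec_mulVec, h,
      Matrix.zero_mulVec]
  have h3 : A.rank ≤ _ := Submodule.finrank_mono h2
  omega

theorem fracRank_add_fracRank_le {R : Type*} [CommRing R] [IsDomain R] {ι ι' : Type*} [Fintype ι]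
    [Fintype ι'] (B : Matrix ι' ι R) (A : Matrix ι κ R) (h : B * A = 0) :
    fracRank A + fracRank B ≤ Fintype.card ι :=
  rank_add_rank_le_of_mul_eq_zero (B.map (algebraMap R (FractionRing R)))
    (A.map (algebraMap R (FractionRing R))) (by rw [← Matrix.map_mul, h]; simp)

end LinearAlgebra

/-! ### Rank of the Segre points and the upper bound by the orbit dimension. -/

section SegreRank

variable {N n d : ℕ} {M : Set (Fin N → ℂ)} {r : Fin d → (Fin N → ℂ) → ℝ}
  {γ : Fin N → MvPowerSeries (Fin N ⊕ Fin n) ℂ}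

/-- The differentials of the defining functions along a formal mapping. -/
noncomputable def formalDiffMatrix {κ : Type*} (r : Fin d → (Fin N → ℂ) → ℝ)
    (Ξ : Fin N ⊕ Fin N → MvPowerSeries κ ℂ) : Matrix (Fin d) (Fin N ⊕ Fin N) (MvPowerSeries κ ℂ) :=
  Matrix.of fun j s => subst Ξ (pderiv ℂ s (taylorSeries fun Z => (r j Z : ℂ)))

theorem IsDefiningFunction.map_constantCoeff_formalDiffMatrix (hr : IsDefiningFunction M r)
    {κ : Type*} {Ξ : Fin N ⊕ Fin N → MvPowerSeries κ ℂ} (hΞ : ∀ s, constantCoeff (Ξ s) = 0) :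
    (formalDiffMatrix r Ξ).map constantCoeff = diffMatrix r 0 := by
  ext j s
  rw [Matrix.map_apply, formalDiffMatrix, Matrix.of_apply, constantCoeff_subst' hΞ,
    pderiv_taylorSeries (hr.smoothNear_ofReal j), constantCoeff_taylorSeries]
  rfl

theorem fracRank_eq_of_le {κ : Type*} [Fintype κ] {σ : Type*} [Fintype σ]
    (A : Matrix (Fin d) κ (MvPowerSeries σ ℂ)) (h : (A.map constantCoeff).rank = d) :
    fracRank A = d := by
  refine le_antisymm ?_ (h.symm.le.trans (rank_constantCoeff_le_fracRank A))
  rw [fracRank]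
  simpa using Matrix.rank_le_card_height (A.map (algebraMap _ (FractionRing (MvPowerSeries σ ℂ))))

theorem formalDiffMatrix_mul_jacobian {κ : Type*} [Fintype κ]
    {Ξ : Fin N ⊕ Fin N → MvPowerSeries κ ℂ} (hΞ : ∀ s, constantCoeff (Ξ s) = 0)
    (h : ∀ j, subst Ξ (taylorSeries fun Z => (r j Z : ℂ)) = 0) :
    formalDiffMatrix r Ξ * jacobian Ξ = 0 := by
  ext1 j s
  have := pderiv_subst hΞ s (taylorSeries fun Z => (r j Z : ℂ))
  rw [h, map_zero] at this
  rw [Matrix.mul_apply, Matrix.zero_apply, this]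
  rfl

theorem IsSegreVarietyMapping.subst_segrePoint_eq_zero (hγ : IsSegreVarietyMapping r γ) (i : ℕ)
    (j : Fin d) : subst (segrePoint γ i) (taylorSeries fun Z => (r j Z : ℂ)) = 0 := by
  rw [subst_segrePoint hγ.constantCoeff, hγ.subst_eq_zero, subst_zero_series
    (constantCoeff_elim (constantCoeff_segreBase hγ.constantCoeff _) (by simp))]

theorem fracRank_jacobian_segreBase (γ : Fin N → MvPowerSeries (Fin N ⊕ Fin n) ℂ) (j : ℕ) :
    fracRank (jacobian (segreBase γ j)) = genericRank (iteratedSegre γ j) := by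
  rw [← fracRank_jacobian_conj_lift]
  have h1 : (jacobian (iteratedSegre γ j)).map (fun f => liftSeries (conjSeries f)) =
      (jacobian (segreBase γ j)).submatrix id fun s : Fin j × Fin n => (s.1.castSucc, s.2) := by
    ext1 k s
    simp only [jacobian, Matrix.map_apply, Matrix.submatrix_apply, Matrix.of_apply, segreBase, id]
    rw [pderiv_liftSeries_castSucc, pderiv_conjSeries]
  rw [h1]
  refine le_antisymm ?_ (fracRank_submatrix_le _ _ _)
  have h2 : jacobian (segreBase γ j) = ((jacobian (segreBase γ j)).submatrix id
      fun s : Fin j × Fin n => (s.1.castSucc, s.2)) * (Matrix.of fun (s : Fin j × Fin n) u =>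
        if u = (s.1.castSucc, s.2) then 1 else 0 :
          Matrix (Fin j × Fin n) (Fin (j + 1) × Fin n) (MvPowerSeries (Fin (j + 1) × Fin n) ℂ)) := by
    ext1 k u
    rw [Matrix.mul_apply]
    obtain ⟨a, i⟩ := u
    induction a using Fin.lastCases with
    | last =>
      rw [Finset.sum_eq_zero]
      · exact pderiv_liftSeries_last i _
      · intro s _
        simp [(Fin.castSucc_lt_last s.1).ne']
    | cast a =>
      rw [Finset.sum_eq_single (a, i)]
      · simp
      · intro s _ hs
        have : ¬ ((a.castSucc, i) = (s.1.castSucc, s.2)) := by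
          intro h
          rw [Prod.mk.injEq, Fin.castSucc_inj] at h
          exact hs (Prod.ext h.1.symm h.2.symm)
        simp [this]
      · simp
  conv_lhs => rw [h2]
  exact fracRank_mul_le_left _ _

theorem IsSegreVarietyMapping.fracRank_jacobian_segrePoint (hγ : IsSegreVarietyMapping r γ)
    (hN : n + d = N) (hr : IsDefiningFunction M r) (hM : IsGenericSubmanifold M d) (j : ℕ) :
    fracRank (jacobian (segrePoint γ j)) = n + genericRank (iteratedSegre γ j) := by
  have h0 := constantCoeff_segrePoint hγ.constantCoeff j
  rw [← fracRank_jacobian_segreBase]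
  refine rank_eq_add_rank_submatrix_inr hN _ ((formalDiffMatrix r (segrePoint γ j)).map
    (algebraMap _ (FractionRing (MvPowerSeries (Fin (j + 1) × Fin n) ℂ)))) ?_ ?_
    (fun i => (Fin.last j, i)) ?_ ?_
  · rw [← Matrix.map_mul, formalDiffMatrix_mul_jacobian h0 (hγ.subst_segrePoint_eq_zero j)]
    simp
  · refine fracRank_eq_of_le ((formalDiffMatrix r (segrePoint γ j)).submatrix id Sum.inl) ?_
    rw [← Matrix.submatrix_map, hr.map_constantCoeff_formalDiffMatrix h0,
      hr.rank_diffMatrix_inl hM]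
  · intro i l
    have : jacobian (segrePoint γ j) (Sum.inr l) (Fin.last j, i) = 0 := pderiv_liftSeries_last i _
    rw [Matrix.map_apply, this, map_zero]
  · refine le_trans ?_ (rank_constantCoeff_le_fracRank
      ((jacobian (iteratedSegre γ (j + 1))).submatrix id fun i : Fin n => (Fin.last j, i)))
    rw [← Matrix.submatrix_map, map_constantCoeff_jacobian_iteratedSegre hγ.constantCoeff,
      hγ.rank_eq]

/-- Differentiating F_i(Ξ) = 0 shows that the gradients of the F_i along Ξ annihilate the Jacobian
of Ξ. They are independent over the field of fractions because their values `a i` at the origin are.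
-/
theorem fracRank_jacobian_add_le {κ : Type} [Fintype κ] {m : ℕ}
    {Ξ : Fin N ⊕ Fin N → MvPowerSeries κ ℂ} (hΞ : ∀ s, constantCoeff (Ξ s) = 0)
    {F : Fin m → MvPowerSeries (Fin N ⊕ Fin N) ℂ} {a : Fin m → Fin N ⊕ Fin N → ℂ}
    (hFa : ∀ i, F i - linearSeries (a i) ∈ orderIdeal _ 2) (ha : LinearIndependent ℂ a)
    (hF : ∀ i, subst Ξ (F i) = 0) : fracRank (jacobian Ξ) + m ≤ 2 * N := by
  set B : Matrix (Fin m) (Fin N ⊕ Fin N) (MvPowerSeries κ ℂ) :=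
    Matrix.of fun i s => subst Ξ (pderiv ℂ s (F i)) with hB
  have hBa : B.map constantCoeff = Matrix.of a := by
    ext i s
    rw [Matrix.map_apply, hB, Matrix.of_apply, Matrix.of_apply, constantCoeff_subst' hΞ]
    have := mem_orderIdeal_one.1 (pderiv_mem_orderIdeal s (hFa i))
    rwa [map_sub, map_sub, pderiv_linearSeries, constantCoeff_C, sub_eq_zero] at this
  have hBr : fracRank B = m := by
    refine fracRank_eq_of_le B ?_
    rw [hBa]
    simpa using LinearIndependent.rank_matrix (M := Matrix.of a) ha
  have hBA : B * jacobian Ξ = 0 := by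
    ext1 i s
    have := pderiv_subst hΞ s (F i)
    rw [hF, map_zero] at this
    rw [Matrix.mul_apply, Matrix.zero_apply, this]
    rfl
  have h3 := fracRank_add_fracRank_le _ _ hBA
  rw [hBr, Fintype.card_sum, Fintype.card_fin] at h3
  omega

/-- The `a i` are a basis of the annihilator of `lieValues M`, and the formal Nagano theorem lifts
each of them to the orbit ideal. -/
theorem exists_linearIndependent_orbitIdeal (M : Set (Fin N → ℂ)) :
    ∃ (m : ℕ) (a : Fin m → Fin N ⊕ Fin N → ℂ) (F : Fin m → MvPowerSeries (Fin N ⊕ Fin N) ℂ),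
      m + Module.finrank ℂ (lieValues M) = 2 * N ∧ LinearIndependent ℂ a ∧
      ∀ i, F i ∈ orbitIdeal M ∧ F i - linearSeries (a i) ∈ orderIdeal _ 2 := by
  obtain ⟨E, x, hE, hli, hx⟩ := exists_lieValues_basis M
  obtain ⟨G, hG⟩ : ∃ G : Matrix (Fin (Module.finrank ℂ (lieValues M))) (Fin N ⊕ Fin N) ℂ,
    ∀ i s, G i s = E i 0 s := ⟨fun i s => E i 0 s, fun _ _ => rfl⟩
  have hGr : G.rank = Module.finrank ℂ (lieValues M) := by
    have e : G.row = fun i => E i 0 := funext fun i => funext fun s => hG i s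
    have := LinearIndependent.rank_matrix (M := G) (by rw [e]; exact hli)
    rwa [Fintype.card_fin] at this
  obtain ⟨m, hm⟩ : ∃ m, m = Module.finrank ℂ (LinearMap.ker G.mulVecLin) := ⟨_, rfl⟩
  have hker : m + Module.finrank ℂ (lieValues M) = 2 * N := by
    have := LinearMap.finrank_range_add_finrank_ker G.mulVecLin
    rw [Module.finrank_fintype_fun_eq_card, ← hm] at this
    change G.rank + _ = _ at this
    rw [hGr, Fintype.card_sum, Fintype.card_fin] at this
    omega
  obtain ⟨bas⟩ : Nonempty (Module.Basis (Fin m) ℂ (LinearMap.ker G.mulVecLin)) :=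
    ⟨(Module.finBasisOfFinrankEq _ _ hm.symm)⟩
  have hbas : ∀ i, ∃ F ∈ orbitIdeal M, F - linearSeries (bas i).1 ∈ orderIdeal _ 2 := by
    intro i
    refine exists_mem_orbitIdeal _ fun v hv => ?_
    have h1 : ∀ l, ∑ s, E l 0 s * (bas i).1 s = 0 := fun l => by
      simp_rw [← hG]
      have h2 : G.mulVec (bas i).1 = 0 := (bas i).2
      exact congrFun h2 l
    induction hv using Submodule.span_induction with
    | mem v hv =>
      obtain ⟨Y, hY, rfl⟩ := hv
      obtain ⟨c, hc⟩ : ∃ c : _ → ℂ, Y 0 = ∑ i, c i • E i 0 := ⟨_, hx Y hY⟩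
      rw [hc]
      simp only [Finset.sum_apply, Pi.smul_apply, smul_eq_mul, Finset.sum_mul]
      rw [Finset.sum_comm]
      refine Finset.sum_eq_zero fun l _ => ?_
      simp_rw [mul_assoc]
      rw [← Finset.mul_sum, h1, mul_zero]
    | zero => simp
    | add v w _ _ hv hw =>
      simp only [Pi.add_apply, add_mul, Finset.sum_add_distrib, hv, hw, add_zero]
    | smul c v _ hv =>
      simp only [Pi.smul_apply, smul_eq_mul, mul_assoc, ← Finset.mul_sum, hv, mul_zero]
  choose F hF hFl using hbas
  exact ⟨m, fun i => (bas i).1, F, hker,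
    bas.linearIndependent.map' (Submodule.subtype _) (Submodule.ker_subtype _),
    fun i => ⟨hF i, hFl i⟩⟩

/-- The ranks of the iterated Segre mappings are bounded by the dimension of the formal orbit. -/
theorem IsSegreVarietyMapping.add_genericRank_le (hγ : IsSegreVarietyMapping r γ)
    (hN : n + d = N) (hr : IsDefiningFunction M r) (hM : IsGenericSubmanifold M d) (j : ℕ) :
    n + genericRank (iteratedSegre γ j) ≤ Module.finrank ℂ (lieValues M) := by
  rw [← hγ.fracRank_jacobian_segrePoint hN hr hM]
  obtain ⟨m, a, F, hm, ha, hF⟩ := exists_linearIndependent_orbitIdeal M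
  have := fracRank_jacobian_add_le (constantCoeff_segrePoint hγ.constantCoeff j)
    (fun i => (hF i).2) ha fun i => hγ.subst_segrePoint_orbitIdeal hN hr hM j _ (hF i).1
  omega

end SegreRank

/-! ### Clearing denominators. -/

section Domain

variable {R : Type*} [CommRing R] [IsDomain R] {N n d : ℕ} {κ : Type*} [Fintype κ]

theorem exists_mul_eq_of_mem_range {ι : Type*} (A : Matrix ι κ R) {v : ι → R}
    (hv : (fun s => algebraMap R (FractionRing R) (v s)) ∈
      LinearMap.range (A.map (algebraMap R (FractionRing R))).mulVecLin) :
    ∃ (Δ : R) (a : κ → R), Δ ≠ 0 ∧ ∀ u, Δ * v u = ∑ s, a s * A u s := by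
  obtain ⟨c, hc⟩ := hv
  obtain ⟨Δ, hΔ⟩ := IsLocalization.exist_integer_multiples_of_finite (nonZeroDivisors R) c
  choose a ha using hΔ
  refine ⟨Δ, a, nonZeroDivisors.ne_zero Δ.2, fun u => ?_⟩
  apply IsFractionRing.injective R (FractionRing R)
  have h1 := congrFun hc u
  rw [Matrix.mulVecLin_apply, Matrix.mulVec, dotProduct] at h1
  rw [map_mul, ← h1, map_sum, Finset.mul_sum]
  refine Finset.sum_congr rfl fun s _ => ?_
  rw [map_mul, ha, Matrix.map_apply, Algebra.smul_def]
  ring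

theorem exists_mul_eq_of_fracRank (hN : n + d = N) (A : Matrix (Fin N ⊕ Fin N) κ R)
    (D : Matrix (Fin d) (Fin N ⊕ Fin N) R) (hDA : D * A = 0) (f f' : Fin N → Fin N ⊕ Fin N)
    (hf : ∀ F : Fin N ⊕ Fin N → FractionRing R, ∑ s, F s = ∑ k, F (f k) + ∑ k, F (f' k))
    (hc : ∀ s, (∃ k, f k = s) ∨ ∃ k, f' k = s) (hD : fracRank (D.submatrix id f) = d)
    (hA : n + fracRank (A.submatrix f' id) ≤ fracRank A)
    {v : Fin N ⊕ Fin N → R} (hv : ∀ k, v (f' k) = 0) (hDv : ∀ j, ∑ s, D j s * v s = 0) :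
    ∃ (Δ : R) (a : κ → R), Δ ≠ 0 ∧ ∀ u, Δ * v u = ∑ s, a s * A u s := by
  refine exists_mul_eq_of_mem_range A (mem_range_of_rank_submatrix_eq hN _
    (D.map (algebraMap R (FractionRing R))) ?_ f f' hf hc ?_ ?_ ?_ ?_)
  · rw [← Matrix.map_mul, hDA]
    simp
  · rw [Matrix.submatrix_map]
    exact hD
  · rw [Matrix.submatrix_map]
    exact hA
  · intro k
    rw [hv, map_zero]
  · funext j
    have := congrArg (algebraMap R (FractionRing R)) (hDv j)
    rw [map_sum, map_zero] at this
    rw [Matrix.mulVec, dotProduct, Pi.zero_apply, ← this]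
    exact Finset.sum_congr rfl fun s _ => by rw [map_mul, Matrix.map_apply]

end Domain

/-! ### Fields tangent to the image of a formal mapping. -/

section Related

variable {N n d : ℕ} {M : Set (Fin N → ℂ)} {r : Fin d → (Fin N → ℂ) → ℝ}
  {γ : Fin N → MvPowerSeries (Fin N ⊕ Fin n) ℂ} {κ : Type} [Fintype κ]
  {Ξ : Fin N ⊕ Fin N → MvPowerSeries κ ℂ}

/-- Along `Ξ`, the vector field `Y` is tangent to the image of `Ξ`: up to a factor it is the image
of a vector field in the parameter space. -/
def IsRelated (Ξ : Fin N ⊕ Fin N → MvPowerSeries κ ℂ) (Y : VField N) : Prop :=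
  ∃ (Δ : MvPowerSeries κ ℂ) (a : κ → MvPowerSeries κ ℂ), Δ ≠ 0 ∧
    ∀ u, Δ * subst Ξ (formalField Y u) = applyField a (Ξ u)

theorem applyField_subst {Δ : MvPowerSeries κ ℂ} {a : κ → MvPowerSeries κ ℂ} {Y : VField N}
    (hΞ : ∀ s, constantCoeff (Ξ s) = 0)
    (h : ∀ u, Δ * subst Ξ (formalField Y u) = applyField a (Ξ u))
    (f : MvPowerSeries (Fin N ⊕ Fin N) ℂ) :
    applyField a (subst Ξ f) = Δ * subst Ξ (applyField (formalField Y) f) := by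
  have hs := hasSubst_of_constantCoeff_zero hΞ
  rw [applyField, applyField, subst_sum hΞ, Finset.mul_sum]
  simp_rw [pderiv_subst hΞ, subst_mul hs, ← mul_assoc, h, applyField, Finset.mul_sum,
    Finset.sum_mul]
  rw [Finset.sum_comm]
  exact Finset.sum_congr rfl fun u _ => Finset.sum_congr rfl fun s _ => by ring

theorem applyField_comb (b b' : MvPowerSeries κ ℂ) (a a' : κ → MvPowerSeries κ ℂ)
    (f : MvPowerSeries κ ℂ) : applyField (fun s => b * a s + b' * a' s) f =
      b * applyField a f + b' * applyField a' f := by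
  simp only [applyField, add_mul, Finset.sum_add_distrib, Finset.mul_sum, mul_assoc]

theorem IsRelated.add (hΞ : ∀ s, constantCoeff (Ξ s) = 0) {X Y : VField N} (hX : IsRelated Ξ X)
    (hY : IsRelated Ξ Y) (hXs : SmoothNear X 0) (hYs : SmoothNear Y 0) : IsRelated Ξ (X + Y) := by
  obtain ⟨Δ, a, hΔ, h⟩ := hX
  obtain ⟨Δ', a', hΔ', h'⟩ := hY
  refine ⟨Δ * Δ', fun s => Δ' * a s + Δ * a' s, mul_ne_zero hΔ hΔ', fun u => ?_⟩
  have e : formalField (X + Y) u = formalField X u + formalField Y u :=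
    taylorSeries_add (smoothNear_pi.1 hXs u) (smoothNear_pi.1 hYs u)
  rw [applyField_comb, ← h, ← h', e, subst_add (hasSubst_of_constantCoeff_zero hΞ)]
  ring

theorem IsRelated.smul (hΞ : ∀ s, constantCoeff (Ξ s) = 0) {X : VField N} (hX : IsRelated Ξ X)
    (c : ℂ) (hXs : SmoothNear X 0) : IsRelated Ξ (c • X) := by
  obtain ⟨Δ, a, hΔ, h⟩ := hX
  refine ⟨Δ, fun s => C c * a s + 0 * a s, hΔ, fun u => ?_⟩
  have e : formalField (c • X) u = C c * formalField X u :=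
    (taylorSeries_const_mul c (smoothNear_pi.1 hXs u)).trans (smul_eq_C_mul _ _)
  rw [applyField_comb, ← h, e, subst_mul (hasSubst_of_constantCoeff_zero hΞ), subst_C]
  ring

theorem IsRelated.bracket (hΞ : ∀ s, constantCoeff (Ξ s) = 0) {X Y : VField N}
    (hX : IsRelated Ξ X) (hY : IsRelated Ξ Y) (hXs : SmoothNear X 0) (hYs : SmoothNear Y 0) :
    IsRelated Ξ (bracket X Y) := by
  obtain ⟨Δ, a, hΔ, h⟩ := hX
  obtain ⟨Δ', a', hΔ', h'⟩ := hY
  -- On the components of Ξ, the bracket of `a` and `a'` gives ΔΔ'[X, Y] plus the terms a(Δ') Y -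
  -- a'(Δ) X, where derivatives hit the factors. A further multiplication by ΔΔ' turns these into
  -- multiples of `a'` and `a`, which the last two summands remove.
  refine ⟨Δ * Δ' * (Δ * Δ'), fun s => Δ * Δ' * (applyField a (a' s) - applyField a' (a s)) +
    1 * ((Δ' * applyField a' Δ) * a s + (- (Δ * applyField a Δ')) * a' s),
    mul_ne_zero (mul_ne_zero hΔ hΔ') (mul_ne_zero hΔ hΔ'), fun u => ?_⟩
  rw [applyField_comb, applyField_comb, applyField_bracket, ← h u, ← h' u, applyField_mul,
    applyField_mul, applyField_subst hΞ h, applyField_subst hΞ h', formalField_bracket hXs hYs,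
    subst_sub (hasSubst_of_constantCoeff_zero hΞ)]
  ring

theorem mem_range_of_isRelated {Y : VField N} (h : IsRelated Ξ Y) :
    (fun s => algebraMap _ (FractionRing (MvPowerSeries κ ℂ)) (subst Ξ (formalField Y s))) ∈
      LinearMap.range ((jacobian Ξ).map
        (algebraMap _ (FractionRing (MvPowerSeries κ ℂ)))).mulVecLin := by
  obtain ⟨Δ, a, hΔ, h⟩ := h
  have hΔ' : algebraMap _ (FractionRing (MvPowerSeries κ ℂ)) Δ ≠ 0 :=
    (map_ne_zero_iff _ (IsFractionRing.injective _ _)).2 hΔ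
  refine ⟨fun s => (algebraMap _ (FractionRing (MvPowerSeries κ ℂ)) Δ)⁻¹ * algebraMap _ _ (a s),
    funext fun u => ?_⟩
  rw [Matrix.mulVecLin_apply, Matrix.mulVec, dotProduct, ← mul_right_inj' hΔ', ← map_mul, h,
    applyField, map_sum, Finset.mul_sum]
  refine Finset.sum_congr rfl fun s _ => ?_
  rw [Matrix.map_apply, map_mul, jacobian, Matrix.of_apply]
  field_simp

/-- If all fields in `𝔤_M` are tangent to the image of `Ξ`, the rank of `Ξ` is at least the
dimension of the space of their values at the origin. -/
theorem finrank_lieValues_le (hΞ : ∀ s, constantCoeff (Ξ s) = 0)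
    (h : ∀ Y, MemLieAlgebra M Y → IsRelated Ξ Y) :
    Module.finrank ℂ (lieValues M) ≤ fracRank (jacobian Ξ) := by
  obtain ⟨E, x, hE, hli, -⟩ := exists_lieValues_basis M
  set B : Matrix (Fin (Module.finrank ℂ (lieValues M))) (Fin N ⊕ Fin N) (MvPowerSeries κ ℂ) :=
    Matrix.of fun i s => subst Ξ (formalField (E i) s) with hB
  -- Fields independent at the origin stay independent along Ξ over the field of fractions, since Ξ
  -- has no constant term.
  have h1 : fracRank B = Module.finrank ℂ (lieValues M) := by
    refine fracRank_eq_of_le B ?_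
    have e : (B.map constantCoeff).row = fun i => E i 0 := by
      funext i s
      rw [Matrix.row, Matrix.map_apply, hB, Matrix.of_apply, constantCoeff_subst' hΞ,
        constantCoeff_formalField]
    have := LinearIndependent.rank_matrix (M := B.map constantCoeff) (by rw [e]; exact hli)
    rwa [Fintype.card_fin] at this
  rw [← h1, fracRank, Matrix.rank_eq_finrank_span_row, fracRank]
  refine Submodule.finrank_mono ?_
  rw [Submodule.span_le]
  rintro _ ⟨i, rfl⟩
  exact mem_range_of_isRelated (h _ (hE i))

end Related

/-! ### The lower bound, stabilization and finite type. -/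

section FiniteType

variable {N n d : ℕ} {M : Set (Fin N → ℂ)} {r : Fin d → (Fin N → ℂ) → ℝ}
  {γ : Fin N → MvPowerSeries (Fin N ⊕ Fin n) ℂ}

/-- The function Y r_j vanishes only on `M`, not near 0; its Taylor series nevertheless vanishes
along the Segre point because the latter lies in the complexification. -/
theorem IsSegreVarietyMapping.sum_formalDiffMatrix_mul (hγ : IsSegreVarietyMapping r γ)
    (hN : n + d = N) (hr : IsDefiningFunction M r) (hM : IsGenericSubmanifold M d) (i : ℕ)
    {Y : VField N} (hY : IsTangentField M Y) (j : Fin d) :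
    ∑ s, formalDiffMatrix r (segrePoint γ i) j s * subst (segrePoint γ i) (formalField Y s) =
      0 := by
  have hΞ := constantCoeff_segrePoint hγ.constantCoeff i
  have h1 := hγ.subst_taylorSeries_eq_zero hN hr hM
    (hY.1.applyVField (hr.smoothNear_ofReal j))
    (vanishesNear_applyVField hY.eventually (hr.smoothNear_ofReal j) (hr.vanishesNear j))
    (constantCoeff_iteratedSegre hγ.constantCoeff (i + 1))
    (constantCoeff_segreBase hγ.constantCoeff i) (hγ.subst_segrePoint_eq_zero i)
  rw [taylorSeries_applyVField hY.1 (hr.smoothNear_ofReal j), applyField] at h1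
  change subst (segrePoint γ i) _ = 0 at h1
  rw [subst_sum hΞ] at h1
  rw [← h1]
  refine Finset.sum_congr rfl fun s _ => ?_
  rw [subst_mul (hasSubst_of_constantCoeff_zero hΞ), mul_comm]
  rfl

theorem IsSegreVarietyMapping.isRelated_of_vanish (hγ : IsSegreVarietyMapping r γ)
    (hN : n + d = N) (hr : IsDefiningFunction M r) (hM : IsGenericSubmanifold M d) (i : ℕ)
    {Y : VField N} (hY : IsTangentField M Y) (f f' : Fin N → Fin N ⊕ Fin N)
    (hf : ∀ F : Fin N ⊕ Fin N → FractionRing (MvPowerSeries (Fin (i + 1) × Fin n) ℂ),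
      ∑ s, F s = ∑ k, F (f k) + ∑ k, F (f' k))
    (hc : ∀ s, (∃ k, f k = s) ∨ ∃ k, f' k = s) (hD : ((diffMatrix r 0).submatrix id f).rank = d)
    (hA : n + fracRank ((jacobian (segrePoint γ i)).submatrix f' id) ≤
      fracRank (jacobian (segrePoint γ i)))
    (hYf : ∀ p k, Y p (f' k) = 0) : IsRelated (segrePoint γ i) Y := by
  have hΞ := constantCoeff_segrePoint hγ.constantCoeff i
  refine exists_mul_eq_of_fracRank hN (jacobian (segrePoint γ i))
    (formalDiffMatrix r (segrePoint γ i))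
    (formalDiffMatrix_mul_jacobian hΞ (hγ.subst_segrePoint_eq_zero i)) f f' hf hc ?_ hA ?_
    (hγ.sum_formalDiffMatrix_mul hN hr hM i hY)
  · refine fracRank_eq_of_le _ ?_
    rw [← Matrix.submatrix_map, hr.map_constantCoeff_formalDiffMatrix hΞ, hD]
  · intro k
    have : formalField Y (f' k) = 0 := by
      rw [formalField]
      simp_rw [hYf]
      exact taylorSeries_zero
    rw [this, subst_zero_series hΞ]

/-- If the rank of the iterated Segre mappings does not increase at one step, it has reached the
dimension of the formal orbit. -/
theorem IsSegreVarietyMapping.finrank_lieValues_le (hγ : IsSegreVarietyMapping r γ)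
    (hN : n + d = N) (hr : IsDefiningFunction M r) (hM : IsGenericSubmanifold M d) (j : ℕ)
    (h : genericRank (iteratedSegre γ (j + 1)) = genericRank (iteratedSegre γ j)) :
    Module.finrank ℂ (lieValues M) ≤ n + genericRank (iteratedSegre γ j) := by
  have hΞ := constantCoeff_segrePoint hγ.constantCoeff j
  have hrank := hγ.fracRank_jacobian_segrePoint hN hr hM j
  rw [← hrank]
  refine Segre.finrank_lieValues_le hΞ fun Y hY => ?_
  induction hY with
  | type_one_zero X hX hX0 =>
    -- The rank formula for the Segre point says that the projection to ζ has an n-dimensional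
    -- kernel; this needs no assumption on the next rank.
    refine hγ.isRelated_of_vanish hN hr hM j hX Sum.inl Sum.inr (fun F => Fintype.sum_sum_type F)
      (by rintro (k | k) <;> simp) (hr.rank_diffMatrix_inl hM) ?_ hX0
    rw [hrank, ← fracRank_jacobian_segreBase]
    rfl
  | type_zero_one X hX hX0 =>
    -- The projection to Z has rank Rk v^{j+1}. Only because this equals Rk v^j is its kernel also
    -- n-dimensional, which is where the stall enters.
    refine hγ.isRelated_of_vanish hN hr hM j hX Sum.inr Sum.inl
      (fun F => (Fintype.sum_sum_type F).trans (add_comm _ _))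
      (by rintro (k | k) <;> simp) (hr.rank_diffMatrix_inr hM) ?_ hX0
    rw [hrank, ← h]
    rfl
  | add X Y hX hY ihX ihY => exact ihX.add hΞ ihY hX.smoothNear hY.smoothNear
  | smul c X hX ihX => exact ihX.smul hΞ c hX.smoothNear
  | commutator X Y hX hY ihX ihY => exact ihX.bracket hΞ ihY hX.smoothNear hY.smoothNear

theorem IsDefiningFunction.complexTangentSpace_eq (hr : IsDefiningFunction M r)
    (hM : IsGenericSubmanifold M d) :
    complexTangentSpace M 0 = LinearMap.ker (diffMatrix r 0).mulVecLin := by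
  ext v
  rw [hr.eventually_mem_complexTangentSpace_iff.self_of_nhds hM.1, LinearMap.mem_ker, funext_iff]
  refine forall_congr' fun j => ?_
  rw [Matrix.mulVecLin_apply, Matrix.mulVec, dotProduct, Pi.zero_apply]
  simp_rw [mul_comm (v _)]
  rfl

theorem IsDefiningFunction.finrank_complexTangentSpace (hr : IsDefiningFunction M r)
    (hM : IsGenericSubmanifold M d) (hN : n + d = N) :
    Module.finrank ℂ (complexTangentSpace M 0) = n + N := by
  rw [hr.complexTangentSpace_eq hM]
  have h1 := LinearMap.finrank_range_add_finrank_ker (diffMatrix r 0).mulVecLin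
  rw [Module.finrank_fintype_fun_eq_card, Fintype.card_sum, Fintype.card_fin] at h1
  change (diffMatrix r 0).rank + _ = _ at h1
  have h2 := fracRank_submatrix_le (diffMatrix r 0) id Sum.inl
  rw [fracRank_field, fracRank_field, hr.rank_diffMatrix_inl hM] at h2
  have h3 := Matrix.rank_le_card_height (diffMatrix r 0)
  rw [Fintype.card_fin] at h3
  omega

/-- The values of 𝔤_M always lie in the complexified tangent space, of dimension 2N - d = n + N, so
equality is a matter of dimension. -/
theorem IsDefiningFunction.isFiniteType_iff (hr : IsDefiningFunction M r)
    (hM : IsGenericSubmanifold M d) (hN : n + d = N) :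
    IsFiniteType M ↔ Module.finrank ℂ (lieValues M) = n + N := by
  rw [← hr.finrank_complexTangentSpace hM hN]
  have hle : lieValues M ≤ complexTangentSpace M 0 := by
    refine Submodule.span_le.2 ?_
    rintro _ ⟨X, hX, rfl⟩
    exact hX.isTangentField.eventually.self_of_nhds hM.1
  constructor
  · intro h
    exact congrArg (fun V : Submodule ℂ (Fin N ⊕ Fin N → ℂ) => Module.finrank ℂ V) h
  · exact fun h => Submodule.eq_of_le_of_finrank_eq hle h

/-- k₀ is the first stall. The two estimates fix the rank there as the orbit dimension minus n; this
is also an upper bound for all j, so by monotonicity the rank never moves again. -/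
theorem IsSegreVarietyMapping.exists_stabilization (hγ : IsSegreVarietyMapping r γ)
    (hN : n + d = N) (hr : IsDefiningFunction M r) (hM : IsGenericSubmanifold M d) :
    ∃ k₀ : ℕ, 1 ≤ k₀ ∧ k₀ ≤ d + 1 ∧
      (∀ j : ℕ, k₀ ≤ j → genericRank (iteratedSegre γ j) = genericRank (iteratedSegre γ (j + 1))) ∧
      (∀ j : ℕ, 1 ≤ j → j < k₀ →
        genericRank (iteratedSegre γ j) < genericRank (iteratedSegre γ (j + 1))) ∧
      (IsFiniteType M ↔ genericRank (iteratedSegre γ k₀) = N) := by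
  classical
  have hmono := genericRank_iteratedSegre_le_succ hγ.constantCoeff
  -- The rank is at least n for v^1 and gains at least one at each step without a stall. As it never
  -- exceeds n + d, there are at most d such steps, whence k₀ ≤ d + 1.
  have hgrow : ∀ k, (∀ j, 1 ≤ j → j < k + 1 → genericRank (iteratedSegre γ (j + 1)) ≠
      genericRank (iteratedSegre γ j)) → n + k ≤ genericRank (iteratedSegre γ (k + 1)) := by
    intro k
    induction k with
    | zero =>
      exact fun _ => le_genericRank_iteratedSegre hγ.constantCoeff hγ.rank_eq 0
    | succ k ih =>
      intro h
      have h1 := ih fun j hj hjk => h j hj (by omega)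
      have h2 := h (k + 1) (by omega) (by omega)
      have h3 := hmono (k + 1) (by omega)
      omega
  have hex : ∃ j, 1 ≤ j ∧ genericRank (iteratedSegre γ (j + 1)) = genericRank (iteratedSegre γ j) := by
    by_contra hc
    push Not at hc
    have h1 := hgrow (d + 1) fun j hj _ => hc j hj
    have h2 := genericRank_le (iteratedSegre γ (d + 1 + 1))
    omega
  obtain ⟨h1, h2⟩ := Nat.find_spec hex
  have hmin : ∀ j, 1 ≤ j → j < Nat.find hex → genericRank (iteratedSegre γ (j + 1)) ≠
      genericRank (iteratedSegre γ j) := fun j hj hjk h => Nat.find_min hex hjk ⟨hj, h⟩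
  have hdim : Module.finrank ℂ (lieValues M) =
      n + genericRank (iteratedSegre γ (Nat.find hex)) :=
    le_antisymm (hγ.finrank_lieValues_le hN hr hM _ h2) (hγ.add_genericRank_le hN hr hM _)
  have hconst : ∀ j, Nat.find hex ≤ j → genericRank (iteratedSegre γ j) =
      genericRank (iteratedSegre γ (Nat.find hex)) := by
    intro j hj
    refine le_antisymm ?_ ?_
    · have := hγ.add_genericRank_le hN hr hM j
      omega
    · induction j, hj using Nat.le_induction with
      | base => exact le_rfl
      | succ j hj ih => exact ih.trans (hmono j (h1.trans hj))
  refine ⟨Nat.find hex, h1, ?_, fun j hj => ?_, fun j hj hjk => ?_, ?_⟩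
  · obtain ⟨k, hk⟩ : ∃ k, Nat.find hex = k + 1 := ⟨_, (Nat.sub_add_cancel h1).symm⟩
    have h3 := hgrow k fun j hj hjk => hmin j hj (by omega)
    have h4 := genericRank_le (iteratedSegre γ (k + 1))
    omega
  · rw [hconst j hj, hconst (j + 1) (by omega)]
  · exact lt_of_le_of_ne (hmono j hj) (hmin j hj hjk).symm
  · rw [hr.isFiniteType_iff hM hN, hdim]
    omega

end FiniteType

/-! ### Holomorphic functions of several variables are smooth. -/

section Holomorphic

variable {N : ℕ} {U : Set (Fin N → ℂ)} {f : (Fin N → ℂ) → ℂ}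

theorem deriv_comp_line {x : Fin N → ℂ} (hf : DifferentiableAt ℂ f x) (v : Fin N → ℂ) :
    deriv (fun z : ℂ => f (x + z • v)) 0 = fderiv ℂ f x v := by
  have h1 : HasDerivAt (fun z : ℂ => x + z • v) v 0 := by
    simpa using ((hasDerivAt_id (0 : ℂ)).smul_const v).const_add x
  have h2 : HasFDerivAt f (fderiv ℂ f x) (x + (0 : ℂ) • v) := by
    simpa using hf.hasFDerivAt
  exact (h2.comp_hasDerivAt 0 h1).deriv

/-- Cauchy's estimate on the complex line through `x` in direction `v`, on a disc of radius `δ /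
‖v‖`. -/
theorem norm_fderiv_le_of_closedBall {x : Fin N → ℂ} {δ B : ℝ} (hδ : 0 < δ) (hU : IsOpen U)
    (hf : DifferentiableOn ℂ f U) (hx : Metric.closedBall x δ ⊆ U)
    (hB : ∀ y ∈ Metric.closedBall x δ, ‖f y‖ ≤ B) : ‖fderiv ℂ f x‖ ≤ B / δ := by
  have hB0 : 0 ≤ B := (norm_nonneg _).trans (hB x (Metric.mem_closedBall_self hδ.le))
  refine ContinuousLinearMap.opNorm_le_bound _ (by positivity) fun v => ?_
  rcases eq_or_ne v 0 with rfl | hv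
  · simp
  have hv0 : 0 < ‖v‖ := norm_pos_iff.2 hv
  have hxU : x ∈ U := hx (Metric.mem_closedBall_self hδ.le)
  have hmem : ∀ z ∈ Metric.closedBall (0 : ℂ) (δ / ‖v‖), x + z • v ∈ Metric.closedBall x δ := by
    intro z hz
    rw [mem_closedBall_iff_norm, sub_zero, le_div_iff₀ hv0] at hz
    rwa [mem_closedBall_iff_norm, add_sub_cancel_left, norm_smul]
  rw [← deriv_comp_line (hf.differentiableAt (hU.mem_nhds hxU))]
  have hd : DifferentiableOn ℂ (fun z : ℂ => f (x + z • v)) (Metric.closedBall 0 (δ / ‖v‖)) :=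
    hf.comp (by fun_prop) fun z hz => hx (hmem z hz)
  have h3 := Complex.norm_deriv_le_of_forall_mem_sphere_norm_le (c := 0) (C := B)
    (div_pos hδ hv0) (hd.mono Metric.closure_ball_subset_closedBall).diffContOnCl
    fun z hz => hB _ (hmem z (Metric.sphere_subset_closedBall hz))
  calc _ ≤ _ := h3
    _ = B / δ * ‖v‖ := by field_simp

open MeasureTheory in
-- Cauchy's formula on the line x + ℂ v expresses the directional derivative as an integral of f
-- over a circle of fixed radius, which can be differentiated in x under the integral. The
-- dominating bound comes from Cauchy's estimate, so continuity of the derivative is not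
-- presupposed.
theorem differentiableOn_fderiv_apply (hU : IsOpen U) (hf : DifferentiableOn ℂ f U)
    (v : Fin N → ℂ) : DifferentiableOn ℂ (fun x => fderiv ℂ f x v) U := by
  intro x₀ hx₀
  refine DifferentiableAt.differentiableWithinAt ?_
  -- One δ for the variation of x, one for the circle of integration, one for Cauchy's estimate at
  -- its points.
  obtain ⟨δ, hδ, hball⟩ : ∃ δ > 0, Metric.closedBall x₀ (3 * δ) ⊆ U := by
    obtain ⟨ε, hε, h⟩ := Metric.nhds_basis_closedBall.mem_iff.1 (hU.mem_nhds hx₀)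
    exact ⟨ε / 3, by positivity, by rwa [mul_div_cancel₀ _ (by norm_num : (3 : ℝ) ≠ 0)]⟩
  obtain ⟨B, hB⟩ := (isCompact_closedBall x₀ (3 * δ)).exists_bound_of_continuousOn
    (hf.continuousOn.mono hball)
  set ε : ℝ := δ / (‖v‖ + 1) with hε
  have hε0 : 0 < ε := by positivity
  have hεv : ∀ z ∈ Metric.closedBall (0 : ℂ) ε, ‖z • v‖ ≤ δ := by
    intro z hz
    rw [mem_closedBall_iff_norm, sub_zero, hε, le_div_iff₀ (by positivity)] at hz
    rw [norm_smul]
    nlinarith [norm_nonneg z]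
  have hc : ∀ θ, circleMap 0 ε θ ∈ Metric.closedBall (0 : ℂ) ε := fun θ =>
    circleMap_mem_closedBall _ hε0.le _
  have hmem : ∀ x ∈ Metric.closedBall x₀ δ, ∀ z ∈ Metric.closedBall (0 : ℂ) ε,
      x + z • v ∈ Metric.closedBall x₀ (2 * δ) := by
    intro x hx z hz
    rw [mem_closedBall_iff_norm] at hx ⊢
    have := norm_add_le (x - x₀) (z • v)
    rw [add_sub_right_comm]
    linarith [hεv z hz]
  have h2U : Metric.closedBall x₀ (2 * δ) ⊆ U :=
    (Metric.closedBall_subset_closedBall (by linarith)).trans hball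
  have hfd : ∀ y ∈ Metric.closedBall x₀ (2 * δ), ‖fderiv ℂ f y‖ ≤ B / δ := by
    intro y hy
    have hsub : Metric.closedBall y δ ⊆ Metric.closedBall x₀ (3 * δ) :=
      Metric.closedBall_subset_closedBall' (by rw [Metric.mem_closedBall] at hy; linarith)
    exact norm_fderiv_le_of_closedBall hδ hU hf (hsub.trans hball) fun w hw => hB w (hsub hw)
  set w : ℝ → ℂ := fun θ => deriv (circleMap 0 ε) θ * ((circleMap 0 ε θ - 0) ^ 2)⁻¹ with hw
  have hwc : Continuous w := by
    refine Continuous.mul ?_ (Continuous.inv₀ (by fun_prop) fun θ => ?_)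
    · exact (continuous_congr fun θ => deriv_circleMap 0 ε θ).2 (by fun_prop)
    · rw [sub_zero]
      exact pow_ne_zero 2 (circleMap_ne_center hε0.ne')
  have hwn : ∀ θ, ‖w θ‖ = ε⁻¹ := by
    intro θ
    simp only [hw, norm_mul, norm_inv, norm_pow, sub_zero, deriv_circleMap, norm_circleMap_zero,
      abs_of_pos hε0, Complex.norm_I, mul_one]
    field_simp
  have hcauchy : ∀ x ∈ Metric.closedBall x₀ δ, fderiv ℂ f x v = (2 * Real.pi * Complex.I : ℂ)⁻¹ •
      ∫ θ in (0 : ℝ)..2 * Real.pi, w θ * f (x + circleMap 0 ε θ • v) := by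
    intro x hx
    have hxU : x ∈ U := h2U (Metric.closedBall_subset_closedBall (by linarith) hx)
    have hopen : IsOpen {z : ℂ | x + z • v ∈ U} := hU.preimage (by fun_prop)
    have h1 := Complex.two_pi_I_inv_smul_circleIntegral_sub_sq_inv_smul_of_differentiable hopen
      (c := 0) (w₀ := 0) (R := ε) (f := fun z => f (x + z • v))
      (fun z hz => h2U (hmem x hx z hz)) (hf.comp (by fun_prop) fun z hz => hz)
      (Metric.mem_ball_self hε0)
    rw [← deriv_comp_line (hf.differentiableAt (hU.mem_nhds hxU)), ← h1, circleIntegral]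
    simp only [smul_eq_mul, hw, mul_assoc]
  have hdiff : ∀ x ∈ Metric.closedBall x₀ δ, ∀ θ, HasFDerivAt
      (fun x => w θ * f (x + circleMap 0 ε θ • v))
      (w θ • fderiv ℂ f (x + circleMap 0 ε θ • v)) x := by
    intro x hx θ
    have h1 := (hf.differentiableAt (hU.mem_nhds (h2U (hmem x hx _ (hc θ))))).hasFDerivAt
    have h2 : HasFDerivAt (fun x => x + circleMap 0 ε θ • v)
      (ContinuousLinearMap.id ℂ (Fin N → ℂ)) x := (hasFDerivAt_id x).add_const _
    simpa using (h1.comp x h2).const_mul (w θ)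
  have hcont : ∀ x ∈ Metric.closedBall x₀ δ,
      Continuous fun θ => w θ * f (x + circleMap 0 ε θ • v) := by
    intro x hx
    refine hwc.mul (hf.continuousOn.comp_continuous (by fun_prop) fun θ => ?_)
    exact h2U (hmem x hx _ (hc θ))
  have key := intervalIntegral.hasFDerivAt_integral_of_dominated_of_fderiv_le (𝕜 := ℂ)
    (μ := volume) (a := 0) (b := 2 * Real.pi) (x₀ := x₀) (s := Metric.closedBall x₀ δ)
    (F := fun x θ => w θ * f (x + circleMap 0 ε θ • v))
    (F' := fun x θ => w θ • fderiv ℂ f (x + circleMap 0 ε θ • v))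
    (bound := fun _ => ε⁻¹ * (B / δ)) (Metric.closedBall_mem_nhds x₀ hδ) ?_ ?_ ?_ ?_ ?_ ?_
  · have h1 : (fun x => fderiv ℂ f x v) =ᶠ[𝓝 x₀] fun x => (2 * Real.pi * Complex.I : ℂ)⁻¹ •
        ∫ θ in (0 : ℝ)..2 * Real.pi, w θ * f (x + circleMap 0 ε θ • v) := by
      filter_upwards [Metric.closedBall_mem_nhds x₀ hδ] with x hx using hcauchy x hx
    exact (key.differentiableAt.fun_const_smul _).congr_of_eventuallyEq h1
  · filter_upwards [Metric.closedBall_mem_nhds x₀ hδ] with x hx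
    exact (hcont x hx).aestronglyMeasurable
  · exact (hcont x₀ (Metric.mem_closedBall_self hδ.le)).intervalIntegrable _ _
  · have h1 : Measurable fun θ => fderiv ℂ f (x₀ + circleMap 0 ε θ • v) :=
      (measurable_fderiv ℂ f).comp (by fun_prop : Continuous fun θ => x₀ + circleMap 0 ε θ • v).measurable
    exact (hwc.measurable.smul h1).aestronglyMeasurable
  · refine Eventually.of_forall fun θ _ x hx => ?_
    rw [norm_smul, hwn]
    exact mul_le_mul_of_nonneg_left (hfd _ (hmem x hx _ (hc θ))) (by positivity)
  · exact intervalIntegrable_const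
  · exact Eventually.of_forall fun θ _ x hx => hdiff x hx θ

/-- Holomorphic functions of several variables are smooth. -/
theorem contDiffOn_of_differentiableOn (hU : IsOpen U) (hf : DifferentiableOn ℂ f U) :
    ContDiffOn ℂ ∞ f U := by
  rw [contDiffOn_infty]
  intro n
  induction n generalizing f with
  | zero => simpa using hf.continuousOn
  | succ n ih =>
    push_cast
    rw [contDiffOn_succ_iff_fderiv_of_isOpen hU]
    refine ⟨hf, by simp, contDiffOn_clm_apply.2 fun v => ih (differentiableOn_fderiv_apply hU hf v)⟩

theorem smoothNear_of_differentiableOn {H : (Fin N → ℂ) → Fin N → ℂ} {p : Fin N → ℂ}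
    (hU : IsOpen U) (hp : p ∈ U) (hH : DifferentiableOn ℂ H U) : SmoothNear H p :=
  smoothNear_pi.2 fun k => ⟨U, hU, hp, ((contDiffOn_of_differentiableOn hU
    (differentiableOn_pi.1 hH k)).restrict_scalars ℝ)⟩

theorem wirtinger_inr_of_differentiableAt {p : Fin N → ℂ} (hf : DifferentiableAt ℂ f p)
    (k : Fin N) : wirtinger (Sum.inr k) f p = 0 := by
  have h1 : fderiv ℝ f p = (fderiv ℂ f p).restrictScalars ℝ :=
    (hf.hasFDerivAt.restrictScalars ℝ).fderiv
  have h2 : (Pi.single k Complex.I : Fin N → ℂ) = Complex.I • Pi.single k 1 := by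
    rw [← Pi.single_smul, smul_eq_mul, mul_one]
  simp only [wirtinger, h1, ContinuousLinearMap.coe_restrictScalars', h2, map_smul, smul_eq_mul]
  linear_combination (fderiv ℂ f p (Pi.single k 1)) * Complex.I_mul_I / 2

end Holomorphic

/-! ### Formal mappings between complexifications. -/

section FormalMap

variable {N n d : ℕ}

theorem fracRank_mul_le_right {m p q : Type*} [Fintype m] [Fintype p] [Fintype q] {R : Type*}
    [CommRing R] [IsDomain R] (A : Matrix m p R) (B : Matrix p q R) :
    fracRank (A * B) ≤ fracRank B := by
  rw [fracRank, Matrix.map_mul]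
  exact Matrix.rank_mul_le_right _ _

theorem genericRank_comp_le {σ : Type*} [Fintype σ] (g : Fin N → MvPowerSeries (Fin N) ℂ)
    {F : Fin N → MvPowerSeries σ ℂ} (hF : ∀ k, constantCoeff (F k) = 0) :
    genericRank (fun k => subst F (g k)) ≤ genericRank F := by
  rw [genericRank_eq, genericRank_eq, jacobian_subst g hF]
  exact fracRank_mul_le_right _ _

/-- F is recovered from h ∘ F by composing with g, and composition on the left does not raise the
rank. -/
theorem genericRank_le_comp {σ : Type*} [Fintype σ] {h g : Fin N → MvPowerSeries (Fin N) ℂ}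
    (hh : ∀ k, constantCoeff (h k) = 0) (hgh : ∀ k, subst h (g k) = X k)
    {F : Fin N → MvPowerSeries σ ℂ} (hF : ∀ k, constantCoeff (F k) = 0) :
    genericRank F ≤ genericRank fun k => subst F (h k) := by
  have h1 : F = fun k => subst (fun l => subst F (h l)) (g k) := by
    funext k
    rw [← subst_subst hh hF, hgh, subst_X (hasSubst_of_constantCoeff_zero hF)]
  conv_lhs => rw [h1]
  exact genericRank_comp_le g fun k => by rw [constantCoeff_subst' hF, hh]

/-- A formal mapping between the complexified varieties intertwines the iterated Segre mappings. -/
theorem exists_subst_iteratedSegre {ρ ρ' : Fin d → MvPowerSeries (Fin N ⊕ Fin N) ℂ}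
    {γ γ' : Fin N → MvPowerSeries (Fin N ⊕ Fin n) ℂ} (hγ : IsFormalParametrization ρ γ)
    (hγ' : IsFormalParametrization ρ' γ') {h : Fin N → MvPowerSeries (Fin N) ℂ}
    (hh : ∀ k, constantCoeff (h k) = 0)
    (hmap : ∀ {σ : Type} [Finite σ] {a b : Fin N → MvPowerSeries σ ℂ},
      (∀ k, constantCoeff (a k) = 0) → (∀ k, constantCoeff (b k) = 0) →
      (∀ j, subst (Sum.elim a b) (ρ j) = 0) → ∀ j, subst (Sum.elim (fun k => subst a (h k))
        fun k => subst b (conjSeries (h k))) (ρ' j) = 0) (j : ℕ) :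
    ∃ θ : Fin j × Fin n → MvPowerSeries (Fin j × Fin n) ℂ, (∀ s, constantCoeff (θ s) = 0) ∧
      ∀ k, subst (iteratedSegre γ j) (h k) = subst θ (iteratedSegre γ' j k) := by
  have hv := constantCoeff_iteratedSegre hγ.constantCoeff
  have hv' := constantCoeff_iteratedSegre hγ'.constantCoeff
  induction j with
  | zero =>
    refine ⟨0, by simp, fun k => ?_⟩
    have : iteratedSegre γ 0 = 0 := rfl
    rw [this]
    change _ = subst _ (0 : MvPowerSeries (Fin 0 × Fin n) ℂ)
    rw [subst_zero_of_constantCoeff_zero (hh k), subst_zero_series (by simp)]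
  | succ j ih =>
    obtain ⟨θ, hθ, hθv⟩ := ih
    have hb := constantCoeff_segreBase hγ.constantCoeff j
    have hb' := constantCoeff_segreBase hγ'.constantCoeff j
    have hρ : ∀ i, subst (segrePoint γ j) (ρ i) = 0 := fun i => by
      rw [subst_segrePoint hγ.constantCoeff, hγ.subst_eq_zero, subst_zero_series
        (constantCoeff_elim hb (by simp))]
    have h1 := hmap (hv (j + 1)) hb hρ
    -- The image (h(v^{j+1}), h̄(v̄^j)) of the Segre point lies on the target variety, so its first
    -- component is γ'(h̄(v̄^j), τ).
    obtain ⟨τ, hτ, h2⟩ := hγ'.exists_parameter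
      (fun k => by rw [constantCoeff_subst' (hv _), hh])
      (fun k => by rw [constantCoeff_subst' hb, constantCoeff_conjSeries, hh, map_zero]) h1
    -- The old blocks of the substitution are conjugated because v^{j+1} involves v^j through its
    -- conjugate.
    let θ' : Fin (j + 1) × Fin n → MvPowerSeries (Fin (j + 1) × Fin n) ℂ := fun s =>
      Fin.lastCases (motive := fun _ => MvPowerSeries (Fin (j + 1) × Fin n) ℂ) (τ s.2)
        (fun a => liftSeries (conjSeries (θ (a, s.2)))) s.1
    have hlast : ∀ i, θ' (Fin.last j, i) = τ i := fun i => by simp [θ']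
    have hcast : ∀ s : Fin j × Fin n, θ' (s.1.castSucc, s.2) = liftSeries (conjSeries (θ s)) :=
      fun s => by simp [θ']
    have hθ' : ∀ s, constantCoeff (θ' s) = 0 := by
      rintro ⟨a, i⟩
      induction a using Fin.lastCases with
      | last => rw [hlast, hτ]
      | cast a =>
        rw [hcast (a, i), constantCoeff_liftSeries, constantCoeff_conjSeries, hθ, map_zero]
    have hs' := hasSubst_of_constantCoeff_zero hθ'
    refine ⟨θ', hθ', fun k => ?_⟩
    have hbase : ∀ l, subst θ' (segreBase γ' j l) = subst (segreBase γ j) (conjSeries (h l)) := by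
      intro l
      rw [segreBase, subst_liftSeries hθ']
      simp_rw [hcast]
      rw [← liftSeries_subst (by simp [hθ]), ← conjSeries_subst hθ, ← hθv, conjSeries_subst (hv j),
        liftSeries_subst (by simp [hv j])]
      rfl
    rw [h2, iteratedSegre_succ, subst_subst (constantCoeff_elim hb' (by simp)) hθ']
    congr 1
    funext s
    cases s with
    | inl l => exact (hbase l).symm
    | inr i => rw [Sum.elim_inr, Sum.elim_inr, subst_X hs', hlast]

theorem genericRank_iteratedSegre_le_of_map {ρ ρ' : Fin d → MvPowerSeries (Fin N ⊕ Fin N) ℂ}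
    {γ γ' : Fin N → MvPowerSeries (Fin N ⊕ Fin n) ℂ} (hγ : IsFormalParametrization ρ γ)
    (hγ' : IsFormalParametrization ρ' γ') {h g : Fin N → MvPowerSeries (Fin N) ℂ}
    (hh : ∀ k, constantCoeff (h k) = 0) (hgh : ∀ k, subst h (g k) = X k)
    (hmap : ∀ {σ : Type} [Finite σ] {a b : Fin N → MvPowerSeries σ ℂ},
      (∀ k, constantCoeff (a k) = 0) → (∀ k, constantCoeff (b k) = 0) →
      (∀ j, subst (Sum.elim a b) (ρ j) = 0) → ∀ j, subst (Sum.elim (fun k => subst a (h k))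
        fun k => subst b (conjSeries (h k))) (ρ' j) = 0) (j : ℕ) :
    genericRank (iteratedSegre γ j) ≤ genericRank (iteratedSegre γ' j) := by
  obtain ⟨θ, hθ, h1⟩ := exists_subst_iteratedSegre hγ hγ' hh hmap j
  refine (genericRank_le_comp hh hgh (constantCoeff_iteratedSegre hγ.constantCoeff j)).trans ?_
  simp_rw [h1]
  exact genericRank_subst_le _ hθ

end FormalMap

/-! ### Taylor series of holomorphic mappings. -/

section HolomorphicMap

variable {N n d : ℕ}

/-- Vanishing ζ-derivatives leave only monomials in Z, so the values substituted for ζ are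
irrelevant; this is the formal trace of the Cauchy–Riemann equations. -/
theorem subst_elim_eq_of_pderiv_inr {σ : Type*} {f : MvPowerSeries (Fin N ⊕ Fin N) ℂ}
    (hf : ∀ k, pderiv ℂ (Sum.inr k) f = 0) {a b b' : Fin N → MvPowerSeries σ ℂ}
    (ha : ∀ k, constantCoeff (a k) = 0) (hb : ∀ k, constantCoeff (b k) = 0)
    (hb' : ∀ k, constantCoeff (b' k) = 0) :
    subst (Sum.elim a b) f = subst (Sum.elim a b') f := by
  classical
  have hcoeff : ∀ e : Fin N ⊕ Fin N →₀ ℕ, (∃ k, e (Sum.inr k) ≠ 0) → coeff e f = 0 := by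
    rintro e ⟨k, hk⟩
    obtain ⟨e', rfl⟩ := exists_add_of_le (a := Finsupp.single (Sum.inr k) 1) (b := e) (by
      rw [Finsupp.single_le_iff]
      exact Nat.one_le_iff_ne_zero.2 hk)
    have h1 := congrArg (coeff e') (hf k)
    rw [coeff_pderiv, map_zero, add_comm] at h1
    exact (mul_eq_zero.1 h1).resolve_right (Nat.cast_add_one_ne_zero _)
  ext e
  rw [coeff_subst (hasSubst_of_constantCoeff_zero (constantCoeff_elim ha hb)),
    coeff_subst (hasSubst_of_constantCoeff_zero (constantCoeff_elim ha hb'))]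
  refine finsum_congr fun m => ?_
  by_cases hm : ∃ k, m (Sum.inr k) ≠ 0
  · rw [hcoeff m hm, zero_smul, zero_smul]
  · push Not at hm
    congr 2
    refine Finset.prod_congr rfl fun s hs => ?_
    cases s with
    | inl k => rfl
    | inr k => exact absurd (hm k) (Finsupp.mem_support_iff.1 hs)

/-- The Taylor series in `Z` of a holomorphic function. -/
noncomputable def holomorphicSeries (f : (Fin N → ℂ) → ℂ) : MvPowerSeries (Fin N) ℂ :=
  subst (Sum.elim X 0) (taylorSeries f)

section

variable {U : Set (Fin N → ℂ)} {f : (Fin N → ℂ) → ℂ} {H : (Fin N → ℂ) → Fin N → ℂ}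

theorem constantCoeff_holomorphicSeries (f : (Fin N → ℂ) → ℂ) :
    constantCoeff (holomorphicSeries f) = f 0 := by
  rw [holomorphicSeries, constantCoeff_subst' (constantCoeff_elim (by simp) (by simp)),
    constantCoeff_taylorSeries]

theorem subst_taylorSeries_of_holomorphic (hU : IsOpen U) (h0 : (0 : Fin N → ℂ) ∈ U)
    (hf : DifferentiableOn ℂ f U) {σ : Type*} {a b : Fin N → MvPowerSeries σ ℂ}
    (ha : ∀ k, constantCoeff (a k) = 0) (hb : ∀ k, constantCoeff (b k) = 0) :
    subst (Sum.elim a b) (taylorSeries f) = subst a (holomorphicSeries f) := by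
  have hX : ∀ s, constantCoeff (Sum.elim X 0 s : MvPowerSeries (Fin N) ℂ) = 0 :=
    constantCoeff_elim (fun k : Fin N => constantCoeff_X k) (fun k : Fin N => map_zero _)
  have hs : SmoothNear f 0 :=
    ⟨U, hU, h0, (contDiffOn_of_differentiableOn hU hf).restrict_scalars ℝ⟩
  have hp : ∀ k, pderiv ℂ (Sum.inr k) (taylorSeries f) = 0 := by
    intro k
    rw [pderiv_taylorSeries hs, ← taylorSeries_zero]
    refine taylorSeries_congr ?_
    filter_upwards [hU.mem_nhds h0] with q hq
    exact wirtinger_inr_of_differentiableAt (hf.differentiableAt (hU.mem_nhds hq)) k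
  rw [holomorphicSeries, subst_subst hX ha]
  rw [subst_elim_eq_of_pderiv_inr hp ha hb (b' := 0) (by simp)]
  congr 1
  funext s
  cases s with
  | inl k => rw [Sum.elim_inl, Sum.elim_inl, subst_X (hasSubst_of_constantCoeff_zero ha)]
  | inr k => rw [Sum.elim_inr, Sum.elim_inr, Pi.zero_apply, Pi.zero_apply, subst_zero_series ha]

theorem subst_taylorSeries_coord (hU : IsOpen U) (h0 : (0 : Fin N → ℂ) ∈ U)
    (hH : DifferentiableOn ℂ H U) {σ : Type*} [Finite σ] {a b : Fin N → MvPowerSeries σ ℂ}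
    (ha : ∀ k, constantCoeff (a k) = 0) (hb : ∀ k, constantCoeff (b k) = 0) (s : Fin N ⊕ Fin N) :
    subst (Sum.elim a b) (taylorSeries fun q => coord s (H q)) =
      Sum.elim (fun k => subst a (holomorphicSeries fun q => H q k))
        (fun k => subst b (conjSeries (holomorphicSeries fun q => H q k))) s := by
  have hk := differentiableOn_pi.1 hH
  cases s with
  | inl k => exact subst_taylorSeries_of_holomorphic hU h0 (hk k) ha hb
  | inr k =>
    have hs : SmoothNear (fun q => H q k) 0 :=
      ⟨U, hU, h0, (contDiffOn_of_differentiableOn hU (hk k)).restrict_scalars ℝ⟩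
    have h1 : (fun q => coord (Sum.inr k) (H q)) = fun q => starRingEnd ℂ (H q k) := rfl
    have ha' : ∀ k, constantCoeff (conjSeries (a k)) = 0 := by simp [ha]
    have hb' : ∀ k, constantCoeff (conjSeries (b k)) = 0 := by simp [hb]
    have h2 := conjSeries_subst_elim hb' ha' (taylorSeries fun q => H q k)
    simp only [conjSeries_conjSeries] at h2
    rw [h1, taylorSeries_conj hs, ← h2, subst_taylorSeries_of_holomorphic hU h0 (hk k) hb' ha',
      conjSeries_subst hb']
    simp only [conjSeries_conjSeries, Sum.elim_inr]

theorem subst_taylorSeries_comp (hU : IsOpen U) (h0 : (0 : Fin N → ℂ) ∈ U)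
    (hH : DifferentiableOn ℂ H U) (hH0 : H 0 = 0) (hf : SmoothNear f 0) {σ : Type*} [Finite σ]
    {a b : Fin N → MvPowerSeries σ ℂ} (ha : ∀ k, constantCoeff (a k) = 0)
    (hb : ∀ k, constantCoeff (b k) = 0) :
    subst (Sum.elim a b) (taylorSeries fun q => f (H q)) =
      subst (Sum.elim (fun k => subst a (holomorphicSeries fun q => H q k))
        (fun k => subst b (conjSeries (holomorphicSeries fun q => H q k)))) (taylorSeries f) := by
  rw [taylorSeries_comp hH0 (smoothNear_of_differentiableOn hU h0 hH) hf,
    subst_subst (fun u => by rw [constantCoeff_taylorSeries, hH0, map_zero])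
      (constantCoeff_elim ha hb)]
  congr 1
  funext s
  exact subst_taylorSeries_coord hU h0 hH ha hb s

theorem subst_holomorphicSeries_leftInverse {V : Set (Fin N → ℂ)} {G : (Fin N → ℂ) → Fin N → ℂ}
    (hU : IsOpen U) (h0 : (0 : Fin N → ℂ) ∈ U) (hH : DifferentiableOn ℂ H U) (hH0 : H 0 = 0)
    (hV : IsOpen V) (h0' : (0 : Fin N → ℂ) ∈ V) (hG : DifferentiableOn ℂ G V)
    (hGH : ∀ᶠ q in 𝓝 0, G (H q) = q) (k : Fin N) :
    subst (fun k => holomorphicSeries fun q => H q k) (holomorphicSeries fun q => G q k) = X k := by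
  have hGk := differentiableOn_pi.1 hG k
  have hs : SmoothNear (fun q => G q k) 0 :=
    ⟨V, hV, h0', (contDiffOn_of_differentiableOn hV hGk).restrict_scalars ℝ⟩
  have hX : ∀ k, constantCoeff (X k : MvPowerSeries (Fin N) ℂ) = 0 := by simp
  have h1 := subst_taylorSeries_comp hU h0 hH hH0 hs (a := (X : Fin N → MvPowerSeries (Fin N) ℂ))
    (b := 0) hX (by simp)
  have h2 : taylorSeries (fun q => G (H q) k) = X (Sum.inl k) := by
    rw [← taylorSeries_coord]
    refine taylorSeries_congr ?_
    filter_upwards [hGH] with q hq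
    rw [hq]
    rfl
  have h3 : ∀ f : MvPowerSeries (Fin N) ℂ, subst (X : Fin N → MvPowerSeries (Fin N) ℂ) f = f :=
    fun f => by rw [subst_self]; rfl
  have hc : ∀ k, constantCoeff (holomorphicSeries fun q => H q k) = 0 := fun k => by
    rw [constantCoeff_holomorphicSeries, hH0]; rfl
  rw [h2, subst_X (hasSubst_of_constantCoeff_zero (constantCoeff_elim hX (by simp)))] at h1
  simp only [h3] at h1
  rw [subst_taylorSeries_of_holomorphic hV h0' hGk hc] at h1
  · exact h1.symm
  · intro k
    rw [constantCoeff_subst' (by simp), constantCoeff_conjSeries, hc, map_zero]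

end

end HolomorphicMap

/-! ### Invariance under changes of coordinates, defining function and Segre variety mapping. -/

section CoordinateChange

variable {N n d : ℕ} {M : Set (Fin N → ℂ)} {H : OpenPartialHomeomorph (Fin N → ℂ) (Fin N → ℂ)}

theorem isDefiningFunction_of_eventually {r : Fin d → (Fin N → ℂ) → ℝ}
    (hs : ∀ j, SmoothNear (r j) 0) (hli : LinearIndependent ℝ fun j => fderiv ℝ (r j) 0)
    (h : ∀ᶠ q in 𝓝 0, (q ∈ M ↔ ∀ j, r j q = 0)) : IsDefiningFunction M r := by
  refine ⟨hs, hli, ?_⟩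
  obtain ⟨U, hUs, hU, hp⟩ := eventually_nhds_iff.1 h
  refine ⟨U, hU, hp, ?_⟩
  ext q
  exact and_congr_left fun hq => hUs q hq

theorem IsHolomorphicCoordinateChange.symm (hH : IsHolomorphicCoordinateChange H) :
    IsHolomorphicCoordinateChange H.symm where
  zero_mem := by
    have := H.map_source hH.zero_mem
    rwa [hH.map_zero] at this
  map_zero := by
    have := H.left_inv hH.zero_mem
    rwa [hH.map_zero] at this
  holomorphic := hH.holomorphic_symm
  holomorphic_symm := by simpa using hH.holomorphic

theorem IsHolomorphicCoordinateChange.eventually_symm_apply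
    (hH : IsHolomorphicCoordinateChange H) : ∀ᶠ q in 𝓝 0, H.symm (H q) = q := by
  filter_upwards [H.open_source.mem_nhds hH.zero_mem] with q hq using H.left_inv hq

theorem IsHolomorphicCoordinateChange.smoothNear (hH : IsHolomorphicCoordinateChange H) :
    SmoothNear H 0 := smoothNear_of_differentiableOn H.open_source hH.zero_mem hH.holomorphic

theorem IsHolomorphicCoordinateChange.surjective_fderiv (hH : IsHolomorphicCoordinateChange H) :
    Function.Surjective (fderiv ℝ H 0) := by
  have h1 := hH.symm.smoothNear.differentiableAt.hasFDerivAt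
  have h2 := hH.smoothNear.differentiableAt
  rw [← hH.symm.map_zero] at h2
  have h3 := (h2.hasFDerivAt.comp 0 h1)
  have h4 : (fun q => q) =ᶠ[𝓝 0] H ∘ H.symm := by
    filter_upwards [hH.symm.eventually_symm_apply] with q hq
    exact (by simpa using hq.symm)
  have h5 := (h3.congr_of_eventuallyEq h4).unique (hasFDerivAt_id 0)
  rw [hH.symm.map_zero] at h5
  intro v
  exact ⟨fderiv ℝ H.symm 0 v, DFunLike.congr_fun h5 v⟩

theorem IsHolomorphicCoordinateChange.isDefiningFunction_comp
    (hH : IsHolomorphicCoordinateChange H) {r' : Fin d → (Fin N → ℂ) → ℝ}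
    (hr' : IsDefiningFunction (H '' (M ∩ H.source)) r') :
    IsDefiningFunction M fun j q => r' j (H q) := by
  have hcont := hH.smoothNear.contDiffAt.continuousAt
  have hmem := hr'.eventually_mem_iff
  rw [← hH.map_zero] at hmem
  refine isDefiningFunction_of_eventually
    (fun j => SmoothNear.comp (by rw [hH.map_zero]; exact hr'.smooth j) hH.smoothNear) ?_ ?_
  · have h1 : ∀ j, fderiv ℝ (fun q => r' j (H q)) 0 =
        (ContinuousLinearMap.precomp ℝ (fderiv ℝ H 0)) (fderiv ℝ (r' j) 0) := by
      intro j
      have h2 : DifferentiableAt ℝ (r' j) (H 0) := by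
        rw [hH.map_zero]; exact (hr'.smooth j).differentiableAt
      have h3 := (h2.hasFDerivAt.comp 0 hH.smoothNear.differentiableAt.hasFDerivAt).fderiv
      rw [hH.map_zero] at h3
      exact h3
    simp_rw [h1]
    refine hr'.linearIndependent.map' (ContinuousLinearMap.precomp ℝ (fderiv ℝ H 0)).toLinearMap
      (LinearMap.ker_eq_bot.2 fun L L' hLL => ?_)
    ext v
    obtain ⟨w, rfl⟩ := hH.surjective_fderiv v
    exact DFunLike.congr_fun hLL w
  · filter_upwards [hcont.eventually hmem, H.open_source.mem_nhds hH.zero_mem] with q h1 hq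
    rw [← h1]
    constructor
    · exact fun h => ⟨q, ⟨h, hq⟩, rfl⟩
    · rintro ⟨q', ⟨h, hq'⟩, e⟩
      rwa [← H.injOn hq' hq e]

theorem IsHolomorphicCoordinateChange.wirtinger_comp (hH : IsHolomorphicCoordinateChange H)
    {f : (Fin N → ℂ) → ℂ} (hf : SmoothNear f 0) (k : Fin N) :
    wirtinger (Sum.inl k) (fun q => f (H q)) 0 =
      ∑ l, wirtinger (Sum.inl l) f 0 * wirtinger (Sum.inl k) (fun q => H q l) 0 := by
  rw [Segre.wirtinger_comp (by rw [hH.map_zero]; exact hf.differentiableAt)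
    hH.smoothNear.differentiableAt, Fintype.sum_sum_type, hH.map_zero]
  have h1 : ∀ l, wirtinger (Sum.inl k) (fun q => coord (Sum.inr l) (H q)) (0 : Fin N → ℂ) = 0 := by
    intro l
    have h2 : (fun q => coord (Sum.inr l) (H q)) = fun q => starRingEnd ℂ (H q l) := rfl
    have h3 := differentiableOn_pi.1 hH.holomorphic l
    rw [h2, wirtinger_conj, Sum.swap_inl, wirtinger_inr_of_differentiableAt
      (h3.differentiableAt (H.open_source.mem_nhds hH.zero_mem))]
    exact _root_.map_zero _
  simp_rw [h1, mul_zero, Finset.sum_const_zero, add_zero]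
  rfl

theorem IsHolomorphicCoordinateChange.isGenericSubmanifold_image
    (hH : IsHolomorphicCoordinateChange H) (hM : IsGenericSubmanifold M d)
    {r' : Fin d → (Fin N → ℂ) → ℝ} (hr' : IsDefiningFunction (H '' (M ∩ H.source)) r') :
    IsGenericSubmanifold (H '' (M ∩ H.source)) d := by
  refine ⟨⟨0, ⟨hM.1, hH.zero_mem⟩, hH.map_zero⟩, r', hr', ?_⟩
  have h1 := (hH.isDefiningFunction_comp hr').rank_diffMatrix_inl hM
  set A := (diffMatrix r' 0).submatrix id Sum.inl with hA
  have h2 : (diffMatrix (fun j q => r' j (H q)) 0).submatrix id Sum.inl =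
      A * Matrix.of fun l k : Fin N => wirtinger (Sum.inl k) (fun q => H q l) 0 := by
    ext j k
    rw [Matrix.mul_apply]
    exact hH.wirtinger_comp (hr'.smoothNear_ofReal j) k
  have h3 : A.rank = d := by
    refine le_antisymm (Matrix.rank_le_height _) ?_
    conv_lhs => rw [← h1, h2]
    exact Matrix.rank_mul_le_left _ _
  change LinearIndependent ℂ A.row
  rw [linearIndependent_iff_card_eq_finrank_span, Set.finrank, ← Matrix.rank_eq_finrank_span_row,
    h3, Fintype.card_fin]

/-- The functions r'_j ∘ H vanish on `M`, so their Taylor series vanish on its complexification.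
This says that the formal mapping (h, h̄) induced by `H` maps one complexification into the other,
as the comparison of Segre mappings requires. -/
theorem IsSegreVarietyMapping.genericRank_le_of_coordinateChange (hN : n + d = N)
    (hM : IsGenericSubmanifold M d) {r r' : Fin d → (Fin N → ℂ) → ℝ}
    (hr : IsDefiningFunction M r) {γ γ' : Fin N → MvPowerSeries (Fin N ⊕ Fin n) ℂ}
    (hγ : IsSegreVarietyMapping r γ) (hH : IsHolomorphicCoordinateChange H)
    (hr' : IsDefiningFunction (H '' (M ∩ H.source)) r') (hγ' : IsSegreVarietyMapping r' γ')
    (j : ℕ) : genericRank (iteratedSegre γ j) ≤ genericRank (iteratedSegre γ' j) := by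
  have hM' := hH.isGenericSubmanifold_image hM hr'
  have hcomp := hH.isDefiningFunction_comp hr'
  refine genericRank_iteratedSegre_le_of_map (hγ.isFormalParametrization hN hr hM)
    (hγ'.isFormalParametrization hN hr' hM') (h := fun k => holomorphicSeries fun q => H q k)
    (fun k => by rw [constantCoeff_holomorphicSeries, hH.map_zero]; rfl)
    (subst_holomorphicSeries_leftInverse H.open_source hH.zero_mem hH.holomorphic hH.map_zero
      H.open_target hH.symm.zero_mem hH.holomorphic_symm hH.eventually_symm_apply) ?_ j
  intro σ _ a b ha hb hab i
  rw [← subst_taylorSeries_comp H.open_source hH.zero_mem hH.holomorphic hH.map_zero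
    (hr'.smoothNear_ofReal i) ha hb]
  exact hγ.subst_taylorSeries_eq_zero hN hr hM (hcomp.smoothNear_ofReal i) (hcomp.vanishesNear i)
    ha hb hab

/-- The ranks of the iterated Segre mappings are invariant under changes of coordinates, of the
defining function and of the Segre variety mapping. -/
theorem IsSegreVarietyMapping.genericRank_eq_of_coordinateChange (hN : n + d = N)
    (hM : IsGenericSubmanifold M d) {r r' : Fin d → (Fin N → ℂ) → ℝ}
    (hr : IsDefiningFunction M r) {γ γ' : Fin N → MvPowerSeries (Fin N ⊕ Fin n) ℂ}
    (hγ : IsSegreVarietyMapping r γ) (hH : IsHolomorphicCoordinateChange H)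
    (hr' : IsDefiningFunction (H '' (M ∩ H.source)) r') (hγ' : IsSegreVarietyMapping r' γ')
    (j : ℕ) : genericRank (iteratedSegre γ' j) = genericRank (iteratedSegre γ j) := by
  refine le_antisymm ?_ (hγ.genericRank_le_of_coordinateChange hN hM hr hH hr' hγ' j)
  -- The reverse inequality is the same statement for the inverse of `H`. It leads back to `M ∩
  -- H.source`, which has the same germ at 0 as `M` and hence the same defining function `r`.
  refine hγ'.genericRank_le_of_coordinateChange hN (hH.isGenericSubmanifold_image hM hr') hr'
    hH.symm ?_ hγ j
  have h1 : H.symm '' (H '' (M ∩ H.source) ∩ H.symm.source) = M ∩ H.source := by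
    ext q
    constructor
    · rintro ⟨_, ⟨⟨q', hq', rfl⟩, -⟩, rfl⟩
      rwa [H.left_inv hq'.2]
    · exact fun hq => ⟨H q, ⟨⟨q, hq, rfl⟩, H.map_source hq.2⟩, H.left_inv hq.2⟩
  rw [h1]
  refine isDefiningFunction_of_eventually hr.smooth hr.linearIndependent ?_
  filter_upwards [hr.eventually_mem_iff, H.open_source.mem_nhds hH.zero_mem] with q h2 h3
  rw [← h2]
  exact ⟨fun h => h.1, fun h => ⟨h, h3⟩⟩

end CoordinateChange

end Segre

theorem theorem1p1 {N n d : ℕ} (hN : n + d = N)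
    (M : Set (Fin N → ℂ)) (hM : Segre.IsGenericSubmanifold M d)
    (r : Fin d → (Fin N → ℂ) → ℝ) (hr : Segre.IsDefiningFunction M r)
    (γ : Fin N → MvPowerSeries (Fin N ⊕ Fin n) ℂ) (hγ : Segre.IsSegreVarietyMapping r γ) :
    -- the rank is increasing in `j`
    (∀ j : ℕ, 1 ≤ j → Segre.genericRank (Segre.iteratedSegre γ j) ≤
      Segre.genericRank (Segre.iteratedSegre γ (j + 1))) ∧
    -- the rank does not depend on the coordinates, the defining function and the Segre mapping
    (∀ H : OpenPartialHomeomorph (Fin N → ℂ) (Fin N → ℂ),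
      Segre.IsHolomorphicCoordinateChange H →
      ∀ r' : Fin d → (Fin N → ℂ) → ℝ, Segre.IsDefiningFunction (H '' (M ∩ H.source)) r' →
      ∀ γ' : Fin N → MvPowerSeries (Fin N ⊕ Fin n) ℂ, Segre.IsSegreVarietyMapping r' γ' →
      ∀ j : ℕ, 1 ≤ j → Segre.genericRank (Segre.iteratedSegre γ' j) =
        Segre.genericRank (Segre.iteratedSegre γ j)) ∧
    -- stabilization at some `k₀`, and the characterization of finite type
    ∃ k₀ : ℕ, 1 ≤ k₀ ∧ k₀ ≤ d + 1 ∧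
      (∀ j : ℕ, k₀ ≤ j → Segre.genericRank (Segre.iteratedSegre γ j) =
        Segre.genericRank (Segre.iteratedSegre γ (j + 1))) ∧
      (∀ j : ℕ, 1 ≤ j → j < k₀ → Segre.genericRank (Segre.iteratedSegre γ j) <
        Segre.genericRank (Segre.iteratedSegre γ (j + 1))) ∧
      (Segre.IsFiniteType M ↔ Segre.genericRank (Segre.iteratedSegre γ k₀) = N) :=
  ⟨Segre.genericRank_iteratedSegre_le_succ hγ.constantCoeff,
    fun _ hH _ hr' _ hγ' j _ => hγ.genericRank_eq_of_coordinateChange hN hM hr hH hr' hγ' j,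
    hγ.exists_stabilization hN hr hM⟩
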